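/- Let $(M,\theta)$ be a Liouville manifold with cylindrical end: $\omega=d\theta$ is symplectic and $M=M^{in}\cup_{\partial M^{in}}(\partial M^{in}\times[1,\infty))$, where $M^{in}$ is compact with closed boundary $\partial M^{in}$ and, on the end $\partial M^{in}\times(0,\infty)\subset M$ (the infinite cone together with a collar of $\partial M^{in}$ in $M^{in}$), $\theta=r\alpha$ with $\alpha=\theta|_{\partial M^{in}}$ and $r$ the radial coordinate. Hamiltonian vector fields are defined by $\omega(X_F,\cdot)=-dF$. Let $K,L\subset M$ be Lagrangian submanifolds with (possibly empty) Legendrian ends, i.e. of the form $\Lambda\times(R,\infty)$ on the part $\{r>R\}$ of the end for some $R$. Let $(W_s)_{s\in[0,1]}$ be a smooth family of Hamiltonians on $M$ that is linear at infinity, i.e. $W_s(q,r)=r\,H_0^s(q)$ for $q\in\partial M^{in}$, all $s\in[0,1]$ and all large $r$. Let $\varphi_s$ be its flow ($\varphi_0=\mathrm{id}$, $\partial_s\varphi_s=X_{W_s}\circ\varphi_s$), and put $L_s=\varphi_s(L)$, $0\le s\le 1$. Theorem. For every $A\in\mathbb R$ there exist - a smooth function $c:\mathbb R\to(0,\infty)$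 with $c'(s)\le -A$ for $s\in[0,1]$, and a smooth family $H_s$, $s\in\mathbb R$, of everywhere positive functions on $M$ with $H_s(q,r)=c(s)r^2$ for $r\ge1$, with $H_s=H_{-1}$ for $s\le-1$ and $H_s=H_2$ for $s\ge2$; - an $\omega$-compatible almost complex structure $J$ on $M$ with $dr\circ J=-\theta$ for $r\ge1$ (contact type); - a closed $1$-form $\gamma$ on $\Sigma=\mathbb R\times[0,1]$ (coordinates $(s,t)$) with $\gamma=dt$ for $|s|$ large and near $[0,1]\times\{0\}$, such that the following holds. For every compact $B\subset M$ there is a compact $B'\subset M$ such that $u(\Sigma)\subset B'$ for every smooth map $u:\Sigma\to M$ with $$(du-X_{H}\otimes\gamma)^{0,1}=0,$$ $$u(s,1)\in K\ (s\in\mathbb R),\quad u(s,0)\in L_0\ (s\le0),\quad u(s,0)\in L_s\ (0\le s\le1),\quad u(s,0)\in L_1\ (s\ge1),$$ which converges, uniformly in $t\in[0,1]$, as $s\to-\infty$ to a time-one chord of $X_{H_{-1}}$ from $L_0$ to $K$ contained in $B$, and as $s\to+\infty$ to a time-one chord of $X_{H_2}$ from $L_1$ to $K$ contained in $B$. In particular,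 for any two fixed asymptotic chords all solutions lie in one compact subset of $M$. -/

import Mathlib

open Set Filter Topology Bundle
open scoped Manifold ContDiff

noncomputable section

/-! ### One-forms and their exterior derivative on a manifold without boundary -/

section Forms

variable {E : Type*} [NormedAddCommGroup E] [NormedSpace ℝ E]
  {M : Type*} [TopologicalSpace M] [ChartedSpace E M]

/-- The coordinate expression of the one-form `θ` in the preferred chart at `x`, that is, the
pull-back of `θ` under the inverse of that chart. -/
def oneFormInChart (θ : ∀ x : M, TangentSpace 𝓘(ℝ, E) x →L[ℝ] ℝ) (x : M) (y : E) : E →L[ℝ] ℝ :=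
  (θ ((extChartAt 𝓘(ℝ, E) x).symm y)).comp
    (mfderiv 𝓘(ℝ, E) 𝓘(ℝ, E) (extChartAt 𝓘(ℝ, E) x).symm y)

/-- The exterior derivative `(dθ)_x(v, w)`. Mathlib's tangent space at `x` is the model space `E`,
read in the preferred chart at `x`, so that `v` and `w` are their own coordinate expressions and
`dθ(v, w) = ∂_v (θ w) - ∂_w (θ v)` in these coordinates. -/
def extDerivOneForm (θ : ∀ x : M, TangentSpace 𝓘(ℝ, E) x →L[ℝ] ℝ) (x : M)
    (v w : TangentSpace 𝓘(ℝ, E) x) : ℝ :=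
  let D : E →L[ℝ] E →L[ℝ] ℝ := fderiv ℝ (oneFormInChart θ x) (extChartAt 𝓘(ℝ, E) x x)
  D v w - D w v

/-- The derivative `a ↦ a • v` of a curve with velocity `v`. -/
def velocity {x : M} (v : TangentSpace 𝓘(ℝ, E) x) : ℝ →L[ℝ] TangentSpace 𝓘(ℝ, E) x :=
  (1 : ℝ →L[ℝ] ℝ).smulRight v

end Forms

/-! ### Liouville manifolds -/

/-- A Liouville manifold `M` with cylindrical end over the closed manifold `N = ∂M^in`.
The map `cone` is the embedding `(q, r) ↦ (q, r)` of `N × (0, ∞)` onto an open subset of `M`; the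
Liouville domain is `M^in = M ∖ cone (N × (1, ∞))`, the infinite cone is `cone (N × [1, ∞))`, and
`cone (N × (0, 1])` is the collar of `∂M^in = cone (N × {1})` inside `M^in`. The form `α` is
`θ` restricted to `∂M^in`; it is smooth because `θ` is, and it is a contact form because
`dθ = d(r α)` is nondegenerate on the cone. -/
structure LiouvilleManifold (E M E' N : Type*)
    [NormedAddCommGroup E] [NormedSpace ℝ E] [TopologicalSpace M] [ChartedSpace E M]
    [NormedAddCommGroup E'] [NormedSpace ℝ E'] [TopologicalSpace N] [ChartedSpace E' N]
    [IsManifold 𝓘(ℝ, E) ∞ M] where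
  /-- The Liouville one-form. -/
  θ : ∀ x : M, TangentSpace 𝓘(ℝ, E) x →L[ℝ] ℝ
  smooth_θ : ContMDiff 𝓘(ℝ, E) (𝓘(ℝ, E).prod 𝓘(ℝ, E →L[ℝ] ℝ)) ∞
    (fun x => (TotalSpace.mk' (E →L[ℝ] ℝ) x (θ x) :
      TotalSpace (E →L[ℝ] ℝ) (fun x : M => TangentSpace 𝓘(ℝ, E) x →L[ℝ] Bundle.Trivial M ℝ x)))
  nondegenerate : ∀ (x : M) (v : TangentSpace 𝓘(ℝ, E) x),
    (∀ w, extDerivOneForm θ x v w = 0) → v = 0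
  /-- The cylindrical end. -/
  cone : OpenPartialHomeomorph (N × ℝ) M
  cone_source : cone.source = univ ×ˢ Ioi 0
  smooth_cone : ContMDiffOn (𝓘(ℝ, E').prod 𝓘(ℝ, ℝ)) 𝓘(ℝ, E) ∞ cone cone.source
  smooth_cone_symm : ContMDiffOn 𝓘(ℝ, E) (𝓘(ℝ, E').prod 𝓘(ℝ, ℝ)) ∞ cone.symm cone.target
  /-- The contact form on `N = ∂M^in`. -/
  α : ∀ q : N, TangentSpace 𝓘(ℝ, E') q →L[ℝ] ℝ
  /-- `θ = r α` on the end. -/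
  pullback_θ : ∀ (q : N) (r : ℝ), 0 < r →
    ∀ v : TangentSpace (𝓘(ℝ, E').prod 𝓘(ℝ, ℝ)) ((q, r) : N × ℝ),
      θ (cone (q, r)) (mfderiv (𝓘(ℝ, E').prod 𝓘(ℝ, ℝ)) 𝓘(ℝ, E) cone (q, r) v) = r * α q v.1
  isCompact_domain : IsCompact (cone '' (univ ×ˢ Ioi 1))ᶜ
  isClosed_infiniteCone : IsClosed (cone '' (univ ×ˢ Ici 1))

namespace LiouvilleManifold

section

variable {E M E' N : Type*}
  [NormedAddCommGroup E] [NormedSpace ℝ E] [TopologicalSpace M] [ChartedSpace E M]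
  [NormedAddCommGroup E'] [NormedSpace ℝ E'] [TopologicalSpace N] [ChartedSpace E' N]
  [IsManifold 𝓘(ℝ, E) ∞ M]
  (X : LiouvilleManifold E M E' N)

/-- The symplectic form `ω = dθ`. -/
def symplForm (x : M) (v w : TangentSpace 𝓘(ℝ, E) x) : ℝ := extDerivOneForm X.θ x v w

/-- The radial coordinate `r`; it is only meaningful on the image of `cone`. -/
def radius (x : M) : ℝ := (X.cone.symm x).2

/-- The infinite cone `N × [1, ∞)` inside `M`. -/
def infiniteCone : Set M := X.cone '' (univ ×ˢ Ici 1)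

/-- The value at `x` of the Hamiltonian vector field of `f : M → ℝ`, that is, the vector `v` with
`ω(v, ·) = -df` at `x`; it exists and is unique because `ω` is nondegenerate and the dimension is
finite. -/
def hamiltonianVectorField (f : M → ℝ) (x : M) : TangentSpace 𝓘(ℝ, E) x :=
  Classical.epsilon fun v : TangentSpace 𝓘(ℝ, E) x =>
    ∀ w : TangentSpace 𝓘(ℝ, E) x, X.symplForm x v w = -(mfderiv 𝓘(ℝ, E) 𝓘(ℝ, ℝ) f x w : ℝ)

/-! #### Lagrangians with Legendrian ends -/

/-- `L` is a Lagrangian submanifold: near each of its points there is a chart `e` of `M` in which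
`L` is an open piece of a linear subspace `V` of half the dimension, and `ω` vanishes on the
tangent spaces of `L`. -/
def IsLagrangian (L : Set M) : Prop :=
  ∀ p ∈ L, ∃ e ∈ IsManifold.maximalAtlas 𝓘(ℝ, E) ∞ M, ∃ V : Submodule ℝ E,
    p ∈ e.source ∧ 2 * Module.finrank ℝ V = Module.finrank ℝ E ∧
    (∀ x ∈ e.source, x ∈ L ↔ e x ∈ V) ∧
    ∀ x ∈ e.source, x ∈ L → ∀ v w : TangentSpace 𝓘(ℝ, E) x,
      mfderiv 𝓘(ℝ, E) 𝓘(ℝ, E) e x v ∈ V → mfderiv 𝓘(ℝ, E) 𝓘(ℝ, E) e x w ∈ V → X.symplForm x v w = 0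

/-- Sufficiently far out, `L` is `Λ × (R, ∞)` for some `Λ ⊆ N`. For a Lagrangian submanifold `L`
this forces `Λ` to be a (possibly empty) Legendrian submanifold of `N`: the radial direction is
tangent to `L`, hence `α = ω(∂_r, ·)` vanishes on `Λ`. -/
def HasConicalEnd (L : Set M) : Prop :=
  ∃ R : ℝ, 0 < R ∧ ∃ Λ : Set N, ∀ (q : N) (r : ℝ), R < r → (X.cone (q, r) ∈ L ↔ q ∈ Λ)

/-! #### The moving boundary condition -/

/-- The functions `W s`, `0 ≤ s ≤ 1`, form a smooth family on `M`, linear with respect to the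
radial coordinate outside a compact set: `W s (q, r) = r * W₀ s q` for large `r`. -/
def IsLinearHamiltonian (W : ℝ → M → ℝ) : Prop :=
  ContMDiffOn (𝓘(ℝ, ℝ).prod 𝓘(ℝ, E)) 𝓘(ℝ, ℝ) ∞ (fun p : ℝ × M => W p.1 p.2)
    (Icc 0 1 ×ˢ univ) ∧
  ∃ R : ℝ, 0 < R ∧ ∃ W₀ : ℝ → N → ℝ,
    ∀ s ∈ Icc (0 : ℝ) 1, ∀ (q : N) (r : ℝ), R < r → W s (X.cone (q, r)) = r * W₀ s q

/-- `φ s`, `0 ≤ s ≤ 1`, is the flow of the time-dependent Hamiltonian vector field of `W s`. -/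
def IsHamiltonianFlow (W : ℝ → M → ℝ) (φ : ℝ → M → M) : Prop :=
  ContMDiffOn (𝓘(ℝ, ℝ).prod 𝓘(ℝ, E)) 𝓘(ℝ, E) ∞ (fun p : ℝ × M => φ p.1 p.2)
    (Icc 0 1 ×ˢ univ) ∧
  (∀ x, φ 0 x = x) ∧
  ∀ s ∈ Icc (0 : ℝ) 1, ∀ x : M,
    HasMFDerivWithinAt 𝓘(ℝ, ℝ) 𝓘(ℝ, E) (fun s' => φ s' x) (Icc 0 1) s
      (velocity (X.hamiltonianVectorField (W s) (φ s x)))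

/-! #### Floer data -/

/-- `J` is a smooth `ω`-compatible almost complex structure of contact type on the infinite cone:
`dr ∘ J = -θ` there. -/
structure IsContactTypeStructure
    (J : ∀ x : M, TangentSpace 𝓘(ℝ, E) x →L[ℝ] TangentSpace 𝓘(ℝ, E) x) : Prop where
  smooth : ContMDiff 𝓘(ℝ, E) (𝓘(ℝ, E).prod 𝓘(ℝ, E →L[ℝ] E)) ∞
    (fun x => (TotalSpace.mk' (E →L[ℝ] E) x (J x) :
      TotalSpace (E →L[ℝ] E)
        (fun x : M => TangentSpace 𝓘(ℝ, E) x →L[ℝ] TangentSpace 𝓘(ℝ, E) x)))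
  sq : ∀ (x : M) (v : TangentSpace 𝓘(ℝ, E) x), J x (J x v) = -v
  invariant : ∀ (x : M) (v w : TangentSpace 𝓘(ℝ, E) x), X.symplForm x (J x v) (J x w) = X.symplForm x v w
  positive : ∀ (x : M) (v : TangentSpace 𝓘(ℝ, E) x), v ≠ 0 → 0 < X.symplForm x v (J x v)
  contact : ∀ x ∈ X.infiniteCone, ∀ v : TangentSpace 𝓘(ℝ, E) x,
    (mfderiv 𝓘(ℝ, E) 𝓘(ℝ, ℝ) X.radius x (J x v) : ℝ) = -X.θ x v

/-- `H` is a smooth family of positive functions on `M`, parametrized by the coordinate `s` of the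
strip, with `H s (q, r) = c s * r ^ 2` on the infinite cone, and independent of `s` for `s ≤ -1`
and for `s ≥ 2`. -/
structure IsQuadraticHamiltonian (c : ℝ → ℝ) (H : ℝ → M → ℝ) : Prop where
  smooth_c : ContDiff ℝ ∞ c
  c_pos : ∀ s, 0 < c s
  smooth : ContMDiff (𝓘(ℝ, ℝ).prod 𝓘(ℝ, E)) 𝓘(ℝ, ℝ) ∞ (fun p : ℝ × M => H p.1 p.2)
  pos : ∀ s x, 0 < H s x
  quadratic : ∀ s, ∀ x ∈ X.infiniteCone, H s x = c s * X.radius x ^ 2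
  eq_left : ∀ s ≤ -1, H s = H (-1)
  eq_right : ∀ s ≥ 2, H s = H 2

end

end LiouvilleManifold

/-! ### Strips -/

/-- The strip `Σ = ℝ × [0, 1]` with coordinates `(s, t)`. -/
def strip : Set (ℝ × ℝ) := univ ×ˢ Icc 0 1

/-- The one-form `dt`. -/
def dtForm : ℝ × ℝ →L[ℝ] ℝ := ContinuousLinearMap.snd ℝ ℝ ℝ

/-- The complex structure of the strip: `j ∂_s = ∂_t`, `j ∂_t = -∂_s`. -/
def stripJ : ℝ × ℝ →L[ℝ] ℝ × ℝ :=
  (-(ContinuousLinearMap.snd ℝ ℝ ℝ)).prod (ContinuousLinearMap.fst ℝ ℝ ℝ)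

/-- `γ` is a smooth closed one-form, equal to `dt` near both ends of the strip and near
`[0, 1] × {0}`. -/
structure IsAdmissibleOneForm (γ : ℝ × ℝ → ℝ × ℝ →L[ℝ] ℝ) : Prop where
  smooth : ContDiff ℝ ∞ γ
  closed : ∀ z v w, fderiv ℝ γ z v w = fderiv ℝ γ z w v
  eq_dt_ends : ∃ S : ℝ, ∀ z ∈ strip, S ≤ |z.1| → γ z = dtForm
  eq_dt_near : ∀ᶠ z in 𝓝ˢ (Icc (0 : ℝ) 1 ×ˢ {(0 : ℝ)}), γ z = dtForm

namespace LiouvilleManifold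

variable {E M E' N : Type*}
  [NormedAddCommGroup E] [NormedSpace ℝ E] [TopologicalSpace M] [ChartedSpace E M]
  [NormedAddCommGroup E'] [NormedSpace ℝ E'] [TopologicalSpace N] [ChartedSpace E' N]
  [IsManifold 𝓘(ℝ, E) ∞ M]
  (X : LiouvilleManifold E M E' N)

/-- A time-one Hamiltonian chord of `f` from `L` to `K`. -/
structure IsChord (f : M → ℝ) (L K : Set M) (x : ℝ → M) : Prop where
  left : x 0 ∈ L
  right : x 1 ∈ K
  flow : ∀ t ∈ Icc (0 : ℝ) 1, HasMFDerivWithinAt 𝓘(ℝ, ℝ) 𝓘(ℝ, E) x (Icc 0 1) t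
    (velocity (X.hamiltonianVectorField f (x t)))

/-- The one-form `du - X_H ⊗ γ` on the strip with values in `u^* TM`. -/
def perturbedDeriv (H : ℝ → M → ℝ) (γ : ℝ × ℝ → ℝ × ℝ →L[ℝ] ℝ) (u : ℝ × ℝ → M) (z : ℝ × ℝ) :
    ℝ × ℝ →L[ℝ] TangentSpace 𝓘(ℝ, E) (u z) :=
  let D : ℝ × ℝ →L[ℝ] TangentSpace 𝓘(ℝ, E) (u z) := mfderivWithin 𝓘(ℝ, ℝ × ℝ) 𝓘(ℝ, E) u strip z
  D - (γ z).smulRight (X.hamiltonianVectorField (H z.1) (u z))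

/-- The moduli space of strips: smooth solutions `u` of `(du - X_H ⊗ γ)^{0,1} = 0` on `ℝ × [0, 1]`,
where `A^{0,1} = (A + J ∘ A ∘ j) / 2`. The upper boundary is mapped to `K`; the lower
boundary to `L_0 = L` for `s ≤ 0`, to `L_s = φ s (L)` for `0 ≤ s ≤ 1` and to `L_1` for `1 ≤ s`;
and `u(s, ·)` converges, uniformly on `[0, 1]`, to `xm` as `s → -∞` and to `xp` as `s → ∞`. -/
structure IsFloerStrip (H : ℝ → M → ℝ)
    (J : ∀ x : M, TangentSpace 𝓘(ℝ, E) x →L[ℝ] TangentSpace 𝓘(ℝ, E) x)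
    (γ : ℝ × ℝ → ℝ × ℝ →L[ℝ] ℝ) (K L : Set M) (φ : ℝ → M → M) (xm xp : ℝ → M)
    (u : ℝ × ℝ → M) : Prop where
  smooth : ContMDiffOn 𝓘(ℝ, ℝ × ℝ) 𝓘(ℝ, E) ∞ u strip
  equation : ∀ z ∈ strip,
    (1 / 2 : ℝ) • (X.perturbedDeriv H γ u z + (J (u z)).comp ((X.perturbedDeriv H γ u z).comp stripJ))
      = 0
  upper : ∀ s : ℝ, u (s, 1) ∈ K
  lower_left : ∀ s ≤ (0 : ℝ), u (s, 0) ∈ L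
  lower_moving : ∀ s ∈ Icc (0 : ℝ) 1, u (s, 0) ∈ φ s '' L
  lower_right : ∀ s ≥ (1 : ℝ), u (s, 0) ∈ φ 1 '' L
  tendsto_left : ∀ t ∈ Icc (0 : ℝ) 1, Tendsto u (atBot ×ˢ 𝓝[Icc 0 1] t) (𝓝 (xm t))
  tendsto_right : ∀ t ∈ Icc (0 : ℝ) 1, Tendsto u (atTop ×ˢ 𝓝[Icc 0 1] t) (𝓝 (xp t))

end LiouvilleManifold

end

/-! The confinement is a maximum principle for f = log(r ∘ u) on the part of the strip that is
mapped far out in the end. Take γ = dt everywhere and H_s = c(s) G, where G > 0 is smooth and equals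
r² on the cone. Then X_H = 2 c r R on the cone for r > 1, with R the Hamiltonian field of r. For J
of contact type the Floer equation J ∂_s u = ∂_t u - X_H gives ∂_s f = θ(∂_t u)/r - 2 c r and ∂_t f
= -θ(∂_s u)/r. Differentiating once more, with ∂_s θ(∂_t u) - ∂_t θ(∂_s u) = ω(∂_s u, ∂_t u) and dr²
+ θ² ≤ r |·|², yields Δf + 2 c r ∂_s f ≥ -2 c' r (`log_radius_subsolution`). A decreasing c is thus
a source of positivity that grows with r.

The normal derivative of f on the boundary is governed by θ of the boundary velocity. The form θ
vanishes on the conical end of a Lagrangian, so ∂_t f = 0 along K and along the stationary lower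
boundary. On the moving part write u(s,0) = φ_s(y(s)) with y in L. Linearity of W gives θ(X_W) =
dW(Z) = W far out, where Z is the Liouville field, so the flow preserves θ there
(`IsHamiltonianFlow.θ_mfderiv`) and θ(∂_s u) = W_s ≤ C r. Hence ∂_t f ≥ -C
(`IsHamiltonianFlow.θ_velocity_le`). The lift y is only chosen pointwise; a Baire argument
(`subset_closure_of_lift`) makes it differentiable near a dense set of times, at each such time, and
continuity of θ(∂_s u) does the rest.

To absorb the constant -C, the barrier C χ(s) t(1 - t) plus a small strictly convex correction is
added to f. No boundary maximum is then possible, and the error which the barrier creates in the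
interior is dominated by -2 c' r once c' ≤ -Λ c on the support of χ and r is large
(`exists_growth_profile`, `le_of_subsolution`). The result is r ∘ u ≤ ρ₁ exp(C + 1), where ρ₁
depends on B but not on the chords or on u.

The structure J comes from the polar decomposition of ω with respect to a metric g for which g(Z, ·)
= dr and g(R, ·) = θ on the cone. This condition is convex, so such metrics exist by a partition of
unity; the decomposition depends smoothly on g and ω, and it sends Z to R, which is the contact type
condition. -/

open Set Filter Topology Bundle
open scoped Manifold ContDiff

noncomputable section

set_option linter.unusedSectionVars false

/-! ### Tensor fields in charts and the pullback formula for dθ. -/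

section Forms

variable {E : Type*} [NormedAddCommGroup E] [NormedSpace ℝ E]
  {M : Type*} [TopologicalSpace M] [ChartedSpace E M] [IsManifold 𝓘(ℝ, E) ∞ M]

/-- Smoothness of a one-form. -/
abbrev IsSmoothOneForm (θ : ∀ x : M, TangentSpace 𝓘(ℝ, E) x →L[ℝ] ℝ) : Prop :=
  ContMDiff 𝓘(ℝ, E) (𝓘(ℝ, E).prod 𝓘(ℝ, E →L[ℝ] ℝ)) ∞
    (fun x => (TotalSpace.mk' (E →L[ℝ] ℝ) x (θ x) :
      TotalSpace (E →L[ℝ] ℝ) (fun x : M => TangentSpace 𝓘(ℝ, E) x →L[ℝ] Bundle.Trivial M ℝ x)))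

/-- The coordinate frame of the chart at `x₀`. -/
def chartFrame (x₀ x : M) : E →L[ℝ] TangentSpace 𝓘(ℝ, E) x :=
  (trivializationAt E (TangentSpace 𝓘(ℝ, E)) x₀).symmL ℝ x

theorem chartFrame_apply {x₀ x : M} (hx : x ∈ (chartAt E x₀).source) (v : E) : chartFrame x₀ x v =
    (trivializationAt E (TangentSpace 𝓘(ℝ, E)) x₀).symm x v :=
  Trivialization.symmL_apply _ (by simpa using hx) v

theorem oneFormInChart_eventuallyEq_comp_chartFrame (θ : ∀ x : M, TangentSpace 𝓘(ℝ, E) x →L[ℝ] ℝ) (x₀ : M) {y : E}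
    (hy : y ∈ (extChartAt 𝓘(ℝ, E) x₀).target) :
    oneFormInChart θ x₀ y =
      (θ ((extChartAt 𝓘(ℝ, E) x₀).symm y)).comp (chartFrame x₀ ((extChartAt 𝓘(ℝ, E) x₀).symm y)) := by
  unfold oneFormInChart chartFrame
  rw [TangentBundle.symmL_trivializationAt]
  · rw [(extChartAt 𝓘(ℝ, E) x₀).right_inv hy]
    simp
  · simpa using (extChartAt 𝓘(ℝ, E) x₀).map_target hy

/-- Smoothness of a section becomes smoothness of a map into a fixed normed space, measured in the
frame of one chart. The two analogues below do the same for endomorphisms and bilinear forms. -/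
theorem contMDiffAt_oneForm_iff {θ : ∀ x : M, TangentSpace 𝓘(ℝ, E) x →L[ℝ] ℝ}
    (x₀ : M) {x : M} (hx : x ∈ (chartAt E x₀).source) :
    ContMDiffAt 𝓘(ℝ, E) (𝓘(ℝ, E).prod 𝓘(ℝ, E →L[ℝ] ℝ)) ∞
    (fun x => (TotalSpace.mk' (E →L[ℝ] ℝ) x (θ x) :
      TotalSpace (E →L[ℝ] ℝ) (fun x : M => TangentSpace 𝓘(ℝ, E) x →L[ℝ] Bundle.Trivial M ℝ x))) x ↔
    ContMDiffAt 𝓘(ℝ, E) 𝓘(ℝ, E →L[ℝ] ℝ) ∞ (fun x => (θ x).comp (chartFrame x₀ x)) x := by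
  refine (Trivialization.contMDiffAt_section_iff (n := ∞)
    (trivializationAt (E →L[ℝ] ℝ) (fun x : M => TangentSpace 𝓘(ℝ, E) x →L[ℝ] Bundle.Trivial M ℝ x) x₀)
      ?_).trans ?_
  · simpa using hx
  · refine iff_of_eq ?_
    congr 1
    ext x v
    simp [hom_trivializationAt_apply, ContinuousLinearMap.inCoordinates]
    rfl

theorem contMDiffAt_endomorphism_iff {J : ∀ x : M, TangentSpace 𝓘(ℝ, E) x →L[ℝ] TangentSpace 𝓘(ℝ, E) x}
    (x₀ : M) {x : M} (hx : x ∈ (chartAt E x₀).source) :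
    ContMDiffAt 𝓘(ℝ, E) (𝓘(ℝ, E).prod 𝓘(ℝ, E →L[ℝ] E)) ∞
    (fun x => (TotalSpace.mk' (E →L[ℝ] E) x (J x) :
      TotalSpace (E →L[ℝ] E)
        (fun x : M => TangentSpace 𝓘(ℝ, E) x →L[ℝ] TangentSpace 𝓘(ℝ, E) x))) x ↔
    ContMDiffAt 𝓘(ℝ, E) 𝓘(ℝ, E →L[ℝ] E) ∞ (fun x =>
      ((trivializationAt E (TangentSpace 𝓘(ℝ, E)) x₀).continuousLinearMapAt ℝ x).comp
       ((J x).comp (chartFrame x₀ x))) x := by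
  refine (Trivialization.contMDiffAt_section_iff (n := ∞)
    (trivializationAt (E →L[ℝ] E) (fun x : M => TangentSpace 𝓘(ℝ, E) x →L[ℝ] TangentSpace 𝓘(ℝ, E) x) x₀)
      ?_).trans ?_
  · simpa using hx
  · refine iff_of_eq ?_
    congr 1

/-- The coordinate expression of a field of bilinear forms in the chart at `x₀`. -/
def chartBilinear (g : ∀ x : M, TangentSpace 𝓘(ℝ, E) x →L[ℝ] TangentSpace 𝓘(ℝ, E) x →L[ℝ] ℝ)
    (x₀ x : M) : E →L[ℝ] E →L[ℝ] ℝ :=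
  ContinuousLinearMap.bilinearComp (E := E) (F := E) (g x : E →L[ℝ] E →L[ℝ] ℝ)
    (chartFrame x₀ x : E →L[ℝ] E) (chartFrame x₀ x : E →L[ℝ] E)

theorem chartBilinear_apply (g : ∀ x : M, TangentSpace 𝓘(ℝ, E) x →L[ℝ] TangentSpace 𝓘(ℝ, E) x →L[ℝ] ℝ)
    (x₀ x : M) (v w : E) : chartBilinear g x₀ x v w = g x (chartFrame x₀ x v) (chartFrame x₀ x w) :=
  rfl

set_option synthInstance.maxHeartbeats 200000 in
theorem contMDiffAt_bilinear_iff {g : ∀ x : M, TangentSpace 𝓘(ℝ, E) x →L[ℝ] TangentSpace 𝓘(ℝ, E) x →L[ℝ] ℝ}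
    (x₀ : M) {x : M} (hx : x ∈ (chartAt E x₀).source) :
    ContMDiffAt 𝓘(ℝ, E) (𝓘(ℝ, E).prod 𝓘(ℝ, E →L[ℝ] E →L[ℝ] ℝ)) ∞
    (fun x => (TotalSpace.mk' (E →L[ℝ] E →L[ℝ] ℝ) x (g x) :
      TotalSpace (E →L[ℝ] E →L[ℝ] ℝ)
        (fun x : M => TangentSpace 𝓘(ℝ, E) x →L[ℝ] TangentSpace 𝓘(ℝ, E) x →L[ℝ] Bundle.Trivial M ℝ x))) x ↔
    ContMDiffAt 𝓘(ℝ, E) 𝓘(ℝ, E →L[ℝ] E →L[ℝ] ℝ) ∞ (chartBilinear g x₀) x := by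
  refine (Trivialization.contMDiffAt_section_iff (n := ∞)
    (trivializationAt (E →L[ℝ] E →L[ℝ] ℝ) (fun x : M => TangentSpace 𝓘(ℝ, E) x →L[ℝ] TangentSpace 𝓘(ℝ, E) x →L[ℝ] Bundle.Trivial M ℝ x) x₀)
      ?_).trans ?_
  · simpa using hx
  · refine Filter.EventuallyEq.contMDiffAt_iff ?_
    have : (trivializationAt E (TangentSpace 𝓘(ℝ, E)) x₀).baseSet ∈ 𝓝 x :=
      (trivializationAt E (TangentSpace 𝓘(ℝ, E)) x₀).open_baseSet.mem_nhds (by simpa using hx)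
    filter_upwards [this] with x hx
    ext v w
    rw [hom_trivializationAt_apply]
    rw [inCoordinates_apply_eq₂ hx hx (by simp)]
    simp [chartBilinear_apply, chartFrame_apply (x₀ := x₀) (x := x) (by simpa using hx)]

theorem contDiffAt_oneFormInChart {θ : ∀ x : M, TangentSpace 𝓘(ℝ, E) x →L[ℝ] ℝ}
    (hθ : IsSmoothOneForm θ) (x₀ : M) {y : E} (hy : y ∈ (extChartAt 𝓘(ℝ, E) x₀).target) :
    ContDiffAt ℝ ∞ (oneFormInChart θ x₀) y := by
  have h1 : (extChartAt 𝓘(ℝ, E) x₀).symm y ∈ (chartAt E x₀).source := by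
    simpa using (extChartAt 𝓘(ℝ, E) x₀).map_target hy
  have h := (contMDiffAt_oneForm_iff x₀ h1).1 (hθ _)
  have h2 : ContMDiffAt 𝓘(ℝ, E) 𝓘(ℝ, E) ∞ (extChartAt 𝓘(ℝ, E) x₀).symm y :=
    (contMDiffOn_extChartAt_symm x₀).contMDiffAt ((isOpen_extChartAt_target x₀).mem_nhds hy)
  have h3 := (h.comp y h2).contDiffAt
  refine h3.congr_of_eventuallyEq ?_
  filter_upwards [(isOpen_extChartAt_target x₀).mem_nhds hy] with z hz
  exact oneFormInChart_eventuallyEq_comp_chartFrame θ x₀ hz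

section Pullback

variable {V : Type*} [NormedAddCommGroup V] [NormedSpace ℝ V]

theorem ContMDiffAt.contDiffAt_extChartAt_comp {F : V → M} {z : V}
    (hF : ContMDiffAt 𝓘(ℝ, V) 𝓘(ℝ, E) ∞ F z) :
    ContDiffAt ℝ ∞ (fun y => extChartAt 𝓘(ℝ, E) (F z) (F y)) z :=
  ((contMDiffAt_extChartAt (I := 𝓘(ℝ, E)) (n := ∞) (x := F z)).comp z hF).contDiffAt

/-- The chart at `F z` stays fixed while `y` varies: the formula holds on a neighbourhood of `z`, so
both sides may be differentiated at `z`. -/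
theorem eventually_mfderiv_eq_chart {F : V → M} {z : V}
    (hF : ContMDiffAt 𝓘(ℝ, V) 𝓘(ℝ, E) ∞ F z) (θ : ∀ x : M, TangentSpace 𝓘(ℝ, E) x →L[ℝ] ℝ) :
    ∀ᶠ y in 𝓝 z, ∀ v : V, θ (F y) (mfderiv 𝓘(ℝ, V) 𝓘(ℝ, E) F y v) =
      oneFormInChart θ (F z) (extChartAt 𝓘(ℝ, E) (F z) (F y))
        (fderiv ℝ (fun y => extChartAt 𝓘(ℝ, E) (F z) (F y)) y v) := by
  have h1 : ∀ᶠ y in 𝓝 z, F y ∈ (extChartAt 𝓘(ℝ, E) (F z)).source :=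
    hF.continuousAt.eventually (extChartAt_source_mem_nhds (F z))
  have h2 : ∀ᶠ y in 𝓝 z, DifferentiableAt ℝ (fun y => extChartAt 𝓘(ℝ, E) (F z) (F y)) y :=
    ((hF.contDiffAt_extChartAt_comp.of_le (m := 1) (by simp)).eventually (by simp)).mono
      fun y hy => hy.differentiableAt (by simp)
  filter_upwards [h1.eventually_nhds, h2] with y hy1 hy2 v
  have hy := hy1.self_of_nhds
  have e1 : F =ᶠ[𝓝 y] (extChartAt 𝓘(ℝ, E) (F z)).symm ∘
      (fun y => extChartAt 𝓘(ℝ, E) (F z) (F y)) := by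
    filter_upwards [hy1] with w hw
    exact ((extChartAt 𝓘(ℝ, E) (F z)).left_inv hw).symm
  have ht := (extChartAt 𝓘(ℝ, E) (F z)).map_source hy
  have h3 : MDifferentiableAt 𝓘(ℝ, E) 𝓘(ℝ, E) (extChartAt 𝓘(ℝ, E) (F z)).symm
      (extChartAt 𝓘(ℝ, E) (F z) (F y)) :=
    ((contMDiffOn_extChartAt_symm (n := ∞) (F z)).contMDiffAt
      ((isOpen_extChartAt_target (F z)).mem_nhds ht)).mdifferentiableAt (by simp)
  have e2 : (mfderiv 𝓘(ℝ, V) 𝓘(ℝ, E) F y : V →L[ℝ] E) =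
      (mfderiv 𝓘(ℝ, E) 𝓘(ℝ, E) (extChartAt 𝓘(ℝ, E) (F z)).symm
        (extChartAt 𝓘(ℝ, E) (F z) (F y))).comp
        (fderiv ℝ (fun y => extChartAt 𝓘(ℝ, E) (F z) (F y)) y) := by
    rw [e1.mfderiv_eq, mfderiv_comp y h3 hy2.mdifferentiableAt, mfderiv_eq_fderiv]
    rfl
  have hcongr : ∀ (p q : M) (_ : p = q) (w : E), θ p w = θ q w := by
    intro p q h w; subst h; rfl
  have e3 : θ (F y) (mfderiv 𝓘(ℝ, V) 𝓘(ℝ, E) F y v) = θ (F y) ((mfderiv 𝓘(ℝ, E) 𝓘(ℝ, E) (extChartAt 𝓘(ℝ, E) (F z)).symm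
        (extChartAt 𝓘(ℝ, E) (F z) (F y)))
        (fderiv ℝ (fun y => extChartAt 𝓘(ℝ, E) (F z) (F y)) y v)) :=
    congrArg (fun B : V →L[ℝ] E => θ (F y) (B v)) e2
  rw [e3]
  exact hcongr _ _ ((extChartAt 𝓘(ℝ, E) (F z)).left_inv hy).symm _

theorem oneForm_mfderiv_contDiffAt {θ : ∀ x : M, TangentSpace 𝓘(ℝ, E) x →L[ℝ] ℝ}
    (hθ : IsSmoothOneForm θ) {F : V → M} {z : V} (hF : ContMDiffAt 𝓘(ℝ, V) 𝓘(ℝ, E) ∞ F z) (b : V) :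
    ContDiffAt ℝ ∞ (fun y => θ (F y) (mfderiv 𝓘(ℝ, V) 𝓘(ℝ, E) F y b)) z := by
  have h := eventually_mfderiv_eq_chart hF θ
  have h1 := contDiffAt_oneFormInChart hθ (F z) (mem_extChartAt_target (I := 𝓘(ℝ, E)) (F z))
  have h2 := hF.contDiffAt_extChartAt_comp
  have h3 := h1.comp z h2
  have h4 := h2.fderiv_right (m := ∞) (by simp)
  exact (h3.clm_apply (h4.clm_apply contDiffAt_const)).congr_of_eventuallyEq
    (h.mono fun y hy => hy b)

/-- The invariant formula `ω(F_a, F_b) = ∂_a (θ(F_b)) - ∂_b (θ(F_a))` for a smooth map `F`. -/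
theorem extDerivOneForm_mfderiv {θ : ∀ x : M, TangentSpace 𝓘(ℝ, E) x →L[ℝ] ℝ}
    (hθ : IsSmoothOneForm θ) {F : V → M} {z : V} (hF : ContMDiffAt 𝓘(ℝ, V) 𝓘(ℝ, E) ∞ F z)
    (a b : V) :
    extDerivOneForm θ (F z) (mfderiv 𝓘(ℝ, V) 𝓘(ℝ, E) F z a) (mfderiv 𝓘(ℝ, V) 𝓘(ℝ, E) F z b) =
      fderiv ℝ (fun y => θ (F y) (mfderiv 𝓘(ℝ, V) 𝓘(ℝ, E) F y b)) z a -
      fderiv ℝ (fun y => θ (F y) (mfderiv 𝓘(ℝ, V) 𝓘(ℝ, E) F y a)) z b := by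
  have h := eventually_mfderiv_eq_chart hF θ
  have h1 := (contDiffAt_oneFormInChart hθ (F z)
    (mem_extChartAt_target (I := 𝓘(ℝ, E)) (F z))).differentiableAt (by simp)
  have h2 := hF.contDiffAt_extChartAt_comp
  have h2' := h2.differentiableAt (by simp)
  have h4 := (h2.fderiv_right (m := ∞) (by simp)).differentiableAt (by simp)
  -- At the base point itself the preferred chart has derivative the identity, so the manifold
  -- derivative of `F` is that of its coordinate expression.
  have hm : (mfderiv 𝓘(ℝ, V) 𝓘(ℝ, E) F z : V →L[ℝ] E) =
      fderiv ℝ (fun y => extChartAt 𝓘(ℝ, E) (F z) (F y)) z := by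
    have h5 : MDifferentiableAt 𝓘(ℝ, E) 𝓘(ℝ, E) (extChartAt 𝓘(ℝ, E) (F z)) (F z) :=
      (contMDiffAt_extChartAt (I := 𝓘(ℝ, E)) (n := ∞)).mdifferentiableAt (by simp)
    have h6 := mfderiv_comp z h5 (hF.mdifferentiableAt (by simp))
    rw [mfderiv_extChartAt_self] at h6
    rw [← mfderiv_eq_fderiv]
    exact h6.symm
  -- Product rule for θ(F_c): one term with the second derivative of `F`, one with the derivative of
  -- the coefficients of θ. The first is symmetric in the two directions and cancels in the
  -- difference.
  have key : ∀ c d : V, fderiv ℝ (fun y => θ (F y) (mfderiv 𝓘(ℝ, V) 𝓘(ℝ, E) F y c)) z d =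
      oneFormInChart θ (F z) (extChartAt 𝓘(ℝ, E) (F z) (F z))
        (fderiv ℝ (fderiv ℝ (fun y => extChartAt 𝓘(ℝ, E) (F z) (F y))) z d c) +
      fderiv ℝ (oneFormInChart θ (F z)) (extChartAt 𝓘(ℝ, E) (F z) (F z))
        (fderiv ℝ (fun y => extChartAt 𝓘(ℝ, E) (F z) (F y)) z d)
        (fderiv ℝ (fun y => extChartAt 𝓘(ℝ, E) (F z) (F y)) z c) := by
    intro c d
    rw [Filter.EventuallyEq.fderiv_eq (h.mono fun y hy => hy c)]
    have e1 : HasFDerivAt (fun y => oneFormInChart θ (F z) (extChartAt 𝓘(ℝ, E) (F z) (F y))) _ z :=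
      HasFDerivAt.comp (f := fun y => extChartAt 𝓘(ℝ, E) (F z) (F y)) z h1.hasFDerivAt h2'.hasFDerivAt
    have e2 := e1.clm_apply (h4.hasFDerivAt.clm_apply (hasFDerivAt_const c z))
    rw [e2.fderiv]
    simp
  rw [key, key]
  have hsymm : IsSymmSndFDerivAt ℝ (fun y => extChartAt 𝓘(ℝ, E) (F z) (F y)) z :=
    h2.isSymmSndFDerivAt (by simpa using WithTop.coe_le_coe.2 (le_top : (2 : ℕ∞) ≤ ⊤))
  rw [hsymm.eq a b]
  rw [show mfderiv 𝓘(ℝ, V) 𝓘(ℝ, E) F z a = fderiv ℝ (fun y => extChartAt 𝓘(ℝ, E) (F z) (F y)) z a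
    from congrArg (fun B : V →L[ℝ] E => B a) hm,
    show mfderiv 𝓘(ℝ, V) 𝓘(ℝ, E) F z b = fderiv ℝ (fun y => extChartAt 𝓘(ℝ, E) (F z) (F y)) z b
    from congrArg (fun B : V →L[ℝ] E => B b) hm]
  unfold extDerivOneForm
  ring

end Pullback

end Forms

set_option synthInstance.maxHeartbeats 200000 in
theorem ContDiffAt.flip_bilinear {V E : Type*} [NormedAddCommGroup V] [NormedSpace ℝ V]
    [NormedAddCommGroup E] [NormedSpace ℝ E] {f : V → E →L[ℝ] E →L[ℝ] ℝ} {x : V}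
    (hf : ContDiffAt ℝ ∞ f x) : ContDiffAt ℝ ∞ (fun y => (f y).flip) x := by
  have h : IsBoundedLinearMap ℝ (fun B : E →L[ℝ] E →L[ℝ] ℝ => B.flip) :=
    { map_add := fun _ _ => rfl
      map_smul := fun _ _ => rfl
      bound := ⟨1, one_pos, fun B => by simp⟩ }
  have h' : ContDiff ℝ ∞ (fun B : E →L[ℝ] E →L[ℝ] ℝ => B.flip) := by
    apply IsBoundedLinearMap.contDiff
    exact h
  exact h'.contDiffAt.comp x hf

/-! ### The symplectic form and its duality between vectors and covectors. -/

namespace LiouvilleManifold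

variable {E M E' N : Type*}
  [NormedAddCommGroup E] [NormedSpace ℝ E] [TopologicalSpace M] [ChartedSpace E M]
  [NormedAddCommGroup E'] [NormedSpace ℝ E'] [TopologicalSpace N] [ChartedSpace E' N]
  [IsManifold 𝓘(ℝ, E) ∞ M]
  (X : LiouvilleManifold E M E' N)

/-- The symplectic form as a continuous bilinear form. -/
def symplBilin (x : M) : TangentSpace 𝓘(ℝ, E) x →L[ℝ] TangentSpace 𝓘(ℝ, E) x →L[ℝ] ℝ :=
  let D : E →L[ℝ] E →L[ℝ] ℝ := fderiv ℝ (oneFormInChart X.θ x) (extChartAt 𝓘(ℝ, E) x x)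
  (D - D.flip : E →L[ℝ] E →L[ℝ] ℝ)

theorem symplBilin_apply (x : M) (v w : TangentSpace 𝓘(ℝ, E) x) :
    X.symplBilin x v w = X.symplForm x v w := by
  rfl

theorem symplForm_add_left (x : M) (v v' w : TangentSpace 𝓘(ℝ, E) x) :
    X.symplForm x (v + v') w = X.symplForm x v w + X.symplForm x v' w := by
  simp only [← symplBilin_apply, map_add]; rfl

theorem symplForm_add_right (x : M) (v w w' : TangentSpace 𝓘(ℝ, E) x) :
    X.symplForm x v (w + w') = X.symplForm x v w + X.symplForm x v w' := by
  simp only [← symplBilin_apply, map_add]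

theorem symplForm_smul_left (x : M) (a : ℝ) (v w : TangentSpace 𝓘(ℝ, E) x) :
    X.symplForm x (a • v) w = a * X.symplForm x v w := by
  simp only [← symplBilin_apply, map_smul]; rfl

theorem symplForm_smul_right (x : M) (a : ℝ) (v w : TangentSpace 𝓘(ℝ, E) x) :
    X.symplForm x v (a • w) = a * X.symplForm x v w := by
  simp only [← symplBilin_apply, map_smul]; rfl

theorem symplForm_neg_left (x : M) (v w : TangentSpace 𝓘(ℝ, E) x) :
    X.symplForm x (-v) w = -X.symplForm x v w := by
  simp only [← symplBilin_apply, map_neg]; rfl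

theorem symplForm_neg_right (x : M) (v w : TangentSpace 𝓘(ℝ, E) x) :
    X.symplForm x v (-w) = -X.symplForm x v w := by
  simp only [← symplBilin_apply, map_neg]

theorem symplForm_swap (x : M) (v w : TangentSpace 𝓘(ℝ, E) x) :
    X.symplForm x v w = -X.symplForm x w v := by
  unfold symplForm extDerivOneForm
  ring

theorem symplForm_self (x : M) (v : TangentSpace 𝓘(ℝ, E) x) : X.symplForm x v v = 0 := by
  have := X.symplForm_swap x v v
  linarith

section FiniteDimensional

variable [FiniteDimensional ℝ E]

/-- The symplectic form as a linear isomorphism from vectors to covectors. -/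
theorem exists_equiv_symplBilin (x : M) :
    ∃ e : E ≃L[ℝ] (E →L[ℝ] ℝ), (e : E →L[ℝ] E →L[ℝ] ℝ) = X.symplBilin x := by
  let B : E →L[ℝ] E →L[ℝ] ℝ := X.symplBilin x
  let f : E →ₗ[ℝ] (E →L[ℝ] ℝ) := B.toLinearMap
  have hinj : Function.Injective f := by
    rw [← LinearMap.ker_eq_bot, LinearMap.ker_eq_bot']
    intro v hv
    refine X.nondegenerate x v fun w => ?_
    exact congrArg (fun B : E →L[ℝ] ℝ => B w) hv
  have hdim : Module.finrank ℝ E = Module.finrank ℝ (E →L[ℝ] ℝ) := by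
    rw [LinearEquiv.finrank_eq (LinearMap.toContinuousLinearMap (𝕜 := ℝ) (E := E) (F' := ℝ)).symm]
    exact (Subspace.dual_finrank_eq (K := ℝ) (V := E)).symm
  refine ⟨(LinearEquiv.ofInjectiveOfFinrankEq f hinj hdim).toContinuousLinearEquiv, ?_⟩
  ext v w
  rfl

/-- The vector field `ω`-dual to a field of covectors. -/
def sharp (x : M) (β : TangentSpace 𝓘(ℝ, E) x →L[ℝ] ℝ) : TangentSpace 𝓘(ℝ, E) x :=
  (X.exists_equiv_symplBilin x).choose.symm β

theorem symplForm_sharp (x : M) (β : TangentSpace 𝓘(ℝ, E) x →L[ℝ] ℝ) (w : TangentSpace 𝓘(ℝ, E) x) :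
    X.symplForm x (X.sharp x β) w = β w := by
  have h := (X.exists_equiv_symplBilin x).choose_spec
  have : (X.exists_equiv_symplBilin x).choose (X.sharp x β) = β :=
    (X.exists_equiv_symplBilin x).choose.apply_symm_apply β
  rw [← symplBilin_apply]
  have h2 := congrArg (fun B : E →L[ℝ] E →L[ℝ] ℝ => B (X.sharp x β) w) h
  refine h2.symm.trans ?_
  exact congrArg (fun B : E →L[ℝ] ℝ => B w) this

theorem eq_of_symplForm_eq {x : M} {v v' : TangentSpace 𝓘(ℝ, E) x}
    (h : ∀ w, X.symplForm x v w = X.symplForm x v' w) : v = v' := by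
  rw [← sub_eq_zero]
  refine X.nondegenerate x _ fun w => ?_
  have := X.symplForm_add_left x v (-v') w
  rw [symplForm_neg_left, h w, ← sub_eq_add_neg] at this
  unfold symplForm at this
  linarith

/-- The vector ω-dual to -df witnesses that the `Classical.epsilon` in the definition really solves
its equation. -/
theorem symplForm_hamiltonianVectorField (f : M → ℝ) (x : M) (w : TangentSpace 𝓘(ℝ, E) x) :
    X.symplForm x (X.hamiltonianVectorField f x) w = -(mfderiv 𝓘(ℝ, E) 𝓘(ℝ, ℝ) f x w : ℝ) :=
  Classical.epsilon_spec (p := fun v : TangentSpace 𝓘(ℝ, E) x =>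
    ∀ w : TangentSpace 𝓘(ℝ, E) x, X.symplForm x v w = -(mfderiv 𝓘(ℝ, E) 𝓘(ℝ, ℝ) f x w : ℝ))
    ⟨X.sharp x (-(mfderiv 𝓘(ℝ, E) 𝓘(ℝ, ℝ) f x : E →L[ℝ] ℝ)), fun w => X.symplForm_sharp x _ w⟩ w

end FiniteDimensional

/-! ### Smoothness in charts -/

theorem chartFrame_eq_mfderiv {x₀ x : M} (hx : x ∈ (chartAt E x₀).source) :
    (chartFrame x₀ x : E →L[ℝ] E) =
      mfderiv 𝓘(ℝ, E) 𝓘(ℝ, E) (extChartAt 𝓘(ℝ, E) x₀).symm (extChartAt 𝓘(ℝ, E) x₀ x) := by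
  unfold chartFrame
  rw [TangentBundle.symmL_trivializationAt hx]
  simp
  rfl

/-- The definition of dθ at `x` uses the preferred chart at `x`, which need not vary continuously
with `x`. The pullback formula applied to the inverse of the fixed chart at `x₀` gives an expression
from which smoothness in `x` can be read off. -/
theorem chartBilinear_symplBilin {x₀ x : M} (hx : x ∈ (chartAt E x₀).source) :
    chartBilinear X.symplBilin x₀ x =
      fderiv ℝ (oneFormInChart X.θ x₀) (extChartAt 𝓘(ℝ, E) x₀ x) -
      (fderiv ℝ (oneFormInChart X.θ x₀) (extChartAt 𝓘(ℝ, E) x₀ x)).flip := by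
  ext a b
  have hx' : x ∈ (extChartAt 𝓘(ℝ, E) x₀).source := by simpa using hx
  have ht := (extChartAt 𝓘(ℝ, E) x₀).map_source hx'
  have hF : ContMDiffAt 𝓘(ℝ, E) 𝓘(ℝ, E) ∞ (extChartAt 𝓘(ℝ, E) x₀).symm (extChartAt 𝓘(ℝ, E) x₀ x) :=
    (contMDiffOn_extChartAt_symm x₀).contMDiffAt ((isOpen_extChartAt_target x₀).mem_nhds ht)
  have h := extDerivOneForm_mfderiv X.smooth_θ hF a b
  have hd := (contDiffAt_oneFormInChart X.smooth_θ x₀ ht).differentiableAt (by simp)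
  have key : ∀ c d : E, fderiv ℝ (fun y => X.θ ((extChartAt 𝓘(ℝ, E) x₀).symm y)
      (mfderiv 𝓘(ℝ, E) 𝓘(ℝ, E) (extChartAt 𝓘(ℝ, E) x₀).symm y c)) (extChartAt 𝓘(ℝ, E) x₀ x) d =
      fderiv ℝ (oneFormInChart X.θ x₀) (extChartAt 𝓘(ℝ, E) x₀ x) d c := by
    intro c d
    have : HasFDerivAt (fun y => oneFormInChart X.θ x₀ y c) _ (extChartAt 𝓘(ℝ, E) x₀ x) :=
      hd.hasFDerivAt.clm_apply (hasFDerivAt_const c _)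
    refine (congrArg (fun B : E →L[ℝ] ℝ => B d) this.fderiv).trans ?_
    simp
  rw [key, key] at h
  rw [chartBilinear_apply, symplBilin_apply]
  have hl := (extChartAt 𝓘(ℝ, E) x₀).left_inv hx'
  have hcongr : ∀ (p q : M) (_ : p = q) (v w : E), extDerivOneForm X.θ p v w = extDerivOneForm X.θ q v w := by
    intro p q h v w; subst h; rfl
  have e1 := fun c => congrArg (fun B : E →L[ℝ] E => B c) (chartFrame_eq_mfderiv hx)
  refine Eq.trans ?_ h
  refine Eq.trans ?_ (hcongr _ _ hl.symm _ _)
  unfold symplForm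
  exact congrArg₂ (fun v w : E => extDerivOneForm X.θ x v w) (e1 a) (e1 b)

theorem contMDiffAt_chartBilinear_symplBilin (x₀ : M) :
    ContMDiffAt 𝓘(ℝ, E) 𝓘(ℝ, E →L[ℝ] E →L[ℝ] ℝ) ∞ (chartBilinear X.symplBilin x₀) x₀ := by
  have h0 := (contDiffAt_oneFormInChart X.smooth_θ x₀ (mem_extChartAt_target (I := 𝓘(ℝ, E)) x₀))
  have h1 := h0.fderiv_right (m := ∞) (by simp)
  have h2 : ContDiffAt ℝ ∞ (fun y => fderiv ℝ (oneFormInChart X.θ x₀) y -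
      (fderiv ℝ (oneFormInChart X.θ x₀) y).flip) (extChartAt 𝓘(ℝ, E) x₀ x₀) :=
    h1.sub h1.flip_bilinear
  refine (h2.contMDiffAt.comp x₀ (contMDiffAt_extChartAt (I := 𝓘(ℝ, E)) (n := ∞))).congr_of_eventuallyEq ?_
  filter_upwards [(chartAt E x₀).open_source.mem_nhds (mem_chart_source E x₀)] with x hx
  exact X.chartBilinear_symplBilin hx

end LiouvilleManifold

namespace LiouvilleManifold

variable {E M E' N : Type*}
  [NormedAddCommGroup E] [NormedSpace ℝ E] [TopologicalSpace M] [ChartedSpace E M]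
  [NormedAddCommGroup E'] [NormedSpace ℝ E'] [TopologicalSpace N] [ChartedSpace E' N]
  [IsManifold 𝓘(ℝ, E) ∞ M] [IsManifold 𝓘(ℝ, E') ∞ N]
  (X : LiouvilleManifold E M E' N)

/-! ### The cylindrical end -/

theorem mem_cone_source {q : N} {r : ℝ} : (q, r) ∈ X.cone.source ↔ 0 < r := by
  simp [X.cone_source]

theorem cone_mem_target {q : N} {r : ℝ} (hr : 0 < r) : X.cone (q, r) ∈ X.cone.target :=
  X.cone.map_source (X.mem_cone_source.2 hr)

theorem radius_cone {q : N} {r : ℝ} (hr : 0 < r) : X.radius (X.cone (q, r)) = r := by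
  unfold radius
  rw [X.cone.left_inv (X.mem_cone_source.2 hr)]

theorem radius_pos {x : M} (hx : x ∈ X.cone.target) : 0 < X.radius x := by
  have := X.cone.map_target hx
  rw [X.cone_source] at this
  exact this.2

theorem cone_symm_fst_radius {x : M} (hx : x ∈ X.cone.target) :
    X.cone ((X.cone.symm x).1, X.radius x) = x :=
  X.cone.right_inv hx

theorem contMDiffAt_cone {q : N} {r : ℝ} (hr : 0 < r) :
    ContMDiffAt (𝓘(ℝ, E').prod 𝓘(ℝ, ℝ)) 𝓘(ℝ, E) ∞ X.cone (q, r) :=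
  X.smooth_cone.contMDiffAt (X.cone.open_source.mem_nhds (X.mem_cone_source.2 hr))

theorem contMDiffAt_cone_symm {x : M} (hx : x ∈ X.cone.target) :
    ContMDiffAt 𝓘(ℝ, E) (𝓘(ℝ, E').prod 𝓘(ℝ, ℝ)) ∞ X.cone.symm x :=
  X.smooth_cone_symm.contMDiffAt (X.cone.open_target.mem_nhds hx)

theorem contMDiffAt_radius {x : M} (hx : x ∈ X.cone.target) :
    ContMDiffAt 𝓘(ℝ, E) 𝓘(ℝ, ℝ) ∞ X.radius x :=
  contMDiffAt_snd.comp x (X.contMDiffAt_cone_symm hx)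

theorem mdifferentiableAt_radius {x : M} (hx : x ∈ X.cone.target) :
    MDifferentiableAt 𝓘(ℝ, E) 𝓘(ℝ, ℝ) X.radius x :=
  (X.contMDiffAt_radius hx).mdifferentiableAt (by simp)

/-- The derivative of the radial coordinate. -/
def dr (x : M) : TangentSpace 𝓘(ℝ, E) x →L[ℝ] ℝ := mfderiv 𝓘(ℝ, E) 𝓘(ℝ, ℝ) X.radius x

/-- The derivative of the cone embedding. -/
def dcone (q : N) (r : ℝ) : E' × ℝ →L[ℝ] TangentSpace 𝓘(ℝ, E) (X.cone (q, r)) :=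
  mfderiv (𝓘(ℝ, E').prod 𝓘(ℝ, ℝ)) 𝓘(ℝ, E) X.cone (q, r)

/-- Differentiate `cone ∘ cone.symm = id`. Identities between covectors on the end can therefore be
tested on vectors `dcone q r (v, ρ)`. -/
theorem dcone_surjective {q : N} {r : ℝ} (hr : 0 < r) : Function.Surjective (X.dcone q r) := by
  intro w
  have h1 := (X.contMDiffAt_cone_symm (X.cone_mem_target (q := q) hr)).mdifferentiableAt (by simp)
  have h2 := (X.contMDiffAt_cone (q := q) hr).mdifferentiableAt (by simp)
  have hs : X.cone.symm (X.cone (q, r)) = (q, r) := X.cone.left_inv (X.mem_cone_source.2 hr)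
  have h2' : MDifferentiableAt (𝓘(ℝ, E').prod 𝓘(ℝ, ℝ)) 𝓘(ℝ, E) X.cone (X.cone.symm (X.cone (q, r))) := by
    rw [hs]; exact h2
  have h3 := mfderiv_comp (X.cone (q, r)) h2' h1
  have h4 : (X.cone ∘ X.cone.symm) =ᶠ[𝓝 (X.cone (q, r))] id := by
    filter_upwards [X.cone.open_target.mem_nhds (X.cone_mem_target (q := q) hr)] with y hy
    exact X.cone.right_inv hy
  rw [h4.mfderiv_eq, mfderiv_id] at h3
  refine ⟨mfderiv 𝓘(ℝ, E) (𝓘(ℝ, E').prod 𝓘(ℝ, ℝ)) X.cone.symm (X.cone (q, r)) w, ?_⟩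
  have h5 := congrArg (fun B : E →L[ℝ] E => B w) h3
  refine Eq.trans ?_ h5.symm
  have hcongr : ∀ (p p' : N × ℝ) (_ : p = p') (v : E' × ℝ),
    (mfderiv (𝓘(ℝ, E').prod 𝓘(ℝ, ℝ)) 𝓘(ℝ, E) X.cone p v : E) = mfderiv (𝓘(ℝ, E').prod 𝓘(ℝ, ℝ)) 𝓘(ℝ, E) X.cone p' v := by
    intro p p' h v; subst h; rfl
  exact hcongr _ _ hs.symm _

theorem dr_dcone {q : N} {r : ℝ} (hr : 0 < r) (v : E') (ρ : ℝ) :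
    X.dr (X.cone (q, r)) (X.dcone q r (v, ρ)) = ρ := by
  have h1 := X.mdifferentiableAt_radius (X.cone_mem_target (q := q) hr)
  have h2 := (X.contMDiffAt_cone (q := q) hr).mdifferentiableAt (by simp)
  have h3 := mfderiv_comp (q, r) h1 h2
  have h4 : (X.radius ∘ X.cone) =ᶠ[𝓝 (q, r)] Prod.snd := by
    filter_upwards [X.cone.open_source.mem_nhds (X.mem_cone_source.2 hr)] with y hy
    exact X.radius_cone (X.mem_cone_source.1 hy)
  rw [h4.mfderiv_eq, mfderiv_snd] at h3
  exact (congrArg (fun B : E' × ℝ →L[ℝ] ℝ => B (v, ρ)) h3).symm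

theorem θ_dcone {q : N} {r : ℝ} (hr : 0 < r) (v : E') (ρ : ℝ) :
    X.θ (X.cone (q, r)) (X.dcone q r (v, ρ)) = r * X.α q v :=
  X.pullback_θ q r hr (v, ρ)

/-- The cone embedding in a chart of the base. -/
def coneParam (q : N) (p : E' × ℝ) : M := X.cone ((extChartAt 𝓘(ℝ, E') q).symm p.1, p.2)

/-- The coordinate expression of `α`. -/
def αInChart (q : N) : E' → E' →L[ℝ] ℝ := oneFormInChart X.α q

theorem contMDiffAt_chartProd (q : N) {p : E' × ℝ} (hp : p.1 ∈ (extChartAt 𝓘(ℝ, E') q).target) :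
    ContMDiffAt 𝓘(ℝ, E' × ℝ) (𝓘(ℝ, E').prod 𝓘(ℝ, ℝ)) ∞
      (fun p : E' × ℝ => ((extChartAt 𝓘(ℝ, E') q).symm p.1, p.2)) p := by
  have h : ContMDiffAt 𝓘(ℝ, E') 𝓘(ℝ, E') ∞ (extChartAt 𝓘(ℝ, E') q).symm p.1 :=
    (contMDiffOn_extChartAt_symm q).contMDiffAt ((isOpen_extChartAt_target q).mem_nhds hp)
  exact ContMDiffAt.prodMk (h.comp p contDiff_fst.contMDiff.contMDiffAt) contDiff_snd.contMDiff.contMDiffAt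

theorem mfderiv_chartProd (q : N) {p : E' × ℝ} (hp : p.1 ∈ (extChartAt 𝓘(ℝ, E') q).target) (v : E' × ℝ) :
    (mfderiv 𝓘(ℝ, E' × ℝ) (𝓘(ℝ, E').prod 𝓘(ℝ, ℝ))
      (fun p : E' × ℝ => ((extChartAt 𝓘(ℝ, E') q).symm p.1, p.2)) p v : E' × ℝ) =
      (mfderiv 𝓘(ℝ, E') 𝓘(ℝ, E') (extChartAt 𝓘(ℝ, E') q).symm p.1 v.1, v.2) := by
  have h : MDifferentiableAt 𝓘(ℝ, E') 𝓘(ℝ, E') (extChartAt 𝓘(ℝ, E') q).symm p.1 :=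
    ((contMDiffOn_extChartAt_symm (n := ∞) q).contMDiffAt
      ((isOpen_extChartAt_target q).mem_nhds hp)).mdifferentiableAt (by simp)
  have h1 : HasMFDerivAt 𝓘(ℝ, E' × ℝ) 𝓘(ℝ, E') (Prod.fst : E' × ℝ → E') p (ContinuousLinearMap.fst ℝ E' ℝ) :=
    hasFDerivAt_fst.hasMFDerivAt
  have h2 : HasMFDerivAt 𝓘(ℝ, E' × ℝ) 𝓘(ℝ, ℝ) (Prod.snd : E' × ℝ → ℝ) p (ContinuousLinearMap.snd ℝ E' ℝ) :=
    hasFDerivAt_snd.hasMFDerivAt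
  have h3 := (h.hasMFDerivAt.comp p h1).prodMk h2
  have h4 := h3.mfderiv
  exact congrArg (fun B : E' × ℝ →L[ℝ] E' × ℝ => B v) h4

theorem contMDiffAt_coneParam (q : N) {p : E' × ℝ} (hp : p.1 ∈ (extChartAt 𝓘(ℝ, E') q).target)
    (hr : 0 < p.2) : ContMDiffAt 𝓘(ℝ, E' × ℝ) 𝓘(ℝ, E) ∞ (X.coneParam q) p :=
  (X.contMDiffAt_cone hr).comp p (contMDiffAt_chartProd q hp)

theorem mfderiv_coneParam (q : N) {p : E' × ℝ} (hp : p.1 ∈ (extChartAt 𝓘(ℝ, E') q).target)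
    (hr : 0 < p.2) (v : E' × ℝ) : (mfderiv 𝓘(ℝ, E' × ℝ) 𝓘(ℝ, E) (X.coneParam q) p v : E) =
      X.dcone ((extChartAt 𝓘(ℝ, E') q).symm p.1) p.2
      (mfderiv 𝓘(ℝ, E') 𝓘(ℝ, E') (extChartAt 𝓘(ℝ, E') q).symm p.1 v.1, v.2) := by
  have h1 := (X.contMDiffAt_cone (q := (extChartAt 𝓘(ℝ, E') q).symm p.1) hr).mdifferentiableAt (by simp)
  have h2 := (contMDiffAt_chartProd q hp).mdifferentiableAt (by simp)
  have h3 := congrArg (fun B : E' × ℝ →L[ℝ] E => B v) (mfderiv_comp p h1 h2)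
  refine h3.trans ?_
  exact congrArg (fun w : E' × ℝ => (X.dcone ((extChartAt 𝓘(ℝ, E') q).symm p.1) p.2 w : E))
    (mfderiv_chartProd q hp v)

theorem θ_mfderiv_coneParam (q : N) {p : E' × ℝ} (hp : p.1 ∈ (extChartAt 𝓘(ℝ, E') q).target)
    (hr : 0 < p.2) (v : E' × ℝ) :
    X.θ (X.coneParam q p) (mfderiv 𝓘(ℝ, E' × ℝ) 𝓘(ℝ, E) (X.coneParam q) p v) =
      p.2 * X.αInChart q p.1 v.1 := by
  have h := X.mfderiv_coneParam q hp hr v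
  refine (congrArg (fun w : E => X.θ (X.coneParam q p) w) h).trans ?_
  exact X.θ_dcone hr _ _

theorem coneParam_self (q : N) (r : ℝ) : X.coneParam q (extChartAt 𝓘(ℝ, E') q q, r) = X.cone (q, r) := by
  unfold coneParam
  rw [(extChartAt 𝓘(ℝ, E') q).left_inv (mem_extChartAt_source q)]

theorem mfderiv_extChartAt_symm_self (q : N) (v : E') :
    (mfderiv 𝓘(ℝ, E') 𝓘(ℝ, E') (extChartAt 𝓘(ℝ, E') q).symm (extChartAt 𝓘(ℝ, E') q q) v : E') = v := by
  have h := mfderivWithin_range_extChartAt_symm (I := 𝓘(ℝ, E')) (x := q)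
  have h2 := congrArg (fun B : E' →L[ℝ] E' => B v) h
  simp at h2
  exact h2

theorem mfderiv_coneParam_self (q : N) {r : ℝ} (hr : 0 < r) (v : E' × ℝ) :
    (mfderiv 𝓘(ℝ, E' × ℝ) 𝓘(ℝ, E) (X.coneParam q) (extChartAt 𝓘(ℝ, E') q q, r) v : E) = X.dcone q r v := by
  have h := X.mfderiv_coneParam q (p := (extChartAt 𝓘(ℝ, E') q q, r)) (mem_extChartAt_target q) hr v
  refine h.trans ?_
  have hcongr : ∀ (q q' : N) (_ : q = q') (v : E' × ℝ), (X.dcone q r v : E) = X.dcone q' r v := by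
    intro q q' h v; subst h; rfl
  refine (hcongr _ _ ((extChartAt 𝓘(ℝ, E') q).left_inv (mem_extChartAt_source q)) _).trans ?_
  exact congrArg (fun w : E' => (X.dcone q r (w, v.2) : E)) (mfderiv_extChartAt_symm_self q v.1)

/-- Pullback formula along the cone embedding, where θ becomes r α. Smoothness of α is not a datum;
the differentiability in the second conjunct is inherited from θ and is what permits evaluating the
derivatives along lines. -/
theorem symplForm_dcone (q : N) {r : ℝ} (hr : 0 < r) (a b : E' × ℝ) :
    X.symplForm (X.cone (q, r)) (X.dcone q r a) (X.dcone q r b) =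
    fderiv ℝ (fun p : E' × ℝ => p.2 * X.αInChart q p.1 b.1) (extChartAt 𝓘(ℝ, E') q q, r) a -
    fderiv ℝ (fun p : E' × ℝ => p.2 * X.αInChart q p.1 a.1) (extChartAt 𝓘(ℝ, E') q q, r) b ∧
    ∀ c : E', DifferentiableAt ℝ (fun p : E' × ℝ => p.2 * X.αInChart q p.1 c) (extChartAt 𝓘(ℝ, E') q q, r) := by
  have hF : ContMDiffAt 𝓘(ℝ, E' × ℝ) 𝓘(ℝ, E) ∞ (X.coneParam q) (extChartAt 𝓘(ℝ, E') q q, r) :=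
    X.contMDiffAt_coneParam q (mem_extChartAt_target q) hr
  have h := extDerivOneForm_mfderiv X.smooth_θ hF a b
  have hev : ∀ᶠ p : E' × ℝ in 𝓝 (extChartAt 𝓘(ℝ, E') q q, r), ∀ v : E' × ℝ,
    X.θ (X.coneParam q p) (mfderiv 𝓘(ℝ, E' × ℝ) 𝓘(ℝ, E) (X.coneParam q) p v) =
      p.2 * X.αInChart q p.1 v.1 := by
    have h1 : ∀ᶠ p : E' × ℝ in 𝓝 (extChartAt 𝓘(ℝ, E') q q, r), p.1 ∈ (extChartAt 𝓘(ℝ, E') q).target :=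
      continuousAt_fst.eventually ((isOpen_extChartAt_target q).mem_nhds (mem_extChartAt_target q))
    have h2 : ∀ᶠ p : E' × ℝ in 𝓝 (extChartAt 𝓘(ℝ, E') q q, r), 0 < p.2 :=
      continuousAt_snd.eventually (lt_mem_nhds hr)
    filter_upwards [h1, h2] with p hp1 hp2 v
    exact X.θ_mfderiv_coneParam q hp1 hp2 v
  rw [Filter.EventuallyEq.fderiv_eq (hev.mono fun p hp => hp a),
    Filter.EventuallyEq.fderiv_eq (hev.mono fun p hp => hp b)] at h
  constructor
  · refine Eq.trans ?_ h
    have hcongr : ∀ (p q : M) (_ : p = q) (v w : E), extDerivOneForm X.θ p v w = extDerivOneForm X.θ q v w := by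
      intro p q h v w; subst h; rfl
    refine (hcongr _ _ (X.coneParam_self q r).symm _ _).trans ?_
    exact (congrArg₂ (fun v w : E => extDerivOneForm X.θ _ v w)
      (X.mfderiv_coneParam_self q hr a) (X.mfderiv_coneParam_self q hr b)).symm
  · intro c
    have h3 := oneForm_mfderiv_contDiffAt X.smooth_θ hF (c, (0 : ℝ))
    exact (h3.congr_of_eventuallyEq (hev.mono fun p hp => (hp (c, 0)).symm)).differentiableAt (by simp)

theorem fderiv_apply_eq_deriv_line {V : Type*} [NormedAddCommGroup V] [NormedSpace ℝ V] {f : V → ℝ} {z : V}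
    (hf : DifferentiableAt ℝ f z) (a : V) : fderiv ℝ f z a = deriv (fun t : ℝ => f (z + t • a)) 0 := by
  have h : HasDerivAt (fun t : ℝ => z + t • a) a 0 := by
    simpa using ((hasDerivAt_id (0 : ℝ)).smul_const a).const_add z
  have hf' : HasFDerivAt f (fderiv ℝ f z) (z + (0 : ℝ) • a) := by simpa using hf.hasFDerivAt
  exact (hf'.comp_hasDerivAt (0 : ℝ) h).deriv.symm

/-- `ω(∂_r, ·) = α`. -/
theorem symplForm_dcone_radial (q : N) {r : ℝ} (hr : 0 < r) (v : E') (ρ : ℝ) :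
    X.symplForm (X.cone (q, r)) (X.dcone q r (0, 1)) (X.dcone q r (v, ρ)) = X.α q v := by
  obtain ⟨h, hd⟩ := X.symplForm_dcone q hr (0, 1) (v, ρ)
  rw [h, fderiv_apply_eq_deriv_line (hd _)]
  simp only [map_zero, mul_zero, fderiv_fun_const]
  have : deriv (fun t : ℝ => (r + t) * X.αInChart q (extChartAt 𝓘(ℝ, E') q q) v) 0 = X.αInChart q (extChartAt 𝓘(ℝ, E') q q) v := by
    have h1 : HasDerivAt (fun t : ℝ => (r + t) * X.αInChart q (extChartAt 𝓘(ℝ, E') q q) v)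
        (1 * X.αInChart q (extChartAt 𝓘(ℝ, E') q q) v) 0 :=
      ((hasDerivAt_id (0 : ℝ)).const_add r).mul_const _
    rw [h1.deriv, one_mul]
  simp
  unfold αInChart oneFormInChart
  have hcongr : ∀ (p q : N) (_ : p = q) (v : E'), X.α p v = X.α q v := by
    intro p q h v; subst h; rfl
  refine (hcongr _ _ ((extChartAt 𝓘(ℝ, E') q).left_inv (mem_extChartAt_source q)) _).trans ?_
  exact congrArg (fun w : E' => X.α q w) (mfderiv_extChartAt_symm_self q v)

/-- On vectors tangent to the slices, `ω` is linear in the radial coordinate. -/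
theorem symplForm_dcone_slice (q : N) {r r' : ℝ} (hr : 0 < r) (hr' : 0 < r') (v w : E') :
    r' * X.symplForm (X.cone (q, r)) (X.dcone q r (v, 0)) (X.dcone q r (w, 0)) =
    r * X.symplForm (X.cone (q, r')) (X.dcone q r' (v, 0)) (X.dcone q r' (w, 0)) := by
  obtain ⟨h, hd⟩ := X.symplForm_dcone q hr (v, 0) (w, 0)
  obtain ⟨h', hd'⟩ := X.symplForm_dcone q hr' (v, 0) (w, 0)
  -- Along slice directions r is constant, so both sides are r r' times the exterior derivative of α
  -- at `(v, w)`.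
  rw [h, h', fderiv_apply_eq_deriv_line (hd _), fderiv_apply_eq_deriv_line (hd _),
    fderiv_apply_eq_deriv_line (hd' _), fderiv_apply_eq_deriv_line (hd' _)]
  simp [deriv_const_mul_field]
  ring

end LiouvilleManifold

/-- The differential of a real-valued function on a manifold. -/
def dfun {E M : Type*} [NormedAddCommGroup E] [NormedSpace ℝ E] [TopologicalSpace M]
    [ChartedSpace E M] (f : M → ℝ) (x : M) : TangentSpace 𝓘(ℝ, E) x →L[ℝ] ℝ :=
  mfderiv 𝓘(ℝ, E) 𝓘(ℝ, ℝ) f x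

/-! ### Liouville and Reeb fields, contact type structures, Hamiltonians on the end. -/

namespace LiouvilleManifold

variable {E M E' N : Type*}
  [NormedAddCommGroup E] [NormedSpace ℝ E] [TopologicalSpace M] [ChartedSpace E M]
  [NormedAddCommGroup E'] [NormedSpace ℝ E'] [TopologicalSpace N] [ChartedSpace E' N]
  [IsManifold 𝓘(ℝ, E) ∞ M] [IsManifold 𝓘(ℝ, E') ∞ N] [FiniteDimensional ℝ E]
  (X : LiouvilleManifold E M E' N)

/-- The Liouville vector field. -/
def liouville (x : M) : TangentSpace 𝓘(ℝ, E) x := X.sharp x (X.θ x)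

/-- The Hamiltonian vector field of the radial coordinate; on the end it is the Reeb field. -/
def reeb (x : M) : TangentSpace 𝓘(ℝ, E) x := X.sharp x (-(X.dr x : E →L[ℝ] ℝ))

theorem symplForm_liouville (x : M) (w : TangentSpace 𝓘(ℝ, E) x) :
    X.symplForm x (X.liouville x) w = X.θ x w := X.symplForm_sharp x _ w

theorem symplForm_reeb (x : M) (w : TangentSpace 𝓘(ℝ, E) x) :
    X.symplForm x (X.reeb x) w = -X.dr x w := X.symplForm_sharp x _ w

theorem exists_cone_eq {x : M} (hx : x ∈ X.cone.target) : ∃ q r, 0 < r ∧ X.cone (q, r) = x :=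
  ⟨_, _, X.radius_pos hx, X.cone_symm_fst_radius hx⟩

/-- Z = r ∂_r, because ω(∂_r, ·) = α and θ = r α. -/
theorem liouville_cone (q : N) {r : ℝ} (hr : 0 < r) :
    X.liouville (X.cone (q, r)) = X.dcone q r (0, r) := by
  refine X.eq_of_symplForm_eq fun w => ?_
  obtain ⟨⟨v, ρ⟩, rfl⟩ := X.dcone_surjective hr w
  rw [symplForm_liouville, θ_dcone _ hr]
  have : ((0 : E'), r) = r • ((0 : E'), (1 : ℝ)) := by simp
  rw [this, map_smul, symplForm_smul_left, symplForm_dcone_radial _ _ hr]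

theorem θ_liouville (x : M) : X.θ x (X.liouville x) = 0 := by
  rw [← symplForm_liouville, symplForm_self]

theorem dr_liouville {x : M} (hx : x ∈ X.cone.target) : X.dr x (X.liouville x) = X.radius x := by
  obtain ⟨q, r, hr, rfl⟩ := X.exists_cone_eq hx
  rw [X.liouville_cone q hr, X.dr_dcone hr, X.radius_cone hr]

theorem dr_reeb (x : M) : X.dr x (X.reeb x) = 0 := by
  have := X.symplForm_reeb x (X.reeb x)
  rw [symplForm_self] at this
  linarith

theorem θ_reeb {x : M} (hx : x ∈ X.cone.target) : X.θ x (X.reeb x) = X.radius x := by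
  rw [← symplForm_liouville, symplForm_swap, symplForm_reeb, X.dr_liouville hx, neg_neg]

theorem symplForm_hamiltonianVectorField' (f : M → ℝ) (x : M) (w : TangentSpace 𝓘(ℝ, E) x) :
    X.symplForm x (X.hamiltonianVectorField f x) w = -dfun f x w :=
  X.symplForm_hamiltonianVectorField f x w

theorem θ_hamiltonianVectorField (f : M → ℝ) (x : M) :
    X.θ x (X.hamiltonianVectorField f x) = dfun f x (X.liouville x) := by
  rw [← symplForm_liouville, symplForm_swap, symplForm_hamiltonianVectorField', neg_neg]

theorem dr_hamiltonianVectorField (f : M → ℝ) (x : M) :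
    X.dr x (X.hamiltonianVectorField f x) = -dfun f x (X.reeb x) := by
  have h1 := X.symplForm_reeb x (X.hamiltonianVectorField f x)
  rw [symplForm_swap, symplForm_hamiltonianVectorField'] at h1
  linarith

theorem infiniteCone_subset_target : X.infiniteCone ⊆ X.cone.target := by
  rintro _ ⟨⟨q, r⟩, ⟨-, hr⟩, rfl⟩
  exact X.cone_mem_target (lt_of_lt_of_le one_pos hr)

section ContactType

variable {X} {J : ∀ x : M, TangentSpace 𝓘(ℝ, E) x →L[ℝ] TangentSpace 𝓘(ℝ, E) x}

theorem IsContactTypeStructure.dr_apply (hJ : X.IsContactTypeStructure J) {x : M}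
    (hx : x ∈ X.infiniteCone) (v : TangentSpace 𝓘(ℝ, E) x) : X.dr x (J x v) = -X.θ x v :=
  hJ.contact x hx v

theorem IsContactTypeStructure.θ_apply (hJ : X.IsContactTypeStructure J) {x : M}
    (hx : x ∈ X.infiniteCone) (v : TangentSpace 𝓘(ℝ, E) x) : X.θ x (J x v) = X.dr x v := by
  have h := hJ.dr_apply hx (J x v)
  rw [hJ.sq, map_neg] at h
  linarith

/-- By invariance ω(JZ, w) = ω(Z, -Jw) = -θ(Jw) = -dr(w), which is the defining equation of the Reeb
field. -/
theorem IsContactTypeStructure.apply_liouville (hJ : X.IsContactTypeStructure J) {x : M}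
    (hx : x ∈ X.infiniteCone) : J x (X.liouville x) = X.reeb x := by
  refine X.eq_of_symplForm_eq fun w => ?_
  have h : w = J x (-J x w) := by rw [map_neg, hJ.sq, neg_neg]
  have h1 := hJ.invariant x (X.liouville x) (-J x w)
  rw [← h, symplForm_liouville, map_neg, hJ.θ_apply hx] at h1
  rw [h1, symplForm_reeb]

theorem IsContactTypeStructure.apply_reeb (hJ : X.IsContactTypeStructure J) {x : M}
    (hx : x ∈ X.infiniteCone) : J x (X.reeb x) = -X.liouville x := by
  rw [← hJ.apply_liouville hx, hJ.sq]

/-- On the infinite cone, `dr² + θ² ≤ r |v|²`. -/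
theorem IsContactTypeStructure.sq_add_sq_le (hJ : X.IsContactTypeStructure J) {x : M}
    (hx : x ∈ X.infiniteCone) (v : TangentSpace 𝓘(ℝ, E) x) :
    X.dr x v ^ 2 + X.θ x v ^ 2 ≤ X.radius x * X.symplForm x v (J x v) := by
  have hx' := X.infiniteCone_subset_target hx
  have hr := X.radius_pos hx'
  set a := X.dr x v
  set b := X.θ x v
  set r := X.radius x
  set Z := X.liouville x
  set R := X.reeb x
  have hnn : ∀ w : TangentSpace 𝓘(ℝ, E) x, 0 ≤ X.symplForm x w (J x w) := by
    intro w
    by_cases hw : w = 0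
    · subst hw
      have := X.symplForm_smul_left x 0 0 (J x 0)
      rw [zero_smul, zero_mul] at this
      exact this.ge
    · exact (hJ.positive x w hw).le
  -- Bessel's inequality for the metric ω(·, J·): Z and R are orthogonal with |Z|² = |R|² = r, and
  -- their products with v are dr(v) and θ(v). The vector here is v minus its projection to their
  -- span.
  have h := hnn (v + ((-(a / r)) • Z + (-(b / r)) • R))
  have hZ : J x Z = R := hJ.apply_liouville hx
  have hR : J x R = -Z := hJ.apply_reeb hx
  simp only [map_add, map_smul, hZ, hR, symplForm_add_left, symplForm_add_right,
    symplForm_smul_left, symplForm_smul_right, symplForm_neg_right] at h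
  have e1 : X.symplForm x v R = a := by
    rw [symplForm_swap, X.symplForm_reeb x v, neg_neg]
  have e2 : X.symplForm x v Z = -b := by
    rw [symplForm_swap, X.symplForm_liouville x v]
  have e3 : X.symplForm x Z (J x v) = a := by
    rw [X.symplForm_liouville x, hJ.θ_apply hx]
  have e4 : X.symplForm x R (J x v) = b := by
    rw [X.symplForm_reeb x, hJ.dr_apply hx, neg_neg]
  have e5 : X.symplForm x Z R = r := by
    rw [X.symplForm_liouville x, X.θ_reeb hx']
  have e6 : X.symplForm x R Z = -r := by
    rw [X.symplForm_swap, e5]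
  have e7 : X.symplForm x Z Z = 0 := X.symplForm_self x Z
  have e8 : X.symplForm x R R = 0 := X.symplForm_self x R
  rw [e1, e2, e3, e4, e5, e6, e7, e8] at h
  have h2 := mul_nonneg hr.le h
  have e9 : ∀ n : ℝ, r * (n + (-(a / r) * a + -(b / r) * b) +
      (-(a / r) * (a + (-(a / r) * r + -(b / r) * 0)) + -(b / r) * -(-b + (-(a / r) * 0 + -(b / r) * -r)))) =
      r * n - (a ^ 2 + b ^ 2) := by
    intro n
    field_simp
    ring
  rw [e9] at h2
  linarith

end ContactType

section Hamiltonians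

theorem mfderiv_mul_radius_sq {f : M → ℝ} {c : ℝ} {x : M} (hx : x ∈ X.cone.target)
    (hf : f =ᶠ[𝓝 x] fun y => c * X.radius y ^ 2) (w : TangentSpace 𝓘(ℝ, E) x) :
    dfun f x w = 2 * c * X.radius x * X.dr x w := by
  unfold dfun
  rw [hf.mfderiv_eq]
  have h1 := (X.mdifferentiableAt_radius hx).hasMFDerivAt
  have h2 : HasDerivAt (fun t : ℝ => c * t ^ 2) (c * (2 * X.radius x)) (X.radius x) := by
    simpa using (hasDerivAt_pow 2 (X.radius x)).const_mul c
  have h3 := (h2.hasFDerivAt.hasMFDerivAt.comp x h1).mfderiv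
  refine (congrArg (fun B : E →L[ℝ] ℝ => B w) h3).trans ?_
  change (X.dr x w : ℝ) • (c * (2 * X.radius x)) = _
  rw [smul_eq_mul]
  ring

theorem hamiltonianVectorField_mul_radius_sq {f : M → ℝ} {c : ℝ} {x : M} (hx : x ∈ X.cone.target)
    (hf : f =ᶠ[𝓝 x] fun y => c * X.radius y ^ 2) :
    X.hamiltonianVectorField f x = (2 * c * X.radius x) • X.reeb x := by
  refine X.eq_of_symplForm_eq fun w => ?_
  rw [symplForm_hamiltonianVectorField', X.mfderiv_mul_radius_sq hx hf, symplForm_smul_left,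
    symplForm_reeb]
  ring

theorem mfderiv_dcone {f : M → ℝ} {q : N} {r : ℝ} (hr : 0 < r)
    (hf : MDifferentiableAt 𝓘(ℝ, E) 𝓘(ℝ, ℝ) f (X.cone (q, r))) (v : E' × ℝ) :
    dfun f (X.cone (q, r)) (X.dcone q r v) =
      deriv (fun t : ℝ => f (X.coneParam q ((extChartAt 𝓘(ℝ, E') q q, r) + t • v))) 0 := by
  have hF : ContMDiffAt 𝓘(ℝ, E' × ℝ) 𝓘(ℝ, E) ∞ (X.coneParam q) (extChartAt 𝓘(ℝ, E') q q, r) :=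
    X.contMDiffAt_coneParam q (mem_extChartAt_target q) hr
  have hf' : MDifferentiableAt 𝓘(ℝ, E) 𝓘(ℝ, ℝ) f (X.coneParam q (extChartAt 𝓘(ℝ, E') q q, r)) := by
    rw [X.coneParam_self]; exact hf
  have h := mfderiv_comp (extChartAt 𝓘(ℝ, E') q q, r) hf' (hF.mdifferentiableAt (by simp))
  have hd : DifferentiableAt ℝ (f ∘ X.coneParam q) (extChartAt 𝓘(ℝ, E') q q, r) :=
    (hf'.comp _ (hF.mdifferentiableAt (by simp))).differentiableAt
  have h1 := fderiv_apply_eq_deriv_line hd v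
  refine Eq.trans ?_ h1
  rw [← mfderiv_eq_fderiv]
  refine Eq.trans ?_ (congrArg (fun B : E' × ℝ →L[ℝ] ℝ => B v) h).symm
  have hcongr : ∀ (p p' : M) (_ : p = p') (v : E), dfun f p v =
      dfun f p' v := by
    intro p p' h v; subst h; rfl
  refine (hcongr _ _ (X.coneParam_self q r).symm _).trans ?_
  exact congrArg (fun w : E => (dfun f (X.coneParam q (extChartAt 𝓘(ℝ, E') q q, r)) w : ℝ))
    (X.mfderiv_coneParam_self q hr v).symm

/-- For a function that is linear in `r`, the Liouville derivative is the function itself. -/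
theorem mfderiv_liouville_of_linear {f : M → ℝ} {h : N → ℝ} {R : ℝ} (hR : 0 < R)
    (hlin : ∀ q r, R < r → f (X.cone (q, r)) = r * h q) {q : N} {r : ℝ} (hr : R < r)
    (hf : MDifferentiableAt 𝓘(ℝ, E) 𝓘(ℝ, ℝ) f (X.cone (q, r))) :
    dfun f (X.cone (q, r)) (X.liouville (X.cone (q, r))) =
      f (X.cone (q, r)) := by
  rw [X.liouville_cone q (hR.trans hr), X.mfderiv_dcone (hR.trans hr) hf, hlin q r hr]
  -- Euler's identity: moving along Z only rescales r, and f is homogeneous of degree one there.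
  have hev : (fun t : ℝ => f (X.coneParam q ((extChartAt 𝓘(ℝ, E') q q, r) + t • ((0 : E'), r)))) =ᶠ[𝓝 0]
      fun t => (r + t * r) * h q := by
    have : ∀ᶠ t : ℝ in 𝓝 0, R < r + t * r := by
      have hc : ContinuousAt (fun t : ℝ => r + t * r) 0 := by fun_prop
      exact hc.eventually (lt_mem_nhds (by simpa using hr))
    filter_upwards [this] with t ht
    have e : ((extChartAt 𝓘(ℝ, E') q q, r) + t • ((0 : E'), r)) = (extChartAt 𝓘(ℝ, E') q q, r + t * r) := by
      simp
    rw [e, X.coneParam_self, hlin q _ ht]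
  rw [hev.deriv_eq]
  have h2 : HasDerivAt (fun t : ℝ => (r + t * r) * h q) ((1 * r) * h q) 0 :=
    (((hasDerivAt_id (0 : ℝ)).mul_const r).const_add r).mul_const _
  rw [h2.deriv, one_mul]

theorem exists_reeb_eq_dcone (q : N) {r : ℝ} (hr : 0 < r) :
    ∃ v : E', X.reeb (X.cone (q, r)) = X.dcone q r (v, 0) := by
  obtain ⟨⟨v, ρ⟩, hv⟩ := X.dcone_surjective hr (X.reeb (X.cone (q, r)))
  have h := X.dr_reeb (X.cone (q, r))
  rw [← hv, X.dr_dcone hr] at h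
  subst h
  exact ⟨v, hv.symm⟩

/-- The component v along N is characterized by α(v) = 1 and the vanishing of the exterior
derivative of α on `(v, ·)`, conditions that do not involve r. -/
theorem reeb_eq_dcone_of_reeb_eq_dcone {q : N} {r r' : ℝ} (hr : 0 < r) (hr' : 0 < r') {v : E'}
    (hv : X.reeb (X.cone (q, r)) = X.dcone q r (v, 0)) :
    X.reeb (X.cone (q, r')) = X.dcone q r' (v, 0) := by
  have hα : X.α q v = 1 := by
    have h := X.θ_reeb (X.cone_mem_target (q := q) hr)
    rw [hv, X.θ_dcone hr, X.radius_cone hr] at h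
    exact mul_left_cancel₀ hr.ne' (by rw [h, mul_one])
  refine X.eq_of_symplForm_eq fun w => ?_
  obtain ⟨⟨w, ρ⟩, rfl⟩ := X.dcone_surjective hr' w
  rw [symplForm_reeb, X.dr_dcone hr']
  have e : ((w, ρ) : E' × ℝ) = (w, 0) + ρ • (0, 1) := by simp
  have h0 : X.symplForm (X.cone (q, r)) (X.dcone q r (v, 0)) (X.dcone q r (w, 0)) = 0 := by
    rw [← hv, symplForm_reeb, X.dr_dcone hr, neg_zero]
  have h1 := X.symplForm_dcone_slice q hr hr' v w
  rw [h0, mul_zero] at h1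
  have h2 : X.symplForm (X.cone (q, r')) (X.dcone q r' (v, 0)) (X.dcone q r' (w, 0)) = 0 := by
    rcases mul_eq_zero.1 h1.symm with h | h
    · exact absurd h hr.ne'
    · exact h
  rw [e, map_add, map_smul, symplForm_add_right, symplForm_smul_right, h2,
    X.symplForm_swap _ (X.dcone q r' (v, 0)), X.symplForm_dcone_radial q hr', hα]
  ring

/-- For a function that is linear in `r`, the Reeb derivative is linear in `r`. -/
theorem mfderiv_reeb_of_linear {f : M → ℝ} {h : N → ℝ} {R : ℝ} (hR : 0 < R)
    (hlin : ∀ q r, R < r → f (X.cone (q, r)) = r * h q) {q : N} {r r' : ℝ} (hr : R < r) (hr' : R < r')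
    (hf : ∀ x, MDifferentiableAt 𝓘(ℝ, E) 𝓘(ℝ, ℝ) f x) :
    r' * dfun f (X.cone (q, r)) (X.reeb (X.cone (q, r))) =
    r * dfun f (X.cone (q, r')) (X.reeb (X.cone (q, r'))) := by
  obtain ⟨v, hv⟩ := X.exists_reeb_eq_dcone q (hR.trans hr)
  rw [X.reeb_eq_dcone_of_reeb_eq_dcone (hR.trans hr) (hR.trans hr') hv, hv,
    X.mfderiv_dcone (hR.trans hr) (hf _), X.mfderiv_dcone (hR.trans hr') (hf _)]
  -- The Reeb vectors at both radii come from the same tangent vector `v` of the base, so each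
  -- derivative is its radius times the derivative of `h` along one common curve.
  have e : ∀ s, R < s → ∀ t : ℝ, f (X.coneParam q ((extChartAt 𝓘(ℝ, E') q q, s) + t • (v, (0 : ℝ)))) =
      s * h ((extChartAt 𝓘(ℝ, E') q).symm (extChartAt 𝓘(ℝ, E') q q + t • v)) := by
    intro s hs t
    have e : ((extChartAt 𝓘(ℝ, E') q q, s) + t • (v, (0 : ℝ))) = (extChartAt 𝓘(ℝ, E') q q + t • v, s) := by
      simp
    rw [e]
    exact hlin _ s hs
  simp only [e r hr, e r' hr', deriv_const_mul_field]
  ring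

end Hamiltonians

end LiouvilleManifold

/-! ### Positive square roots and the Sylvester equation. -/

section SquareRoot

variable {V : Type*} [AddCommGroup V] [Module ℝ V] [FiniteDimensional ℝ V]

/-- A positive definite symmetric bilinear form diagonalizes the operators that are symmetric with
respect to it. -/
theorem exists_eigenbasis_of_symmetric (g : V →ₗ[ℝ] V →ₗ[ℝ] ℝ) (hsymm : ∀ v w, g v w = g w v)
    (hpos : ∀ v, v ≠ 0 → 0 < g v v) (S : V →ₗ[ℝ] V) (hS : ∀ v w, g (S v) w = g v (S w)) :
    ∃ (b : Module.Basis (Fin (Module.finrank ℝ V)) ℝ V) (l : Fin (Module.finrank ℝ V) → ℝ),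
      (∀ i, S (b i) = l i • b i) ∧ ∀ i j, g (b i) (b j) = if i = j then 1 else 0 := by
  -- The form `g` itself serves as the inner product, so that the spectral theorem gives a
  -- `g`-orthonormal eigenbasis.
  let core : InnerProductSpace.Core ℝ V :=
    { inner := fun v w => g v w
      conj_inner_symm := fun v w => by simpa using hsymm w v
      re_inner_nonneg := fun v => by
        by_cases h : v = 0
        · simp [h]
        · simpa using (hpos v h).le
      add_left := fun v w z => by simp
      smul_left := fun v w r => by simp
      definite := fun v hv => by
        by_contra h
        exact (hpos v h).ne' hv }
  let _ : NormedAddCommGroup V := core.toNormedAddCommGroup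
  let _ : InnerProductSpace ℝ V := InnerProductSpace.ofCore core.toCore
  have hSs : S.IsSymmetric := fun v w => hS v w
  let b := hSs.eigenvectorBasis rfl
  refine ⟨b.toBasis, hSs.eigenvalues rfl, fun i => ?_, fun i j => ?_⟩
  · rw [OrthonormalBasis.coe_toBasis]
    exact hSs.apply_eigenvectorBasis rfl i
  · rw [OrthonormalBasis.coe_toBasis]
    exact orthonormal_iff_ite.1 b.orthonormal i j

theorem exists_positive_sqrt (g : V →ₗ[ℝ] V →ₗ[ℝ] ℝ) (hsymm : ∀ v w, g v w = g w v)
    (hpos : ∀ v, v ≠ 0 → 0 < g v v) (P : V →ₗ[ℝ] V) (hP : ∀ v w, g (P v) w = g v (P w))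
    (hP' : ∀ v, v ≠ 0 → 0 < g (P v) v) :
    ∃ S : V →ₗ[ℝ] V, (∀ v w, g (S v) w = g v (S w)) ∧ (∀ v, v ≠ 0 → 0 < g (S v) v) ∧
      S ∘ₗ S = P := by
  obtain ⟨b, l, hl, hb⟩ := exists_eigenbasis_of_symmetric g hsymm hpos P hP
  have hlpos : ∀ i, 0 < l i := by
    intro i
    have := hP' (b i) (b.ne_zero i)
    rwa [hl, map_smul, LinearMap.smul_apply, hb, if_pos rfl, smul_eq_mul, mul_one] at this
  let S : V →ₗ[ℝ] V := b.constr ℝ fun i => √(l i) • b i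
  have hS : ∀ i, S (b i) = √(l i) • b i := fun i => by simp [S]
  have hSS : S ∘ₗ S = P := by
    refine b.ext fun i => ?_
    rw [LinearMap.comp_apply, hS, map_smul, hS, smul_smul, Real.mul_self_sqrt (hlpos i).le, hl]
  have hSsymm : ∀ v w, g (S v) w = g v (S w) := by
    have : g ∘ₗ S = (g.compl₂ S) := by
      refine b.ext fun i => b.ext fun j => ?_
      rw [LinearMap.comp_apply, LinearMap.compl₂_apply, hS, hS, map_smul, map_smul,
        LinearMap.smul_apply, hb]
      split_ifs with h
      · rw [h]
      · simp
    intro v w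
    exact congrArg (fun B : V →ₗ[ℝ] V →ₗ[ℝ] ℝ => B v w) this
  refine ⟨S, hSsymm, fun v hv => ?_, hSS⟩
  have e : g (S v) v = ∑ i, √(l i) * (b.repr v i) ^ 2 := by
    have hv := b.sum_repr v
    conv_lhs => rw [← hv]
    simp only [map_sum, map_smul, hS, LinearMap.sum_apply, LinearMap.smul_apply, hb, smul_eq_mul]
    refine Finset.sum_congr rfl fun i _ => ?_
    simp
    ring
  rw [e]
  obtain ⟨i, hi⟩ : ∃ i, b.repr v i ≠ 0 := by
    by_contra! h
    exact hv (b.repr.map_eq_zero_iff.1 (Finsupp.ext h))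
  refine Finset.sum_pos' (fun i _ => by positivity) ⟨i, Finset.mem_univ _, ?_⟩
  have := hlpos i
  positivity

/-- If S₂ e = l e with l > 0, then S₁(De) = -l De, which contradicts positivity of S₁ unless De = 0.
This one fact gives both uniqueness of positive square roots and injectivity of the derivative of
squaring. -/
theorem eq_zero_of_comp_add_comp_eq_zero (g : V →ₗ[ℝ] V →ₗ[ℝ] ℝ) (hsymm : ∀ v w, g v w = g w v)
    (hpos : ∀ v, v ≠ 0 → 0 < g v v) (S₁ S₂ D : V →ₗ[ℝ] V)
    (h₁' : ∀ v, v ≠ 0 → 0 < g (S₁ v) v)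
    (h₂ : ∀ v w, g (S₂ v) w = g v (S₂ w)) (h₂' : ∀ v, v ≠ 0 → 0 < g (S₂ v) v)
    (h : S₁ ∘ₗ D + D ∘ₗ S₂ = 0) : D = 0 := by
  obtain ⟨b, l, hl, hb⟩ := exists_eigenbasis_of_symmetric g hsymm hpos S₂ h₂
  refine b.ext fun i => ?_
  by_contra hD
  have hli : 0 < l i := by
    have := h₂' (b i) (b.ne_zero i)
    rwa [hl, map_smul, LinearMap.smul_apply, hb, if_pos rfl, smul_eq_mul, mul_one] at this
  have e := congrArg (fun B : V →ₗ[ℝ] V => g (B (b i)) (D (b i))) h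
  simp only [LinearMap.add_apply, LinearMap.comp_apply, hl, map_smul, map_add, LinearMap.smul_apply,
    LinearMap.zero_apply, map_zero, smul_eq_mul] at e
  have p1 := h₁' _ hD
  have p2 := mul_pos hli (hpos _ hD)
  linarith

end SquareRoot

/-! ### Polar decomposition of a symplectic form on a vector space. -/

section Polar

variable {E : Type*} [NormedAddCommGroup E] [NormedSpace ℝ E] [FiniteDimensional ℝ E]

theorem exists_equiv_of_nondegenerate (B : E →L[ℝ] E →L[ℝ] ℝ) (hB : ∀ v, (∀ w, B v w = 0) → v = 0) :
    ∃ e : E ≃L[ℝ] (E →L[ℝ] ℝ), (e : E →L[ℝ] E →L[ℝ] ℝ) = B := by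
  let f : E →ₗ[ℝ] (E →L[ℝ] ℝ) := B.toLinearMap
  have hinj : Function.Injective f := by
    rw [← LinearMap.ker_eq_bot, LinearMap.ker_eq_bot']
    intro v hv
    exact hB v fun w => congrArg (fun B : E →L[ℝ] ℝ => B w) hv
  have hdim : Module.finrank ℝ E = Module.finrank ℝ (E →L[ℝ] ℝ) := by
    rw [LinearEquiv.finrank_eq (LinearMap.toContinuousLinearMap (𝕜 := ℝ) (E := E) (F' := ℝ)).symm]
    exact (Subspace.dual_finrank_eq (K := ℝ) (V := E)).symm
  refine ⟨(LinearEquiv.ofInjectiveOfFinrankEq f hinj hdim).toContinuousLinearEquiv, ?_⟩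
  ext v w
  rfl

/-- `g` is a scalar product. -/
structure IsScalarProduct (g : E →L[ℝ] E →L[ℝ] ℝ) : Prop where
  symm : ∀ v w, g v w = g w v
  pos : ∀ v, v ≠ 0 → 0 < g v v

/-- `S` is the positive square root of `P` with respect to the scalar product `g`. -/
structure IsPosSqrt (g : E →L[ℝ] E →L[ℝ] ℝ) (P S : E →L[ℝ] E) : Prop where
  symm : ∀ v w, g (S v) w = g v (S w)
  pos : ∀ v, v ≠ 0 → 0 < g (S v) v
  sq : S * S = P

theorem IsScalarProduct.nondegenerate {g : E →L[ℝ] E →L[ℝ] ℝ} (hg : IsScalarProduct g) (v : E)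
    (h : ∀ w, g v w = 0) : v = 0 := by
  by_contra hv
  exact (hg.pos v hv).ne' (h v)

theorem IsScalarProduct.ext {g : E →L[ℝ] E →L[ℝ] ℝ} (hg : IsScalarProduct g) {v v' : E}
    (h : ∀ w, g v w = g v' w) : v = v' := by
  rw [← sub_eq_zero]
  refine hg.nondegenerate _ fun w => ?_
  rw [map_sub, sub_apply, h, sub_self]

/-- The scalar product as a bilinear map. -/
def bilinOf (g : E →L[ℝ] E →L[ℝ] ℝ) : E →ₗ[ℝ] E →ₗ[ℝ] ℝ :=
  LinearMap.mk₂ ℝ (fun v w => g v w) (by simp) (by simp) (by simp) (by simp)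

theorem eq_zero_of_mul_add_mul_eq_zero {g : E →L[ℝ] E →L[ℝ] ℝ} (hg : IsScalarProduct g)
    {P₁ S₁ P₂ S₂ D : E →L[ℝ] E} (h₁ : IsPosSqrt g P₁ S₁) (h₂ : IsPosSqrt g P₂ S₂)
    (h : S₁ * D + D * S₂ = 0) : D = 0 := by
  have := eq_zero_of_comp_add_comp_eq_zero (bilinOf g) hg.symm hg.pos S₁.toLinearMap S₂.toLinearMap
    D.toLinearMap h₁.pos h₂.symm h₂.pos (by
      ext v; exact congrArg (fun B : E →L[ℝ] E => B v) h)
  ext v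
  exact congrArg (fun B : E →ₗ[ℝ] E => B v) this

/-- D = S₁ - S₂ satisfies S₁D + DS₂ = S₁² - S₂² = 0. -/
theorem IsPosSqrt.unique {g : E →L[ℝ] E →L[ℝ] ℝ} (hg : IsScalarProduct g)
    {P S₁ S₂ : E →L[ℝ] E} (h₁ : IsPosSqrt g P S₁) (h₂ : IsPosSqrt g P S₂) : S₁ = S₂ := by
  rw [← sub_eq_zero]
  refine eq_zero_of_mul_add_mul_eq_zero hg h₁ h₂ ?_
  rw [mul_sub, sub_mul, h₁.sq, h₂.sq]
  abel

theorem exists_isPosSqrt {g : E →L[ℝ] E →L[ℝ] ℝ} (hg : IsScalarProduct g) {P : E →L[ℝ] E}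
    (hP : ∀ v w, g (P v) w = g v (P w)) (hP' : ∀ v, v ≠ 0 → 0 < g (P v) v) :
    ∃ S, IsPosSqrt g P S := by
  obtain ⟨S, h1, h2, h3⟩ := exists_positive_sqrt (bilinOf g) hg.symm hg.pos P.toLinearMap hP hP'
  refine ⟨LinearMap.toContinuousLinearMap S, h1, h2, ?_⟩
  ext v
  exact congrArg (fun B : E →ₗ[ℝ] E => B v) h3

theorem exists_inverse_of_injective {S : E →L[ℝ] E} (hS : ∀ v, S v = 0 → v = 0) :
    ∃ T : E →L[ℝ] E, S * T = 1 ∧ T * S = 1 := by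
  have hinj : Function.Injective S.toLinearMap := by
    rw [← LinearMap.ker_eq_bot, LinearMap.ker_eq_bot']
    exact hS
  let e := (LinearEquiv.ofInjectiveEndo S.toLinearMap hinj).toContinuousLinearEquiv
  refine ⟨(e.symm : E →L[ℝ] E), ?_, ?_⟩
  · ext v; exact e.apply_symm_apply v
  · ext v; exact e.symm_apply_apply v

theorem IsPosSqrt.injective {g : E →L[ℝ] E →L[ℝ] ℝ} {P S : E →L[ℝ] E} (h : IsPosSqrt g P S) (v : E)
    (hv : S v = 0) : v = 0 := by
  by_contra hne
  have := h.pos v hne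
  simp [hv] at this

/-- The data of a polar decomposition `A = J S` of the operator `A` with `Ω = g(A ·, ·)`. -/
structure IsPolar (g Ω : E →L[ℝ] E →L[ℝ] ℝ) (A S J : E →L[ℝ] E) : Prop where
  form : ∀ v w, g (A v) w = Ω v w
  isPosSqrt : IsPosSqrt g (-(A * A)) S
  mul_eq : J * S = A

/-- A = g⁻¹Ω is skew and injective, so -A² is symmetric and positive; with S its positive square
root, J = A S⁻¹. -/
theorem exists_isPolar {g Ω : E →L[ℝ] E →L[ℝ] ℝ} (hg : IsScalarProduct g)
    (hΩ : ∀ v w, Ω v w = -Ω w v) (hΩ' : ∀ v, (∀ w, Ω v w = 0) → v = 0) :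
    ∃ A S J, IsPolar g Ω A S J := by
  obtain ⟨e, he⟩ := exists_equiv_of_nondegenerate g hg.nondegenerate
  have hA : ∀ v w, g (e.symm (Ω v)) w = Ω v w := by
    intro v w
    have h1 := congrArg (fun B : E →L[ℝ] E →L[ℝ] ℝ => B (e.symm (Ω v)) w) he
    simp only [ContinuousLinearEquiv.coe_coe, e.apply_symm_apply] at h1
    exact h1.symm
  let A : E →L[ℝ] E := (e.symm : (E →L[ℝ] ℝ) →L[ℝ] E).comp Ω
  have hA' : ∀ v w, g (A v) w = Ω v w := hA
  have hanti : ∀ v w, g (A v) w = -g v (A w) := by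
    intro v w
    rw [hA', hΩ, ← hA' w v, hg.symm]
  obtain ⟨S, hS⟩ := exists_isPosSqrt hg (P := -(A * A))
    (fun v w => by
      have : g (A (A v)) w = g v (A (A w)) := by rw [hanti, hanti, neg_neg]
      simpa using this)
    (fun v hv => by
      have h1 : g ((-(A * A)) v) v = g (A v) (A v) := by
        have : g (A (A v)) v = -g (A v) (A v) := hanti _ _
        simp [this]
      rw [h1]
      refine hg.pos _ fun h0 => hv (hΩ' v fun w => ?_)
      rw [← hA', h0]
      simp)
  obtain ⟨T, hT1, hT2⟩ := exists_inverse_of_injective hS.injective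
  exact ⟨A, S, A * T, hA', hS, by rw [mul_assoc, hT2, mul_one]⟩

namespace IsPolar

variable {g Ω : E →L[ℝ] E →L[ℝ] ℝ} {A S J : E →L[ℝ] E}

theorem antisymm (h : IsPolar g Ω A S J) (hg : IsScalarProduct g) (hΩ : ∀ v w, Ω v w = -Ω w v)
    (v w : E) : g (A v) w = -g v (A w) := by
  rw [h.form, hΩ, ← h.form w v, hg.symm]

/-- A S A⁻¹ is again a positive symmetric square root of -A², hence equals S by uniqueness. -/
theorem commute (h : IsPolar g Ω A S J) (hg : IsScalarProduct g) (hΩ : ∀ v w, Ω v w = -Ω w v)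
    (hΩ' : ∀ v, (∀ w, Ω v w = 0) → v = 0) : A * S = S * A := by
  have hAinj : ∀ v, A v = 0 → v = 0 := fun v hv => hΩ' v fun w => by rw [← h.form, hv]; simp
  obtain ⟨T, hT1, hT2⟩ := exists_inverse_of_injective hAinj
  have hanti := h.antisymm hg hΩ
  have hAA : A * A = -(S * S) := by rw [h.isPosSqrt.sq, neg_neg]
  have hAAS : ∀ v, A (A (S v)) = S (A (A v)) := by
    intro v
    have e : A * A * S = S * (A * A) := by rw [hAA]; simp [mul_assoc]
    exact congrArg (fun B : E →L[ℝ] E => B v) e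
  have hAT : ∀ v, A (T v) = v := fun v => congrArg (fun B : E →L[ℝ] E => B v) hT1
  have hTA : ∀ v, T (A v) = v := fun v => congrArg (fun B : E →L[ℝ] E => B v) hT2
  have hS' : IsPosSqrt g (-(A * A)) (A * S * T) := by
    refine ⟨fun v w => ?_, fun v hv => ?_, ?_⟩
    · change g (A (S (T v))) w = g v (A (S (T w)))
      have e1 : g (A (S (T v))) w = -g (T v) (S (A w)) := by rw [hanti, h.isPosSqrt.symm]
      have e2 : g v (A (S (T w))) = -g (T v) (A (A (S (T w)))) := by
        conv_lhs => rw [← hAT v]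
        rw [hanti]
      rw [e1, e2, hAAS, hAT]
    · change 0 < g (A (S (T v))) v
      have hTv : T v ≠ 0 := fun h0 => hv (by rw [← hAT v, h0, map_zero])
      -- With w = A⁻¹v, skewness turns the expression into -g(Sw, A²w) = g(Sw, S²w), a value of the
      -- positive form of S at Sw.
      have e1 : g (A (S (T v))) v = g (S (S (T v))) (S (T v)) := by
        conv_lhs => rw [← hAT v]
        rw [hTA, hanti, ← hg.symm]
        have : A (A (T v)) = -S (S (T v)) := congrArg (fun B : E →L[ℝ] E => B (T v)) hAA
        rw [this, map_neg, neg_apply, neg_neg, h.isPosSqrt.symm]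
      rw [e1]
      exact h.isPosSqrt.pos _ fun h0 => hTv (h.isPosSqrt.injective _ h0)
    · have : A * S * T * (A * S * T) = A * (S * S) * T := by
        calc A * S * T * (A * S * T) = A * S * (T * A) * S * T := by simp only [mul_assoc]
          _ = A * (S * S) * T := by rw [hT2]; simp only [mul_assoc, mul_one]
      rw [this, h.isPosSqrt.sq]
      calc A * -(A * A) * T = -(A * A * (A * T)) := by simp [mul_assoc]
        _ = _ := by rw [hT1, mul_one]
  have e := hS'.unique hg h.isPosSqrt
  calc A * S = A * S * T * A := by rw [mul_assoc (A * S), hT2, mul_one]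
    _ = S * A := by rw [e]

theorem exists_inverse (h : IsPolar g Ω A S J) : ∃ T : E →L[ℝ] E, S * T = 1 ∧ T * S = 1 :=
  exists_inverse_of_injective h.isPosSqrt.injective

theorem mul_eq' (h : IsPolar g Ω A S J) (hg : IsScalarProduct g) (hΩ : ∀ v w, Ω v w = -Ω w v)
    (hΩ' : ∀ v, (∀ w, Ω v w = 0) → v = 0) : S * J = A := by
  obtain ⟨T, hT1, hT2⟩ := h.exists_inverse
  have hJ : J = A * T := by rw [← h.mul_eq, mul_assoc, hT1, mul_one]
  rw [hJ, ← mul_assoc, ← h.commute hg hΩ hΩ', mul_assoc, hT1, mul_one]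

/-- Since SJ = A = JS, one has S J² S = A² = -S², and S is invertible. -/
theorem sq (h : IsPolar g Ω A S J) (hg : IsScalarProduct g) (hΩ : ∀ v w, Ω v w = -Ω w v)
    (hΩ' : ∀ v, (∀ w, Ω v w = 0) → v = 0) : J * J = -1 := by
  obtain ⟨T, hT1, hT2⟩ := h.exists_inverse
  have e : S * (J * J) * S = -(S * S) := by
    calc S * (J * J) * S = (S * J) * (J * S) := by simp only [mul_assoc]
      _ = _ := by rw [h.mul_eq' hg hΩ hΩ', h.mul_eq, h.isPosSqrt.sq, neg_neg]
  calc J * J = (T * S) * (J * J) * (S * T) := by rw [hT1, hT2, one_mul, mul_one]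
    _ = T * (S * (J * J) * S) * T := by simp only [mul_assoc]
    _ = -((T * S) * (S * T)) := by rw [e]; simp [mul_assoc]
    _ = -1 := by rw [hT1, hT2, one_mul]

theorem skew (h : IsPolar g Ω A S J) (hg : IsScalarProduct g) (hΩ : ∀ v w, Ω v w = -Ω w v)
    (hΩ' : ∀ v, (∀ w, Ω v w = 0) → v = 0) (v w : E) : g (J v) w = -g v (J w) := by
  obtain ⟨T, hT1, hT2⟩ := h.exists_inverse
  have hv : v = S (T v) := (congrArg (fun B : E →L[ℝ] E => B v) hT1).symm
  have e1 : ∀ v, J (S v) = A v := fun v => congrArg (fun B : E →L[ℝ] E => B v) h.mul_eq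
  have e2 : ∀ v, S (J v) = A v := fun v => congrArg (fun B : E →L[ℝ] E => B v) (h.mul_eq' hg hΩ hΩ')
  rw [hv, e1, h.isPosSqrt.symm, e2, h.antisymm hg hΩ]

/-- Ω(v, Jw) = g(Av, Jw) = -g(JAv, w) by skewness of J, and JA = J²S = -S. Invariance and positivity
of J with respect to Ω both follow. -/
theorem form_apply (h : IsPolar g Ω A S J) (hg : IsScalarProduct g) (hΩ : ∀ v w, Ω v w = -Ω w v)
    (hΩ' : ∀ v, (∀ w, Ω v w = 0) → v = 0) (v w : E) : Ω v (J w) = g (S v) w := by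
  have e2 : J (A v) = -S v := by
    have : J * A = -S := by rw [← h.mul_eq, ← mul_assoc, h.sq hg hΩ hΩ', neg_one_mul]
    exact congrArg (fun B : E →L[ℝ] E => B v) this
  have := h.skew hg hΩ hΩ' (A v) w
  rw [e2, map_neg, neg_apply] at this
  rw [← h.form]
  linarith

theorem invariant (h : IsPolar g Ω A S J) (hg : IsScalarProduct g) (hΩ : ∀ v w, Ω v w = -Ω w v)
    (hΩ' : ∀ v, (∀ w, Ω v w = 0) → v = 0) (v w : E) : Ω (J v) (J w) = Ω v w := by
  rw [h.form_apply hg hΩ hΩ']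
  have : S (J v) = A v := congrArg (fun B : E →L[ℝ] E => B v) (h.mul_eq' hg hΩ hΩ')
  rw [this, h.form]

theorem positive (h : IsPolar g Ω A S J) (hg : IsScalarProduct g) (hΩ : ∀ v w, Ω v w = -Ω w v)
    (hΩ' : ∀ v, (∀ w, Ω v w = 0) → v = 0) {v : E} (hv : v ≠ 0) : 0 < Ω v (J v) := by
  rw [h.form_apply hg hΩ hΩ']
  exact h.isPosSqrt.pos v hv

/-- If `A` rotates the plane spanned by `Z` and `R`, then so does `J`. -/
theorem apply_eq_of_rotation (h : IsPolar g Ω A S J) (hg : IsScalarProduct g) {Z R : E}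
    (hZ : A Z = R) (hR : A R = -Z) : J Z = R := by
  have h1 : S (S Z) = Z := by
    have := congrArg (fun B : E →L[ℝ] E => B Z) h.isPosSqrt.sq
    change S (S Z) = -(A (A Z)) at this
    rw [this, hZ, hR, neg_neg]
  -- From S²Z = Z, a nonzero SZ - Z would be an eigenvector of S for the eigenvalue -1.
  have h2 : S Z = Z := by
    by_contra hne
    have hw : S Z - Z ≠ 0 := sub_ne_zero.2 hne
    have e : S (S Z - Z) = -(S Z - Z) := by rw [map_sub, h1, neg_sub]
    have p := h.isPosSqrt.pos _ hw
    rw [e, map_neg, neg_apply] at p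
    have := hg.pos _ hw
    linarith
  have h3 : J (S Z) = A Z := congrArg (fun B : E →L[ℝ] E => B Z) h.mul_eq
  rw [← hZ, ← h3, h2]

end IsPolar

end Polar

/-! ### Smooth dependence of the polar decomposition on its data. -/

section SmoothPolar

variable {E : Type*} [NormedAddCommGroup E] [NormedSpace ℝ E] [FiniteDimensional ℝ E]

set_option synthInstance.maxHeartbeats 200000 in
theorem exists_coercive_constant {b : E →L[ℝ] E →L[ℝ] ℝ} (hb : ∀ v, v ≠ 0 → 0 < b v v) :
    ∃ c > 0, ∀ v, c * ‖v‖ ^ 2 ≤ b v v := by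
  have hc : IsCompact (Metric.sphere (0 : E) 1) := isCompact_sphere 0 1
  rcases (Metric.sphere (0 : E) 1).eq_empty_or_nonempty with h | h
  · refine ⟨1, one_pos, fun v => ?_⟩
    have hv : v = 0 := by
      by_contra hv
      have : ‖v‖⁻¹ • v ∈ Metric.sphere (0 : E) 1 := by
        simp [norm_smul, hv]
      rw [h] at this
      exact this
    simp [hv]
  · obtain ⟨u, hu, hmin⟩ := hc.exists_isMinOn h
      (f := fun v => b v v) (b.continuous.clm_apply continuous_id).continuousOn
    have hu0 : u ≠ 0 := by
      rintro rfl
      simp at hu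
    refine ⟨b u u, hb u hu0, fun v => ?_⟩
    by_cases hv : v = 0
    · simp [hv]
    have hv' : 0 < ‖v‖ := norm_pos_iff.2 hv
    have h1 : ‖v‖⁻¹ • v ∈ Metric.sphere (0 : E) 1 := by
      simp [norm_smul, hv]
    have h2 : b u u ≤ b (‖v‖⁻¹ • v) (‖v‖⁻¹ • v) := hmin h1
    simp only [map_smul, smul_apply, smul_eq_mul] at h2
    have h3 : b v v = ‖v‖ ^ 2 * (‖v‖⁻¹ * (‖v‖⁻¹ * b v v)) := by
      field_simp
    rw [h3, mul_comm]
    gcongr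

set_option synthInstance.maxHeartbeats 200000 in
-- Positive definiteness is an open condition: the coercivity constant of the limit absorbs the
-- operator norm of the difference, uniformly in `v`.
theorem eventually_pos_of_tendsto {ι : Type*} {l : Filter ι} {b : ι → E →L[ℝ] E →L[ℝ] ℝ}
    {b₀ : E →L[ℝ] E →L[ℝ] ℝ} (hb : Tendsto b l (𝓝 b₀)) (hpos : ∀ v, v ≠ 0 → 0 < b₀ v v) :
    ∀ᶠ i in l, ∀ v, v ≠ 0 → 0 < b i v v := by
  obtain ⟨c, hc, h⟩ := exists_coercive_constant hpos
  filter_upwards [hb.eventually (Metric.ball_mem_nhds b₀ hc)] with i hi v hv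
  have h1 : ‖(b i - b₀) v v‖ ≤ ‖b i - b₀‖ * ‖v‖ * ‖v‖ := (b i - b₀).le_opNorm₂ v v
  have h2 : ‖b i - b₀‖ < c := (dist_eq_norm (b i) b₀).symm.trans_lt hi
  have hv' : 0 < ‖v‖ := norm_pos_iff.2 hv
  have h3 : ‖b i - b₀‖ * ‖v‖ * ‖v‖ < c * ‖v‖ ^ 2 := by
    rw [mul_assoc, ← sq]
    gcongr
  have h4 := (abs_le.1 h1).1
  have h5 : (b i - b₀) v v = b i v v - b₀ v v := rfl
  have := h v
  linarith

theorem tendsto_clm_comp {F G H ι : Type*} [NormedAddCommGroup F] [NormedSpace ℝ F]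
    [NormedAddCommGroup G] [NormedSpace ℝ G] [NormedAddCommGroup H] [NormedSpace ℝ H]
    {l : Filter ι} {a : ι → G →L[ℝ] H} {b : ι → F →L[ℝ] G} {a₀ : G →L[ℝ] H} {b₀ : F →L[ℝ] G}
    (ha : Tendsto a l (𝓝 a₀)) (hb : Tendsto b l (𝓝 b₀)) :
    Tendsto (fun i => (a i).comp (b i)) l (𝓝 (a₀.comp b₀)) :=
  ((continuous_fst.clm_comp continuous_snd).tendsto (a₀, b₀)).comp (ha.prodMk_nhds hb)

/-- The `g`-adjoint of T written as g⁻¹ Tᵗ g, a formula visibly continuous in g and T where g is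
nondegenerate. -/
theorem adjoint_spec {g : E →L[ℝ] E →L[ℝ] ℝ} (hg : IsScalarProduct g) (T : E →L[ℝ] E) (v w : E) :
    g ((g.inverse.comp (((ContinuousLinearMap.compL ℝ E E ℝ).flip T).comp g)) v) w = g v (T w) := by
  obtain ⟨e, he⟩ := exists_equiv_of_nondegenerate g hg.nondegenerate
  rw [← he]
  simp

set_option synthInstance.maxHeartbeats 200000 in
/-- Locally near a positive definite one, the positive square root is a smooth function of the
operator, and independent of the scalar product. -/
theorem exists_smooth_sqrt {ι : Type*} {l : Filter ι} {g : ι → E →L[ℝ] E →L[ℝ] ℝ}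
    {P S : ι → E →L[ℝ] E} {g₀ : E →L[ℝ] E →L[ℝ] ℝ} {P₀ S₀ : E →L[ℝ] E}
    (hg : Tendsto g l (𝓝 g₀)) (hP : Tendsto P l (𝓝 P₀)) (hg₀ : IsScalarProduct g₀)
    (h₀ : IsPosSqrt g₀ P₀ S₀) (hgl : ∀ᶠ i in l, IsScalarProduct (g i))
    (hS : ∀ᶠ i in l, IsPosSqrt (g i) (P i) (S i)) :
    ∃ σ : (E →L[ℝ] E) → (E →L[ℝ] E), ContDiffAt ℝ ∞ σ P₀ ∧ ∀ᶠ i in l, S i = σ (P i) := by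
  let f : (E →L[ℝ] E) → (E →L[ℝ] E) := fun T => T * T
  have hf : ContDiff ℝ ∞ f := contDiff_id.mul contDiff_id
  let D : (E →L[ℝ] E) →ₗ[ℝ] (E →L[ℝ] E) :=
    { toFun := fun T => S₀ * T + T * S₀
      map_add' := fun T T' => by simp only [mul_add, add_mul]; abel
      map_smul' := fun c T => by simp }
  have hD : Function.Injective D := by
    rw [← LinearMap.ker_eq_bot, LinearMap.ker_eq_bot']
    intro T hT
    exact eq_zero_of_mul_add_mul_eq_zero hg₀ h₀ h₀ hT
  let e : (E →L[ℝ] E) ≃L[ℝ] (E →L[ℝ] E) := (LinearEquiv.ofInjectiveEndo D hD).toContinuousLinearEquiv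
  -- Squaring has derivative T ↦ S₀T + TS₀ at S₀, an isomorphism by the Sylvester lemma. The inverse
  -- function theorem then supplies σ.
  have hf' : HasFDerivAt f (e : (E →L[ℝ] E) →L[ℝ] (E →L[ℝ] E)) S₀ := by
    have h1 : HasFDerivAt f _ S₀ := (hasFDerivAt_id (𝕜 := ℝ) S₀).mul' (hasFDerivAt_id (𝕜 := ℝ) S₀)
    refine h1.congr_fderiv ?_
    ext T v
    simp [e, D]
  have hn : (∞ : WithTop ℕ∞) ≠ 0 := by simp
  let σ := hf.contDiffAt.localInverse hf' hn
  have hfS : f S₀ = P₀ := h₀.sq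
  have hσ : ContDiffAt ℝ ∞ σ P₀ := hfS ▸ hf.contDiffAt.to_localInverse hf' hn
  have hσS : σ P₀ = S₀ := by rw [← hfS]; exact hf.contDiffAt.localInverse_apply_image hf' hn
  have hstr := hf.contDiffAt.hasStrictFDerivAt' hf' hn
  have hleft : ∀ᶠ T in 𝓝 S₀, σ (f T) = T := hstr.eventually_left_inverse
  have hright : ∀ᶠ Q in 𝓝 P₀, f (σ Q) = Q := by
    rw [← hfS]; exact hstr.eventually_right_inverse
  refine ⟨σ, hσ, ?_⟩
  have hT : Tendsto (fun i => σ (P i)) l (𝓝 S₀) := by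
    have := hσ.continuousAt.tendsto.comp hP
    rwa [hσS] at this
  let adj : (E →L[ℝ] E →L[ℝ] ℝ) → (E →L[ℝ] E) → (E →L[ℝ] E) := fun g T =>
    g.inverse.comp (((ContinuousLinearMap.compL ℝ E E ℝ).flip T).comp g)
  obtain ⟨e₀, he₀⟩ := exists_equiv_of_nondegenerate g₀ hg₀.nondegenerate
  have hinv : ContinuousAt (ContinuousLinearMap.inverse : (E →L[ℝ] E →L[ℝ] ℝ) → _) g₀ := by
    rw [← he₀]
    exact (contDiffAt_map_inverse (n := 0) e₀).continuousAt
  have hadj : Tendsto (fun i => adj (g i) (σ (P i))) l (𝓝 (adj g₀ S₀)) := by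
    have h1 := hinv.tendsto.comp hg
    have h2 : Tendsto (fun i => (ContinuousLinearMap.compL ℝ E E ℝ).flip (σ (P i))) l
        (𝓝 ((ContinuousLinearMap.compL ℝ E E ℝ).flip S₀)) :=
      ((ContinuousLinearMap.compL ℝ E E ℝ).flip.continuous.tendsto _).comp hT
    exact tendsto_clm_comp h1 (tendsto_clm_comp h2 hg)
  have hadj₀ : adj g₀ S₀ = S₀ := by
    ext v
    refine hg₀.ext fun w => ?_
    rw [h₀.symm]
    exact adjoint_spec hg₀ S₀ v w
  -- The operator σ(P) is near S₀, but its symmetry is not yet known. Its adjoint also tends to S₀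
  -- and also squares to P, so local injectivity of squaring identifies the two. Symmetry,
  -- positivity and uniqueness then give S = σ(P).
  rw [hadj₀] at hadj
  have hpos : ∀ᶠ i in l, ∀ v, v ≠ 0 → 0 < g i (σ (P i) v) v :=
    eventually_pos_of_tendsto (b := fun i => (g i).comp (σ (P i))) (tendsto_clm_comp hg hT) h₀.pos
  filter_upwards [hgl, hS, hP.eventually hright, hadj.eventually hleft, hpos] with i hgi hSi hri hli hpi
  have hadjsq : f (adj (g i) (σ (P i))) = P i := by
    ext v
    refine hgi.ext fun w => ?_
    have a := adjoint_spec hgi (σ (P i))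
    have e1 : g i (adj (g i) (σ (P i)) (adj (g i) (σ (P i)) v)) w = g i v (σ (P i) (σ (P i) w)) :=
      (a _ _).trans (a _ _)
    have e2 : σ (P i) (σ (P i) w) = P i w := congrArg (fun B : E →L[ℝ] E => B w) hri
    refine e1.trans ?_
    rw [e2, ← hSi.sq]
    change g i v (S i (S i w)) = g i (S i (S i v)) w
    rw [hSi.symm, hSi.symm]
  rw [hadjsq] at hli
  refine hSi.unique hgi ⟨fun v w => ?_, hpi, hri⟩
  have a := adjoint_spec hgi (σ (P i)) v w
  conv_lhs => rw [hli]
  exact a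

/-- The decomposition may be chosen separately at each point: A = g⁻¹Ω, S = σ(-A²) and J = A S⁻¹ are
forced, and each formula is smooth in its arguments. -/
theorem contMDiffAt_of_isPolar {M : Type*} [TopologicalSpace M] [ChartedSpace E M]
    {g Ω : M → E →L[ℝ] E →L[ℝ] ℝ} {A S J : M → E →L[ℝ] E} {x₀ : M}
    (hg : ContMDiffAt 𝓘(ℝ, E) 𝓘(ℝ, E →L[ℝ] E →L[ℝ] ℝ) ∞ g x₀)
    (hΩ : ContMDiffAt 𝓘(ℝ, E) 𝓘(ℝ, E →L[ℝ] E →L[ℝ] ℝ) ∞ Ω x₀)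
    (hgx : ∀ᶠ x in 𝓝 x₀, IsScalarProduct (g x))
    (hpol : ∀ᶠ x in 𝓝 x₀, IsPolar (g x) (Ω x) (A x) (S x) (J x)) :
    ContMDiffAt 𝓘(ℝ, E) 𝓘(ℝ, E →L[ℝ] E) ∞ J x₀ := by
  have hAeq : ∀ᶠ x in 𝓝 x₀, A x = (g x).inverse.comp (Ω x) := by
    filter_upwards [hgx, hpol] with x hx hp
    ext v
    refine hx.ext fun w => ?_
    rw [hp.form]
    obtain ⟨e, he⟩ := exists_equiv_of_nondegenerate (g x) hx.nondegenerate
    rw [← he]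
    simp
  obtain ⟨e₀, he₀⟩ := exists_equiv_of_nondegenerate (g x₀) hgx.self_of_nhds.nondegenerate
  have hginv : ContMDiffAt 𝓘(ℝ, E) 𝓘(ℝ, (E →L[ℝ] ℝ) →L[ℝ] E) ∞ (fun x => (g x).inverse) x₀ := by
    have h : ContDiffAt ℝ ∞ (ContinuousLinearMap.inverse : (E →L[ℝ] E →L[ℝ] ℝ) → _) (g x₀) := by
      rw [← he₀]
      exact contDiffAt_map_inverse e₀
    exact h.contMDiffAt.comp x₀ hg
  have hA : ContMDiffAt 𝓘(ℝ, E) 𝓘(ℝ, E →L[ℝ] E) ∞ A x₀ :=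
    (hginv.clm_comp hΩ).congr_of_eventuallyEq hAeq
  have hP : ContMDiffAt 𝓘(ℝ, E) 𝓘(ℝ, E →L[ℝ] E) ∞ (fun x => -(A x * A x)) x₀ := by
    have h1 : ContMDiffAt 𝓘(ℝ, E) 𝓘(ℝ, E →L[ℝ] E) ∞ (fun x => A x * A x) x₀ := hA.clm_comp hA
    have h2 : ContDiff ℝ ∞ (fun T : E →L[ℝ] E => -T) := contDiff_neg
    exact h2.contMDiff.contMDiffAt.comp x₀ h1
  obtain ⟨σ, hσ, hσS⟩ := exists_smooth_sqrt hg.continuousAt.tendsto hP.continuousAt.tendsto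
    hgx.self_of_nhds hpol.self_of_nhds.isPosSqrt hgx (hpol.mono fun x hx => hx.isPosSqrt)
  have hSsm : ContMDiffAt 𝓘(ℝ, E) 𝓘(ℝ, E →L[ℝ] E) ∞ S x₀ :=
    ContMDiffAt.congr_of_eventuallyEq (hσ.contMDiffAt.comp x₀ hP) hσS
  have hSe : ∀ᶠ x in 𝓝 x₀, ∃ e : E ≃L[ℝ] E, (e : E →L[ℝ] E) = S x := by
    filter_upwards [hpol] with x hx
    obtain ⟨T, hT1, hT2⟩ := hx.exists_inverse
    refine ⟨ContinuousLinearEquiv.equivOfInverse (S x) T (fun v => ?_) (fun v => ?_), rfl⟩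
    · exact congrArg (fun B : E →L[ℝ] E => B v) hT2
    · exact congrArg (fun B : E →L[ℝ] E => B v) hT1
  obtain ⟨e₁, he₁⟩ := hSe.self_of_nhds
  have hSinv : ContMDiffAt 𝓘(ℝ, E) 𝓘(ℝ, E →L[ℝ] E) ∞ (fun x => (S x).inverse) x₀ := by
    have h : ContDiffAt ℝ ∞ (ContinuousLinearMap.inverse : (E →L[ℝ] E) → _) (S x₀) := by
      rw [← he₁]
      exact contDiffAt_map_inverse e₁
    exact h.contMDiffAt.comp x₀ hSsm
  refine (hA.clm_comp hSinv).congr_of_eventuallyEq ?_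
  filter_upwards [hpol, hSe] with x hx ⟨e, he⟩
  rw [← hx.mul_eq, ← he]
  ext v
  simp

end SmoothPolar

/-! ### Coordinate frames for vectors, differentials and bilinear forms. -/

section Frames

variable {E : Type*} [NormedAddCommGroup E] [NormedSpace ℝ E]
  {M : Type*} [TopologicalSpace M] [ChartedSpace E M] [IsManifold 𝓘(ℝ, E) ∞ M]

/-- The coordinates of tangent vectors in the chart at `x₀`. -/
def chartCoord (x₀ x : M) : TangentSpace 𝓘(ℝ, E) x →L[ℝ] E :=
  (trivializationAt E (TangentSpace 𝓘(ℝ, E)) x₀).continuousLinearMapAt ℝ x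

theorem chartCoord_chartFrame {x₀ x : M} (hx : x ∈ (chartAt E x₀).source) (v : E) :
    chartCoord x₀ x (chartFrame x₀ x v) = v :=
  Trivialization.continuousLinearMapAt_symmL _ (by simpa using hx) v

theorem chartFrame_chartCoord {x₀ x : M} (hx : x ∈ (chartAt E x₀).source)
    (v : TangentSpace 𝓘(ℝ, E) x) : chartFrame x₀ x (chartCoord x₀ x v) = v :=
  Trivialization.symmL_continuousLinearMapAt _ (by simpa using hx) v

/-- The bilinear form with coordinates `b` in the chart at `x₀`. -/
def ofChartBilinear (x₀ : M) (b : M → E →L[ℝ] E →L[ℝ] ℝ) (x : M) :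
    TangentSpace 𝓘(ℝ, E) x →L[ℝ] TangentSpace 𝓘(ℝ, E) x →L[ℝ] ℝ :=
  let c : E →L[ℝ] E := chartCoord x₀ x
  ((b x).bilinearComp c c : E →L[ℝ] E →L[ℝ] ℝ)

theorem ofChartBilinear_apply (x₀ : M) (b : M → E →L[ℝ] E →L[ℝ] ℝ) (x : M)
    (v w : TangentSpace 𝓘(ℝ, E) x) :
    ofChartBilinear x₀ b x v w = b x (chartCoord x₀ x v) (chartCoord x₀ x w) := rfl

theorem chartBilinear_ofChartBilinear {x₀ x : M} (hx : x ∈ (chartAt E x₀).source)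
    (b : M → E →L[ℝ] E →L[ℝ] ℝ) : chartBilinear (ofChartBilinear x₀ b) x₀ x = b x := by
  ext v w
  rw [chartBilinear_apply, ofChartBilinear_apply, chartCoord_chartFrame hx,
    chartCoord_chartFrame hx]

/-- Smoothness of a field of bilinear forms. -/
abbrev IsSmoothBilinearAt
    (g : ∀ x : M, TangentSpace 𝓘(ℝ, E) x →L[ℝ] TangentSpace 𝓘(ℝ, E) x →L[ℝ] ℝ) (x : M) : Prop :=
  ContMDiffAt 𝓘(ℝ, E) (𝓘(ℝ, E).prod 𝓘(ℝ, E →L[ℝ] E →L[ℝ] ℝ)) ∞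
    (fun x => (TotalSpace.mk' (E →L[ℝ] E →L[ℝ] ℝ) x (g x) :
      TotalSpace (E →L[ℝ] E →L[ℝ] ℝ)
        (fun x : M => TangentSpace 𝓘(ℝ, E) x →L[ℝ] TangentSpace 𝓘(ℝ, E) x →L[ℝ] Bundle.Trivial M ℝ x))) x

theorem isSmoothBilinearAt_ofChartBilinear {x₀ x : M} (hx : x ∈ (chartAt E x₀).source)
    {b : M → E →L[ℝ] E →L[ℝ] ℝ} (hb : ContMDiffAt 𝓘(ℝ, E) 𝓘(ℝ, E →L[ℝ] E →L[ℝ] ℝ) ∞ b x) :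
    IsSmoothBilinearAt (ofChartBilinear x₀ b) x := by
  refine (contMDiffAt_bilinear_iff x₀ hx).2 (hb.congr_of_eventuallyEq ?_)
  filter_upwards [(chartAt E x₀).open_source.mem_nhds hx] with y hy
  exact chartBilinear_ofChartBilinear hy b

theorem contMDiffAt_extChartAt_symm {x₀ y : M} (hy : y ∈ (chartAt E x₀).source) :
    ContMDiffAt 𝓘(ℝ, E) 𝓘(ℝ, E) ∞ (extChartAt 𝓘(ℝ, E) x₀).symm (extChartAt 𝓘(ℝ, E) x₀ y) :=
  (contMDiffOn_extChartAt_symm x₀).contMDiffAt ((isOpen_extChartAt_target x₀).mem_nhds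
    ((extChartAt 𝓘(ℝ, E) x₀).map_source (by simpa using hy)))

theorem dfun_comp_chartFrame {f : M → ℝ} {x₀ y : M} (hy : y ∈ (chartAt E x₀).source)
    (hf : MDifferentiableAt 𝓘(ℝ, E) 𝓘(ℝ, ℝ) f y) :
    ((dfun f y).comp (chartFrame x₀ y) : E →L[ℝ] ℝ) =
      fderiv ℝ (fun b => f ((extChartAt 𝓘(ℝ, E) x₀).symm b)) (extChartAt 𝓘(ℝ, E) x₀ y) := by
  have hy' : y ∈ (extChartAt 𝓘(ℝ, E) x₀).source := by simpa using hy
  have hl := (extChartAt 𝓘(ℝ, E) x₀).left_inv hy'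
  have h3 : MDifferentiableAt 𝓘(ℝ, E) 𝓘(ℝ, ℝ) f
      ((extChartAt 𝓘(ℝ, E) x₀).symm (extChartAt 𝓘(ℝ, E) x₀ y)) := by
    rw [hl]
    exact hf
  have h4 := mfderiv_comp _ h3 ((contMDiffAt_extChartAt_symm hy).mdifferentiableAt (by simp))
  rw [LiouvilleManifold.chartFrame_eq_mfderiv hy]
  have hcongr : ∀ y' (_ : y' = y), (dfun f y : E →L[ℝ] ℝ) = dfun f y' := by
    intro y' h; subst h; rfl
  rw [hcongr _ hl]
  simp only [mfderiv_eq_fderiv, Function.comp_def] at h4 ⊢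
  exact h4.symm

theorem contMDiffAt_dfun {f : M → ℝ} {x₀ x : M} (hx : x ∈ (chartAt E x₀).source) {U : Set M}
    (hU : U ∈ 𝓝 x) (hf : ContMDiffOn 𝓘(ℝ, E) 𝓘(ℝ, ℝ) ∞ f U) :
    ContMDiffAt 𝓘(ℝ, E) 𝓘(ℝ, E →L[ℝ] ℝ) ∞
      (fun y => (dfun f y).comp (chartFrame x₀ y : E →L[ℝ] E)) x := by
  obtain ⟨V, hVU, hV, hxV⟩ := mem_nhds_iff.1 hU
  have hx' : x ∈ (extChartAt 𝓘(ℝ, E) x₀).source := by simpa using hx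
  have h1 : ContMDiffAt 𝓘(ℝ, E) 𝓘(ℝ, ℝ) ∞ (f ∘ (extChartAt 𝓘(ℝ, E) x₀).symm) (extChartAt 𝓘(ℝ, E) x₀ x) := by
    refine ContMDiffAt.comp _ ?_ (contMDiffAt_extChartAt_symm hx)
    rw [(extChartAt 𝓘(ℝ, E) x₀).left_inv hx']
    exact hf.contMDiffAt hU
  have h2 := h1.contDiffAt.fderiv_right (m := ∞) (by simp)
  refine (h2.contMDiffAt.comp x (contMDiffAt_extChartAt' (n := ∞) hx)).congr_of_eventuallyEq ?_
  filter_upwards [(chartAt E x₀).open_source.mem_nhds hx, hV.mem_nhds hxV] with y hy hyV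
  exact dfun_comp_chartFrame hy
    (((hf.mono hVU).contMDiffAt (hV.mem_nhds hyV)).mdifferentiableAt (by simp))

end Frames

/-! ### Scalar products adapted to prescribed dual vectors. -/

section ScalarProducts

variable {E : Type*} [NormedAddCommGroup E] [NormedSpace ℝ E] [FiniteDimensional ℝ E]

variable (E) in
theorem exists_isScalarProduct : ∃ g : E →L[ℝ] E →L[ℝ] ℝ, IsScalarProduct g := by
  let e : E ≃L[ℝ] EuclideanSpace ℝ (Fin (Module.finrank ℝ E)) := toEuclidean
  let f : E →L[ℝ] EuclideanSpace ℝ (Fin (Module.finrank ℝ E)) := e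
  let b : EuclideanSpace ℝ (Fin (Module.finrank ℝ E)) →L[ℝ]
    EuclideanSpace ℝ (Fin (Module.finrank ℝ E)) →L[ℝ] ℝ := innerSL ℝ
  refine ⟨b.bilinearComp f f, fun v w => ?_, fun v hv => ?_⟩
  · exact real_inner_comm (e w) (e v)
  · have h : e v ≠ 0 := by simpa using hv
    exact real_inner_self_pos.2 h

/-- The scalar product `g` modified so that `Z`, `R` become dual to the covectors `a`, `b`. -/
def adaptedForm (g : E →L[ℝ] E →L[ℝ] ℝ) (p : (E →L[ℝ] ℝ) × (E →L[ℝ] ℝ) × E × E × ℝ) :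
    E →L[ℝ] E →L[ℝ] ℝ :=
  let P : E →L[ℝ] E := ContinuousLinearMap.id ℝ E - p.2.2.2.2 • (p.1.smulRight p.2.2.1 +
    p.2.1.smulRight p.2.2.2.1)
  ((ContinuousLinearMap.compL ℝ E E ℝ).flip P).comp (g.comp P) +
    p.2.2.2.2 • (p.1.smulRight p.1 + p.2.1.smulRight p.2.1)

theorem adaptedForm_apply (g : E →L[ℝ] E →L[ℝ] ℝ) (a b : E →L[ℝ] ℝ) (Z R : E) (k : ℝ) (v w : E) :
    adaptedForm g (a, b, Z, R, k) v w =
      g (v - k • (a v • Z + b v • R)) (w - k • (a w • Z + b w • R)) + k * (a v * a w + b v * b w) := by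
  rfl

set_option synthInstance.maxHeartbeats 200000 in
theorem contDiff_adaptedForm (g : E →L[ℝ] E →L[ℝ] ℝ) : ContDiff ℝ ∞ (adaptedForm g) := by
  refine contDiff_clm_apply_iff.2 fun v => contDiff_clm_apply_iff.2 fun w => ?_
  have h : ∀ p : (E →L[ℝ] ℝ) × (E →L[ℝ] ℝ) × E × E × ℝ, adaptedForm g p v w =
      g (v - p.2.2.2.2 • (p.1 v • p.2.2.1 + p.2.1 v • p.2.2.2.1))
        (w - p.2.2.2.2 • (p.1 w • p.2.2.1 + p.2.1 w • p.2.2.2.1)) +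
        p.2.2.2.2 * (p.1 v * p.1 w + p.2.1 v * p.2.1 w) := fun p => adaptedForm_apply g _ _ _ _ _ v w
  simp only [h]
  have h1 : ∀ u : E, ContDiff ℝ ∞ (fun p : (E →L[ℝ] ℝ) × (E →L[ℝ] ℝ) × E × E × ℝ =>
      u - p.2.2.2.2 • (p.1 u • p.2.2.1 + p.2.1 u • p.2.2.2.1)) := fun u => by fun_prop
  have h2 : ContDiff ℝ ∞ (fun p : (E →L[ℝ] ℝ) × (E →L[ℝ] ℝ) × E × E × ℝ =>
      p.2.2.2.2 * (p.1 v * p.1 w + p.2.1 v * p.2.1 w)) := by fun_prop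
  exact ((g.contDiff.comp (h1 v)).clm_apply (h1 w)).add h2

/-- No duality between the vectors and covectors is needed: a vector killed by id - k(a ⊗ Z + b ⊗ R)
with a(v) = b(v) = 0 is already zero. -/
theorem isScalarProduct_adaptedForm {g : E →L[ℝ] E →L[ℝ] ℝ} (hg : IsScalarProduct g)
    (a b : E →L[ℝ] ℝ) (Z R : E) {k : ℝ} (hk : 0 < k) :
    IsScalarProduct (adaptedForm g (a, b, Z, R, k)) := by
  refine ⟨fun v w => ?_, fun v hv => ?_⟩
  · rw [adaptedForm_apply, adaptedForm_apply, hg.symm]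
    ring
  · rw [adaptedForm_apply]
    by_cases h : v - k • (a v • Z + b v • R) = 0
    · have h1 : 0 < a v * a v + b v * b v := by
        by_contra hn
        have ha : a v = 0 := by nlinarith [mul_self_nonneg (a v), mul_self_nonneg (b v)]
        have hb : b v = 0 := by nlinarith [mul_self_nonneg (a v), mul_self_nonneg (b v)]
        rw [ha, hb] at h
        simp at h
        exact hv h
      rw [h]
      simp only [map_zero]
      positivity
    · have := hg.pos _ h
      nlinarith [mul_self_nonneg (a v), mul_self_nonneg (b v),
        mul_nonneg hk.le (add_nonneg (mul_self_nonneg (a v)) (mul_self_nonneg (b v)))]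

/-- For k = 1/r the operator id - k(a ⊗ Z + b ⊗ R) kills Z, so only the rank-one term (1/r) a(Z) a =
a survives. -/
theorem adaptedForm_left {g : E →L[ℝ] E →L[ℝ] ℝ} {a b : E →L[ℝ] ℝ} {Z R : E} {r : ℝ} (hr : 0 < r)
    (haZ : a Z = r) (hbZ : b Z = 0) (w : E) : adaptedForm g (a, b, Z, R, r⁻¹) Z w = a w := by
  rw [adaptedForm_apply, haZ, hbZ]
  simp [smul_smul, hr.ne']

theorem adaptedForm_right {g : E →L[ℝ] E →L[ℝ] ℝ} {a b : E →L[ℝ] ℝ} {Z R : E} {r : ℝ} (hr : 0 < r)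
    (haR : a R = 0) (hbR : b R = r) (w : E) : adaptedForm g (a, b, Z, R, r⁻¹) R w = b w := by
  rw [adaptedForm_apply, haR, hbR]
  simp [smul_smul, hr.ne']

theorem adaptedForm_dual {g : E →L[ℝ] E →L[ℝ] ℝ} {a b : E →L[ℝ] ℝ} {Z R : E} {r : ℝ} (hr : 0 < r)
    {T T' : E →L[ℝ] E} (hT : ∀ v, T (T' v) = v) (haZ : a Z = r) (hbZ : b Z = 0) (haR : a R = 0)
    (hbR : b R = r) (w : E) :
    adaptedForm g (a.comp T, b.comp T, T' Z, T' R, r⁻¹) (T' Z) (T' w) = a w ∧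
    adaptedForm g (a.comp T, b.comp T, T' Z, T' R, r⁻¹) (T' R) (T' w) = b w := by
  rw [adaptedForm_left hr (by simp [hT, haZ]) (by simp [hT, hbZ]),
    adaptedForm_right hr (by simp [hT, haR]) (by simp [hT, hbR])]
  simp [hT]

theorem IsScalarProduct.conj {g : E →L[ℝ] E →L[ℝ] ℝ} (hg : IsScalarProduct g) {T T' : E →L[ℝ] E}
    (hT : ∀ v, T' (T v) = v) : IsScalarProduct (g.bilinearComp T T) := by
  refine ⟨fun v w => hg.symm _ _, fun v hv => hg.pos _ fun h => hv ?_⟩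
  exact (hT v).symm.trans ((congrArg T' h).trans (map_zero T'))

theorem IsPolar.conj {g Ω : E →L[ℝ] E →L[ℝ] ℝ} {A S J T T' : E →L[ℝ] E} (h : IsPolar g Ω A S J)
    (hT : ∀ v, T' (T v) = v) (hT' : ∀ v, T (T' v) = v) :
    IsPolar (g.bilinearComp T T) (Ω.bilinearComp T T) (T' ∘L A ∘L T) (T' ∘L S ∘L T)
      (T' ∘L J ∘L T) := by
  have hsq : ∀ v, S (S v) = -(A (A v)) := fun v => congrArg (fun B : E →L[ℝ] E => B v) h.isPosSqrt.sq
  refine ⟨fun v w => ?_, ⟨fun v w => ?_, fun v hv => ?_, ?_⟩, ?_⟩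
  · simp [hT', h.form]
  · simp [hT', h.isPosSqrt.symm]
  · simp only [ContinuousLinearMap.bilinearComp_apply, ContinuousLinearMap.comp_apply, hT']
    refine h.isPosSqrt.pos _ fun h0 => hv ?_
    rw [← hT v, h0, map_zero]
  · ext v
    simp [hT', hsq]
  · ext v
    change T' (J (T (T' (S (T v))))) = T' (A (T v))
    rw [hT']
    exact congrArg (fun B : E →L[ℝ] E => T' (B (T v))) h.mul_eq

end ScalarProducts

/-! ### Compact exhaustion, the function G, adapted metrics and the structure J. -/

namespace LiouvilleManifold

variable {E M E' N : Type*}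
  [NormedAddCommGroup E] [NormedSpace ℝ E] [TopologicalSpace M] [ChartedSpace E M]
  [NormedAddCommGroup E'] [NormedSpace ℝ E'] [TopologicalSpace N] [ChartedSpace E' N]
  [IsManifold 𝓘(ℝ, E) ∞ M] [IsManifold 𝓘(ℝ, E') ∞ N]
  (X : LiouvilleManifold E M E' N)

theorem isCompact_image_cone [CompactSpace N] {a b : ℝ} (ha : 0 < a) :
    IsCompact (X.cone '' (univ ×ˢ Icc a b)) := by
  refine (isCompact_univ.prod isCompact_Icc).image_of_continuousOn
    (X.cone.continuousOn.mono fun p hp => ?_)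
  rw [X.cone_source]
  exact ⟨hp.1, ha.trans_le hp.2.1⟩

theorem isCompact_compl_image_cone [CompactSpace N] {R : ℝ} (hR : 1 ≤ R) :
    IsCompact (X.cone '' (univ ×ˢ Ioi R))ᶜ := by
  have hcl : IsClosed (X.cone '' (univ ×ˢ Ioi R))ᶜ := by
    refine (X.cone.isOpen_image_of_subset_source (isOpen_univ.prod isOpen_Ioi) fun p hp => ?_).isClosed_compl
    rw [X.cone_source]
    exact ⟨hp.1, (zero_lt_one.trans_le hR).trans hp.2⟩
  refine (X.isCompact_domain.union (X.isCompact_image_cone (b := R) one_pos)).of_isClosed_subset hcl ?_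
  intro x hx
  by_cases h : x ∈ X.cone '' (univ ×ˢ Ioi 1)
  · obtain ⟨⟨q, r⟩, ⟨-, hr⟩, rfl⟩ := h
    refine Or.inr ⟨(q, r), ⟨mem_univ _, le_of_lt hr, ?_⟩, rfl⟩
    by_contra hn
    exact hx ⟨(q, r), ⟨mem_univ _, not_le.1 hn⟩, rfl⟩
  · exact Or.inl h

theorem sigmaCompactSpace (X : LiouvilleManifold E M E' N) [CompactSpace N] : SigmaCompactSpace M := by
  refine ⟨fun n => (X.cone '' (univ ×ˢ Ioi ((n : ℝ) + 1)))ᶜ, fun n => X.isCompact_compl_image_cone (by simp), ?_⟩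
  refine eq_univ_of_forall fun x => ?_
  -- Off the end `radius x` is a junk value, which is harmless: it is compared with r only if x lies
  -- on the end.
  obtain ⟨n, hn⟩ := exists_nat_gt (X.radius x)
  refine mem_iUnion.2 ⟨n, ?_⟩
  rintro ⟨⟨q, r⟩, ⟨-, hr⟩, rfl⟩
  have hr' : (n : ℝ) + 1 < r := hr
  have h0 : (0 : ℝ) ≤ n := n.cast_nonneg
  rw [X.radius_cone (by linarith)] at hn
  linarith

variable [FiniteDimensional ℝ E]

theorem isSmoothBilinear_symplBilin (x : M) : IsSmoothBilinearAt X.symplBilin x :=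
  (contMDiffAt_bilinear_iff x (mem_chart_source E x)).2 (X.contMDiffAt_chartBilinear_symplBilin x)

theorem chartCoord_sharp {x₀ x : M} (hx : x ∈ (chartAt E x₀).source)
    (β : TangentSpace 𝓘(ℝ, E) x →L[ℝ] ℝ) : chartCoord x₀ x (X.sharp x β) =
      (chartBilinear X.symplBilin x₀ x).inverse (β.comp (chartFrame x₀ x) : E →L[ℝ] ℝ) := by
  have hnd : ∀ v, (∀ w, chartBilinear X.symplBilin x₀ x v w = 0) → v = 0 := by
    intro v hv
    have h : chartFrame x₀ x v = 0 := by
      refine X.nondegenerate x _ fun w => ?_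
      have := hv (chartCoord x₀ x w)
      rw [chartBilinear_apply, chartFrame_chartCoord hx] at this
      exact this
    rw [← chartCoord_chartFrame hx v, h, map_zero]
  obtain ⟨e, he⟩ := exists_equiv_of_nondegenerate _ hnd
  have h : chartBilinear X.symplBilin x₀ x (chartCoord x₀ x (X.sharp x β)) =
      (β.comp (chartFrame x₀ x) : E →L[ℝ] ℝ) := by
    ext w
    rw [chartBilinear_apply, chartFrame_chartCoord hx]
    exact X.symplForm_sharp x β _
  rw [← h, ← he]
  simp

/-- In a chart, passing to the ω-dual is application of the inverse of the matrix of ω, and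
inversion is smooth at invertible operators. -/
theorem contMDiffAt_sharp {x₀ x : M} (hx : x ∈ (chartAt E x₀).source)
    {β : ∀ x : M, TangentSpace 𝓘(ℝ, E) x →L[ℝ] ℝ}
    (hβ : ContMDiffAt 𝓘(ℝ, E) 𝓘(ℝ, E →L[ℝ] ℝ) ∞
      (fun y => ((β y).comp (chartFrame x₀ y) : E →L[ℝ] ℝ)) x) :
    ContMDiffAt 𝓘(ℝ, E) 𝓘(ℝ, E) ∞ (fun y => chartCoord x₀ y (X.sharp y (β y))) x := by
  have h1 := (contMDiffAt_bilinear_iff x₀ hx).1 (X.isSmoothBilinear_symplBilin x)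
  have hnd : ∀ v, (∀ w, chartBilinear X.symplBilin x₀ x v w = 0) → v = 0 := by
    intro v hv
    have h : chartFrame x₀ x v = 0 := by
      refine X.nondegenerate x _ fun w => ?_
      have := hv (chartCoord x₀ x w)
      rw [chartBilinear_apply, chartFrame_chartCoord hx] at this
      exact this
    rw [← chartCoord_chartFrame hx v, h, map_zero]
  obtain ⟨e, he⟩ := exists_equiv_of_nondegenerate _ hnd
  have h2 : ContDiffAt ℝ ∞ (ContinuousLinearMap.inverse : (E →L[ℝ] E →L[ℝ] ℝ) → _)
      (chartBilinear X.symplBilin x₀ x) := by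
    rw [← he]
    exact contDiffAt_map_inverse e
  have h3 : ContMDiffAt 𝓘(ℝ, E) 𝓘(ℝ, (E →L[ℝ] ℝ) →L[ℝ] E) ∞
      (fun y => (chartBilinear X.symplBilin x₀ y).inverse) x := h2.contMDiffAt.comp x h1
  refine (h3.clm_apply hβ).congr_of_eventuallyEq ?_
  filter_upwards [(chartAt E x₀).open_source.mem_nhds hx] with y hy
  exact X.chartCoord_sharp hy _

theorem contMDiffAt_θ_coord {x₀ x : M} (hx : x ∈ (chartAt E x₀).source) :
    ContMDiffAt 𝓘(ℝ, E) 𝓘(ℝ, E →L[ℝ] ℝ) ∞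
      (fun y => ((X.θ y).comp (chartFrame x₀ y) : E →L[ℝ] ℝ)) x :=
  (contMDiffAt_oneForm_iff x₀ hx).1 (X.smooth_θ x)

theorem contMDiffAt_dr_coord {x₀ x : M} (hx : x ∈ (chartAt E x₀).source) (hx' : x ∈ X.cone.target) :
    ContMDiffAt 𝓘(ℝ, E) 𝓘(ℝ, E →L[ℝ] ℝ) ∞
      (fun y => ((X.dr y).comp (chartFrame x₀ y) : E →L[ℝ] ℝ)) x :=
  contMDiffAt_dfun hx (X.cone.open_target.mem_nhds hx')
    fun _ hy => (X.contMDiffAt_radius hy).contMDiffWithinAt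

theorem contMDiffAt_liouville_coord {x₀ x : M} (hx : x ∈ (chartAt E x₀).source) :
    ContMDiffAt 𝓘(ℝ, E) 𝓘(ℝ, E) ∞ (fun y => chartCoord x₀ y (X.liouville y)) x :=
  X.contMDiffAt_sharp hx (X.contMDiffAt_θ_coord hx)

theorem contMDiffAt_reeb_coord {x₀ x : M} (hx : x ∈ (chartAt E x₀).source) (hx' : x ∈ X.cone.target) :
    ContMDiffAt 𝓘(ℝ, E) 𝓘(ℝ, E) ∞ (fun y => chartCoord x₀ y (X.reeb y)) x := by
  refine X.contMDiffAt_sharp hx ?_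
  have h2 : ContDiff ℝ ∞ (fun T : E →L[ℝ] ℝ => -T) := contDiff_neg
  exact h2.contMDiff.contMDiffAt.comp x (X.contMDiffAt_dr_coord hx hx')

/-- A positive function equal to the square of the radial coordinate on the infinite cone. -/
theorem exists_radius_sq [T2Space M] [CompactSpace N] : ∃ G : M → ℝ, ContMDiff 𝓘(ℝ, E) 𝓘(ℝ, ℝ) ∞ G ∧
    (∀ x, 0 < G x) ∧ ∀ x ∈ X.infiniteCone, G x = X.radius x ^ 2 := by
  have := X.sigmaCompactSpace
  -- The admissible values at a point form a convex set, so local solutions glue: r² near the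
  -- infinite cone and 1 off it, the cone being closed.
  let t : M → Set ℝ := fun x => {y : ℝ | 0 < y ∧ (x ∈ X.infiniteCone → y = X.radius x ^ 2)}
  have hconv : ∀ x, Convex ℝ (t x) := by
    rintro x y ⟨hy, hy'⟩ z ⟨hz, hz'⟩ a b ha hb hab
    refine ⟨(convex_Ioi (0 : ℝ)) hy hz ha hb hab, fun hx => ?_⟩
    rw [hy' hx, hz' hx, smul_eq_mul, smul_eq_mul, ← add_mul, hab, one_mul]
  have hloc : ∀ x : M, ∃ U ∈ 𝓝 x, ∃ g : M → ℝ, ContMDiffOn 𝓘(ℝ, E) 𝓘(ℝ, ℝ) ∞ g U ∧ ∀ y ∈ U, g y ∈ t y := by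
    intro x
    by_cases hx : x ∈ X.infiniteCone
    · refine ⟨X.cone.target, X.cone.open_target.mem_nhds (X.infiniteCone_subset_target hx),
        fun y => X.radius y ^ 2, fun y hy => ?_, fun y hy => ⟨pow_pos (X.radius_pos hy) 2, fun _ => rfl⟩⟩
      exact ((X.contMDiffAt_radius hy).pow 2).contMDiffWithinAt
    · exact ⟨X.infiniteConeᶜ, X.isClosed_infiniteCone.isOpen_compl.mem_nhds hx, fun _ => 1,
        contMDiffOn_const, fun y hy => ⟨one_pos, fun h => absurd h hy⟩⟩
  obtain ⟨G, hG⟩ := exists_contMDiffMap_forall_mem_convex_of_local (n := ⊤) 𝓘(ℝ, E) hconv hloc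
  exact ⟨G, G.contMDiff, fun x => (hG x).1, fun x => (hG x).2⟩

/-- The metrics on the tangent space at `x` for which, on the infinite cone, the Liouville and Reeb
fields are dual to `dr` and `θ`. -/
def adaptedMetrics (x : M) :
    Set (TangentSpace 𝓘(ℝ, E) x →L[ℝ] TangentSpace 𝓘(ℝ, E) x →L[ℝ] Bundle.Trivial M ℝ x) :=
  {g | IsScalarProduct (E := E) g ∧ (x ∈ X.infiniteCone → ∀ w : E,
    (g : E →L[ℝ] E →L[ℝ] ℝ) (X.liouville x) w = X.dr x w ∧ (g : E →L[ℝ] E →L[ℝ] ℝ) (X.reeb x) w = X.θ x w)}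

theorem convex_adaptedMetrics (x : M) : Convex ℝ (X.adaptedMetrics x) := by
  rintro g ⟨hg, hg'⟩ h ⟨hh, hh'⟩ a b ha hb hab
  have happ : ∀ v w : E, ((a • g + b • h : TangentSpace 𝓘(ℝ, E) x →L[ℝ] TangentSpace 𝓘(ℝ, E) x →L[ℝ] ℝ) : E →L[ℝ] E →L[ℝ] ℝ) v w =
      a * (g : E →L[ℝ] E →L[ℝ] ℝ) v w + b * (h : E →L[ℝ] E →L[ℝ] ℝ) v w := fun v w => rfl
  refine ⟨⟨fun v w => ?_, fun v hv => ?_⟩, fun hx w => ?_⟩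
  · refine (happ v w).trans (Eq.trans ?_ (happ w v).symm)
    exact congrArg₂ (fun s t : ℝ => a * s + b * t) (hg.symm v w) (hh.symm v w)
  · refine lt_of_lt_of_eq ?_ (happ v v).symm
    exact (convex_Ioi (0 : ℝ)) (hg.pos v hv) (hh.pos v hv) ha hb hab
  · refine ⟨(happ _ _).trans ?_, (happ _ _).trans ?_⟩
    · refine (congrArg₂ (fun s t : ℝ => a * s + b * t) (hg' hx w).1 (hh' hx w).1).trans ?_
      rw [← add_mul, hab, one_mul]
    · refine (congrArg₂ (fun s t : ℝ => a * s + b * t) (hg' hx w).2 (hh' hx w).2).trans ?_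
      rw [← add_mul, hab, one_mul]

theorem isScalarProduct_ofChartBilinear {x₀ x : M} (hx : x ∈ (chartAt E x₀).source)
    {b : M → E →L[ℝ] E →L[ℝ] ℝ} (hb : IsScalarProduct (b x)) :
    IsScalarProduct (E := E) (ofChartBilinear x₀ b x) :=
  hb.conj (T := (chartCoord x₀ x : E →L[ℝ] E)) (T' := (chartFrame x₀ x : E →L[ℝ] E))
    fun v => chartFrame_chartCoord hx v

/-- Near the infinite cone the covectors dr, θ and the vectors Z, R are read in the chart at `x₀`
and a constant scalar product is adapted to them. Off the closed cone nothing is required. -/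
theorem exists_local_adaptedMetric (x₀ : M) : ∃ U ∈ 𝓝 x₀,
    ∃ g : ∀ x : M, TangentSpace 𝓘(ℝ, E) x →L[ℝ] TangentSpace 𝓘(ℝ, E) x →L[ℝ] Bundle.Trivial M ℝ x,
      (∀ x ∈ U, IsSmoothBilinearAt g x) ∧ ∀ x ∈ U, g x ∈ X.adaptedMetrics x := by
  obtain ⟨g₀, hg₀⟩ := exists_isScalarProduct E
  have hs := (chartAt E x₀).open_source.mem_nhds (mem_chart_source E x₀)
  by_cases hx : x₀ ∈ X.infiniteCone
  · let b : M → E →L[ℝ] E →L[ℝ] ℝ := fun x => adaptedForm g₀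
      (((X.dr x).comp (chartFrame x₀ x) : E →L[ℝ] ℝ), ((X.θ x).comp (chartFrame x₀ x) : E →L[ℝ] ℝ),
        chartCoord x₀ x (X.liouville x), chartCoord x₀ x (X.reeb x), (X.radius x)⁻¹)
    refine ⟨(chartAt E x₀).source ∩ X.cone.target, inter_mem hs
      (X.cone.open_target.mem_nhds (X.infiniteCone_subset_target hx)), ofChartBilinear x₀ b,
      fun x hxU => ?_, fun x hxU => ?_⟩
    · refine isSmoothBilinearAt_ofChartBilinear hxU.1 ?_
      have hr : ContMDiffAt 𝓘(ℝ, E) 𝓘(ℝ, ℝ) ∞ (fun x => (X.radius x)⁻¹) x :=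
        (contDiffAt_inv ℝ (X.radius_pos hxU.2).ne').contMDiffAt.comp x (X.contMDiffAt_radius hxU.2)
      exact (contDiff_adaptedForm g₀).contMDiff.contMDiffAt.comp x
        ((X.contMDiffAt_dr_coord hxU.1 hxU.2).prodMk_space ((X.contMDiffAt_θ_coord hxU.1).prodMk_space
          ((X.contMDiffAt_liouville_coord hxU.1).prodMk_space
            ((X.contMDiffAt_reeb_coord hxU.1 hxU.2).prodMk_space hr))))
    · have hr := X.radius_pos hxU.2
      refine ⟨isScalarProduct_ofChartBilinear hxU.1
        (isScalarProduct_adaptedForm hg₀ _ _ _ _ (inv_pos.2 hr)), fun _ w => ?_⟩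
      exact adaptedForm_dual (g := g₀) (a := (X.dr x : E →L[ℝ] ℝ)) (b := (X.θ x : E →L[ℝ] ℝ)) hr
        (T := (chartFrame x₀ x : E →L[ℝ] E)) (T' := (chartCoord x₀ x : E →L[ℝ] E))
        (fun v => chartFrame_chartCoord hxU.1 v) (X.dr_liouville hxU.2) (X.θ_liouville x)
        (X.dr_reeb x) (X.θ_reeb hxU.2) w
  · exact ⟨(chartAt E x₀).source ∩ X.infiniteConeᶜ, inter_mem hs
      (X.isClosed_infiniteCone.isOpen_compl.mem_nhds hx), ofChartBilinear x₀ fun _ => g₀,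
      fun x hxU => isSmoothBilinearAt_ofChartBilinear hxU.1 contMDiffAt_const,
      fun x hxU => ⟨isScalarProduct_ofChartBilinear hxU.1 hg₀, fun h => absurd h hxU.2⟩⟩

set_option synthInstance.maxHeartbeats 200000 in
theorem exists_adaptedMetric [T2Space M] [CompactSpace N] :
    ∃ g : ∀ x : M, TangentSpace 𝓘(ℝ, E) x →L[ℝ] TangentSpace 𝓘(ℝ, E) x →L[ℝ] Bundle.Trivial M ℝ x,
      (∀ x, IsSmoothBilinearAt g x) ∧ ∀ x, g x ∈ X.adaptedMetrics x := by
  have := X.sigmaCompactSpace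
  obtain ⟨g, hg⟩ := exists_contMDiffSection_forall_mem_convex_of_local (n := ⊤) 𝓘(ℝ, E)
    (F_fiber := E →L[ℝ] E →L[ℝ] ℝ)
    (fun x : M => TangentSpace 𝓘(ℝ, E) x →L[ℝ] TangentSpace 𝓘(ℝ, E) x →L[ℝ] Bundle.Trivial M ℝ x)
    X.adaptedMetrics X.convex_adaptedMetrics (fun x₀ => by
      obtain ⟨U, hU, g, hg, hg'⟩ := X.exists_local_adaptedMetric x₀
      exact ⟨U, hU, g, fun x hx => (hg x hx).contMDiffWithinAt, hg'⟩)
  exact ⟨g, fun x => g.contMDiff x, hg⟩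

/-- On the cone ω(Z, ·) = θ = g(R, ·) and ω(R, ·) = -dr = -g(Z, ·), so A rotates the plane of Z and
R and hence JZ = R. Skewness of J then gives dr(Jv) = g(Z, Jv) = -g(R, v) = -θ(v). -/
theorem exists_isContactTypeStructure [T2Space M] [CompactSpace N] :
    ∃ J : ∀ x : M, TangentSpace 𝓘(ℝ, E) x →L[ℝ] TangentSpace 𝓘(ℝ, E) x,
      X.IsContactTypeStructure J := by
  obtain ⟨g, hg, hg'⟩ := X.exists_adaptedMetric
  have hΩ : ∀ x, ∀ v w : E, (X.symplBilin x : E →L[ℝ] E →L[ℝ] ℝ) v w =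
      -(X.symplBilin x : E →L[ℝ] E →L[ℝ] ℝ) w v := fun x v w => X.symplForm_swap x v w
  have hnd : ∀ x, ∀ v : E, (∀ w, (X.symplBilin x : E →L[ℝ] E →L[ℝ] ℝ) v w = 0) → v = 0 :=
    fun x v h => X.nondegenerate x v h
  have hex := fun x => exists_isPolar (E := E) (hg' x).1 (hΩ x) (hnd x)
  choose A S J hpol using hex
  refine ⟨J, fun x₀ => ?_, fun x v => ?_, fun x v w => ?_, fun x v hv => ?_, fun x hx v => ?_⟩
  · have hx₀ := mem_chart_source E x₀
    refine (contMDiffAt_endomorphism_iff x₀ hx₀).2 ?_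
    have hs := (chartAt E x₀).open_source.mem_nhds hx₀
    refine contMDiffAt_of_isPolar ((contMDiffAt_bilinear_iff x₀ hx₀).1 (hg x₀))
      ((contMDiffAt_bilinear_iff x₀ hx₀).1 (X.isSmoothBilinear_symplBilin x₀))
      (A := fun x => (chartCoord x₀ x : E →L[ℝ] E).comp ((A x : E →L[ℝ] E).comp (chartFrame x₀ x : E →L[ℝ] E)))
      (S := fun x => (chartCoord x₀ x : E →L[ℝ] E).comp ((S x : E →L[ℝ] E).comp (chartFrame x₀ x : E →L[ℝ] E)))
      ?_ ?_
    · filter_upwards [hs] with x hx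
      exact (hg' x).1.conj (T := (chartFrame x₀ x : E →L[ℝ] E)) (T' := (chartCoord x₀ x : E →L[ℝ] E))
        (chartCoord_chartFrame hx)
    · filter_upwards [hs] with x hx
      exact (hpol x).conj (T := (chartFrame x₀ x : E →L[ℝ] E)) (T' := (chartCoord x₀ x : E →L[ℝ] E))
        (chartCoord_chartFrame hx) (chartFrame_chartCoord hx)
  · exact congrArg (fun B : E →L[ℝ] E => B v) ((hpol x).sq (hg' x).1 (hΩ x) (hnd x))
  · exact (hpol x).invariant (hg' x).1 (hΩ x) (hnd x) v w
  · exact (hpol x).positive (hg' x).1 (hΩ x) (hnd x) hv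
  · have hdual := (hg' x).2 hx
    have hZ : A x (X.liouville x) = X.reeb x := by
      refine IsScalarProduct.ext (E := E) (hg' x).1 fun w => ?_
      exact ((hpol x).form _ w).trans ((X.symplForm_liouville x w).trans (hdual w).2.symm)
    have hR : A x (X.reeb x) = -X.liouville x := by
      refine IsScalarProduct.ext (E := E) (hg' x).1 fun w => ?_
      refine ((hpol x).form _ w).trans ((X.symplForm_reeb x w).trans ?_)
      refine Eq.trans ?_ (congrArg (fun B : E →L[ℝ] ℝ => B w)
        (map_neg (g x : E →L[ℝ] E →L[ℝ] ℝ) (X.liouville x))).symm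
      exact congrArg Neg.neg (hdual w).1.symm
    have hJ : J x (X.liouville x) = X.reeb x :=
      (hpol x).apply_eq_of_rotation (hg' x).1 hZ hR
    have h := (hpol x).skew (hg' x).1 (hΩ x) (hnd x) (X.liouville x) v
    have h1 : (g x : E →L[ℝ] E →L[ℝ] ℝ) (J x (X.liouville x)) v = X.θ x v := by
      rw [hJ]; exact (hdual v).2
    have h2 := (hdual (J x v)).1
    change X.dr x (J x v) = -X.θ x v
    refine h2.symm.trans (eq_neg_of_add_eq_zero_left ?_)
    rw [← h1]
    exact (add_comm _ _).trans (eq_neg_iff_add_eq_zero.1 h)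

end LiouvilleManifold

/-! ### The Floer equation on the end and the differential inequality for log r. -/

namespace LiouvilleManifold

variable {E M E' N : Type*}
  [NormedAddCommGroup E] [NormedSpace ℝ E] [TopologicalSpace M] [ChartedSpace E M]
  [NormedAddCommGroup E'] [NormedSpace ℝ E'] [TopologicalSpace N] [ChartedSpace E' N]
  [IsManifold 𝓘(ℝ, E) ∞ M] [IsManifold 𝓘(ℝ, E') ∞ N]
  (X : LiouvilleManifold E M E' N)

/-- The part `N × (R, ∞)` of the cylindrical end. -/
def farCone (R : ℝ) : Set M := X.cone '' (univ ×ˢ Ioi R)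

theorem mem_farCone {R : ℝ} (hR : 0 ≤ R) {x : M} :
    x ∈ X.farCone R ↔ x ∈ X.cone.target ∧ R < X.radius x := by
  constructor
  · rintro ⟨⟨q, r⟩, ⟨-, hr⟩, rfl⟩
    have hr' : 0 < r := lt_of_le_of_lt hR hr
    exact ⟨X.cone_mem_target hr', by rw [X.radius_cone hr']; exact hr⟩
  · rintro ⟨hx, hr⟩
    exact ⟨_, ⟨mem_univ _, hr⟩, X.cone_symm_fst_radius hx⟩

theorem isOpen_farCone {R : ℝ} (hR : 0 ≤ R) : IsOpen (X.farCone R) := by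
  refine X.cone.isOpen_image_of_subset_source (isOpen_univ.prod isOpen_Ioi) fun p hp => ?_
  rw [X.cone_source]
  exact ⟨hp.1, lt_of_le_of_lt hR hp.2⟩

theorem farCone_subset_farCone {R R' : ℝ} (h : R ≤ R') : X.farCone R' ⊆ X.farCone R :=
  image_mono (prod_mono_right (Ioi_subset_Ioi h))

theorem farCone_subset_infiniteCone {R : ℝ} (hR : 1 ≤ R) : X.farCone R ⊆ X.infiniteCone :=
  image_mono (prod_mono_right (fun _ h => hR.trans (le_of_lt h)))

variable {X} [FiniteDimensional ℝ E] {c : ℝ → ℝ} {H : ℝ → M → ℝ}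
  {J : ∀ x : M, TangentSpace 𝓘(ℝ, E) x →L[ℝ] TangentSpace 𝓘(ℝ, E) x}

/-- The open set r > 1 replaces the closed cone here, since a derivative needs the formula H = c r²
on a neighbourhood. -/
theorem IsQuadraticHamiltonian.hamiltonianVectorField_eq (hH : X.IsQuadraticHamiltonian c H) (s : ℝ)
    {x : M} (hx : x ∈ X.farCone 1) :
    X.hamiltonianVectorField (H s) x = (2 * c s * X.radius x) • X.reeb x := by
  refine X.hamiltonianVectorField_mul_radius_sq ((X.mem_farCone zero_le_one).1 hx).1 ?_
  filter_upwards [(X.isOpen_farCone zero_le_one).mem_nhds hx] with y hy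
  exact hH.quadratic s y (X.farCone_subset_infiniteCone le_rfl hy)

/-- The Floer equation in the form `J ∂_s u = ∂_t u - X_H`. -/
theorem apply_deriv_eq_of_floer (hJ : X.IsContactTypeStructure J) {u : ℝ × ℝ → M} {z : ℝ × ℝ}
    (hu : (1 / 2 : ℝ) • (X.perturbedDeriv H (fun _ => dtForm) u z +
      (J (u z)).comp ((X.perturbedDeriv H (fun _ => dtForm) u z).comp stripJ)) = 0) :
    J (u z) (mfderivWithin 𝓘(ℝ, ℝ × ℝ) 𝓘(ℝ, E) u strip z ((1, 0) : ℝ × ℝ)) =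
      (mfderivWithin 𝓘(ℝ, ℝ × ℝ) 𝓘(ℝ, E) u strip z ((0, 1) : ℝ × ℝ) : TangentSpace 𝓘(ℝ, E) (u z)) -
        X.hamiltonianVectorField (H z.1) (u z) := by
  have h := (smul_eq_zero.1 hu).resolve_left (by norm_num)
  let D : ℝ × ℝ →L[ℝ] E := mfderivWithin 𝓘(ℝ, ℝ × ℝ) 𝓘(ℝ, E) u strip z
  let Y : E := X.hamiltonianVectorField (H z.1) (u z)
  let j : E →L[ℝ] E := J (u z)
  have hj : ∀ v : E, j (j v) = -v := hJ.sq (u z)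
  have h1 := congrArg (fun B : ℝ × ℝ →L[ℝ] E => B (1, 0)) h
  have h2 : D (1, 0) - (0 : ℝ) • Y + j (D (-0, 1) - (1 : ℝ) • Y) = 0 := h1
  have h3 : D (1, 0) = -j (D (0, 1) - Y) := by
    rw [zero_smul, sub_zero, one_smul, neg_zero] at h2
    exact eq_neg_of_add_eq_zero_left h2
  change j (D (1, 0)) = D (0, 1) - Y
  rw [h3, map_neg, hj, neg_neg]

/-- The components of the Floer equation along `dr` and `θ`. -/
theorem dr_deriv_of_floer (hH : X.IsQuadraticHamiltonian c H) (hJ : X.IsContactTypeStructure J)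
    {s : ℝ} {x : M} (hx : x ∈ X.farCone 1) {a b : TangentSpace 𝓘(ℝ, E) x}
    (h : J x a = b - X.hamiltonianVectorField (H s) x) :
    X.dr x a = X.θ x b - 2 * c s * X.radius x ^ 2 ∧ X.dr x b = -X.θ x a ∧
    X.symplForm x a b = X.symplForm x a (J x a) + 2 * c s * X.radius x * X.dr x a := by
  have hx' := X.farCone_subset_infiniteCone le_rfl hx
  have hxt := ((X.mem_farCone zero_le_one).1 hx).1
  rw [hH.hamiltonianVectorField_eq s hx] at h
  have hb : b = J x a + (2 * c s * X.radius x) • X.reeb x := by rw [h, sub_add_cancel]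
  refine ⟨?_, ?_, ?_⟩
  · rw [hb, map_add, map_smul, hJ.θ_apply hx', X.θ_reeb hxt, smul_eq_mul]
    ring
  · rw [hb, map_add, map_smul, hJ.dr_apply hx', X.dr_reeb, smul_zero, add_zero]
  · rw [hb, symplForm_add_right, symplForm_smul_right, X.symplForm_swap x a (X.reeb x), symplForm_reeb]
    ring

theorem strip_mem_nhds {z : ℝ × ℝ} (hz : z.2 ∈ Ioo (0 : ℝ) 1) : strip ∈ 𝓝 z :=
  prod_mem_nhds univ_mem (Icc_mem_nhds hz.1 hz.2)

theorem fderiv_radius_comp {u : ℝ × ℝ → M} {z : ℝ × ℝ} (hu : ContMDiffAt 𝓘(ℝ, ℝ × ℝ) 𝓘(ℝ, E) ∞ u z)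
    (hx : u z ∈ X.cone.target) (v : ℝ × ℝ) :
    fderiv ℝ (fun y => X.radius (u y)) z v = X.dr (u z) (mfderiv 𝓘(ℝ, ℝ × ℝ) 𝓘(ℝ, E) u z v) := by
  have h := mfderiv_comp z (X.mdifferentiableAt_radius hx) (hu.mdifferentiableAt (by simp))
  rw [mfderiv_eq_fderiv] at h
  exact congrArg (fun B : ℝ × ℝ →L[ℝ] ℝ => B v) h

/-- Here p = r ∘ u, a and b are its partial derivatives, θs and θt the values of θ on ∂_s u and ∂_t
u, and T = ∂_s θt, S = ∂_t θs. The difference of the two sides is (p |∂_s u|² - a² - b²)/p² with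
|∂_s u|² = T - S - 2 c p a. -/
theorem laplacian_bound {p a b T S θs θt c c' : ℝ} (hp : 0 < p) (ha : a = θt - 2 * c * p ^ 2)
    (hb : b = -θs) (h : a ^ 2 + b ^ 2 ≤ p * (T - S - 2 * c * p * a)) :
    -2 * c' * p ≤ (T * p - θt * a) / p ^ 2 - (2 * c' * p + 2 * c * a) + -((S * p - θs * b) / p ^ 2) +
      2 * c * p * (θt / p - 2 * c * p) := by
  have ht : θt = a + 2 * c * p ^ 2 := by linarith
  have hs : θs = -b := by linarith
  have e : (T * p - θt * a) / p ^ 2 - (2 * c' * p + 2 * c * a) + -((S * p - θs * b) / p ^ 2) +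
      2 * c * p * (θt / p - 2 * c * p) - -2 * c' * p =
      (p * (T - S - 2 * c * p * a) - (a ^ 2 + b ^ 2)) / p ^ 2 := by
    rw [ht, hs]
    field_simp
    ring
  have := div_nonneg (sub_nonneg.2 h) (sq_nonneg p)
  linarith

/-- The differential inequality satisfied by `log (r ∘ u)`. -/
theorem log_radius_subsolution (hH : X.IsQuadraticHamiltonian c H) (hJ : X.IsContactTypeStructure J)
    {u : ℝ × ℝ → M} (hu : ContMDiffOn 𝓘(ℝ, ℝ × ℝ) 𝓘(ℝ, E) ∞ u strip)
    (heq : ∀ z ∈ strip, (1 / 2 : ℝ) • (X.perturbedDeriv H (fun _ => dtForm) u z +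
      (J (u z)).comp ((X.perturbedDeriv H (fun _ => dtForm) u z).comp stripJ)) = 0)
    {z : ℝ × ℝ} (hz : z.2 ∈ Ioo (0 : ℝ) 1) (hx : u z ∈ X.farCone 1) :
    ∃ (P Q : ℝ × ℝ → ℝ) (A B : ℝ),
      (∀ᶠ y in 𝓝 z, HasFDerivAt (fun y => Real.log (X.radius (u y)))
        (P y • ContinuousLinearMap.fst ℝ ℝ ℝ + Q y • ContinuousLinearMap.snd ℝ ℝ ℝ) y) ∧
      HasDerivAt (fun s => P (s, z.2)) A z.1 ∧ HasDerivAt (fun t => Q (z.1, t)) B z.2 ∧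
      -2 * deriv c z.1 * X.radius (u z) ≤ A + B + 2 * c z.1 * X.radius (u z) * P z := by
  have hsm : ∀ᶠ y in 𝓝 z, ContMDiffAt 𝓘(ℝ, ℝ × ℝ) 𝓘(ℝ, E) ∞ u y ∧ u y ∈ X.farCone 1 ∧ y ∈ strip ∧
      mfderivWithin 𝓘(ℝ, ℝ × ℝ) 𝓘(ℝ, E) u strip y = mfderiv 𝓘(ℝ, ℝ × ℝ) 𝓘(ℝ, E) u y := by
    have hc := (hu.contMDiffAt (strip_mem_nhds hz)).continuousAt
    filter_upwards [hc.eventually ((X.isOpen_farCone zero_le_one).mem_nhds hx),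
      (isOpen_Ioo.preimage continuous_snd).mem_nhds hz] with y hy hy2
    exact ⟨hu.contMDiffAt (strip_mem_nhds hy2), hy, mem_of_mem_nhds (strip_mem_nhds hy2),
      mfderivWithin_of_mem_nhds (strip_mem_nhds hy2)⟩
  let Θ : ℝ × ℝ → ℝ × ℝ → ℝ := fun v y => X.θ (u y) (mfderiv 𝓘(ℝ, ℝ × ℝ) 𝓘(ℝ, E) u y v)
  let ρ : ℝ × ℝ → ℝ := fun y => X.radius (u y)
  -- The first-order relations are needed on a neighbourhood, because they express the gradient of
  -- log(r ∘ u) that is differentiated again.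
  have hpt : ∀ᶠ y in 𝓝 z, 0 < ρ y ∧ ContMDiffAt 𝓘(ℝ, ℝ × ℝ) 𝓘(ℝ, E) ∞ u y ∧
      DifferentiableAt ℝ ρ y ∧
      fderiv ℝ ρ y (1, 0) = Θ (0, 1) y - 2 * c y.1 * ρ y ^ 2 ∧ fderiv ℝ ρ y (0, 1) = -Θ (1, 0) y ∧
      (fderiv ℝ ρ y (1, 0)) ^ 2 + (fderiv ℝ ρ y (0, 1)) ^ 2 ≤
        ρ y * (extDerivOneForm X.θ (u y) (mfderiv 𝓘(ℝ, ℝ × ℝ) 𝓘(ℝ, E) u y ((1, 0) : ℝ × ℝ))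
          (mfderiv 𝓘(ℝ, ℝ × ℝ) 𝓘(ℝ, E) u y ((0, 1) : ℝ × ℝ)) -
          2 * c y.1 * ρ y * fderiv ℝ ρ y (1, 0)) := by
    filter_upwards [hsm] with y ⟨h1, h2, h3, h4⟩
    have hxt := ((X.mem_farCone zero_le_one).1 h2).1
    have hfl := apply_deriv_eq_of_floer hJ (heq y h3)
    rw [h4] at hfl
    obtain ⟨e1, e2, e3⟩ := dr_deriv_of_floer hH hJ h2 hfl
    have e4 := hJ.sq_add_sq_le (X.farCone_subset_infiniteCone le_rfl h2)
      (mfderiv 𝓘(ℝ, ℝ × ℝ) 𝓘(ℝ, E) u y ((1, 0) : ℝ × ℝ))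
    have f1 : fderiv ℝ ρ y (1, 0) = _ := fderiv_radius_comp h1 hxt (1, 0)
    have f2 : fderiv ℝ ρ y (0, 1) = _ := fderiv_radius_comp h1 hxt (0, 1)
    refine ⟨X.radius_pos hxt, h1,
      ((X.contMDiffAt_radius hxt).comp y h1).contDiffAt.differentiableAt (by simp),
      f1.trans e1, f2.trans e2, ?_⟩
    rw [f1, f2, e2, neg_sq]
    refine e4.trans_eq ?_
    change _ = X.radius (u y) * (X.symplForm (u y) _ _ - _)
    rw [e3]
    ring
  have hΘ : ∀ v, DifferentiableAt ℝ (Θ v) z := fun v =>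
    (oneForm_mfderiv_contDiffAt X.smooth_θ hsm.self_of_nhds.1 v).differentiableAt (by simp)
  have hω := extDerivOneForm_mfderiv X.smooth_θ hsm.self_of_nhds.1 (1, 0) (0, 1)
  obtain ⟨h0, -, hd, hs, ht, hle⟩ := hpt.self_of_nhds
  have hcd : HasDerivAt c (deriv c z.1) z.1 := (hH.smooth_c.differentiable (by simp) z.1).hasDerivAt
  have lineS : ∀ {f : ℝ × ℝ → ℝ}, DifferentiableAt ℝ f z →
      HasDerivAt (fun s => f (s, z.2)) (fderiv ℝ f z (1, 0)) z.1 := fun {f} hf =>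
    hf.hasFDerivAt.comp_hasDerivAt (f := fun s => (s, z.2)) z.1
      ((hasDerivAt_id z.1).prodMk (hasDerivAt_const z.1 z.2))
  have lineT : ∀ {f : ℝ × ℝ → ℝ}, DifferentiableAt ℝ f z →
      HasDerivAt (fun t => f (z.1, t)) (fderiv ℝ f z (0, 1)) z.2 := fun {f} hf =>
    hf.hasFDerivAt.comp_hasDerivAt (f := fun t => (z.1, t)) z.2
      ((hasDerivAt_const z.2 z.1).prodMk (hasDerivAt_id z.2))
  -- The gradient is written through θ, as the Floer equation dictates. The second derivatives then
  -- combine ∂_s θ(∂_t u) and ∂_t θ(∂_s u) into ω(∂_s u, ∂_t u).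
  refine ⟨fun y => Θ (0, 1) y / ρ y - 2 * c y.1 * ρ y, fun y => -(Θ (1, 0) y / ρ y), _, _, ?_,
    ((lineS (hΘ (0, 1))).div (lineS hd) h0.ne').sub ((hcd.const_mul 2).mul (lineS hd)),
    ((lineT (hΘ (1, 0))).div (lineT hd) h0.ne').neg, ?_⟩
  · filter_upwards [hpt] with y ⟨h0, _, hd, hs, ht, _⟩
    refine (hd.hasFDerivAt.log h0.ne').congr_fderiv ?_
    have h1 : fderiv ℝ ρ y = fderiv ℝ ρ y (1, 0) • ContinuousLinearMap.fst ℝ ℝ ℝ +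
        fderiv ℝ ρ y (0, 1) • ContinuousLinearMap.snd ℝ ℝ ℝ := by
      ext <;> simp
    rw [h1, hs, ht]
    ext <;> simp <;> field_simp
  · have hω' : extDerivOneForm X.θ (u z) (mfderiv 𝓘(ℝ, ℝ × ℝ) 𝓘(ℝ, E) u z ((1, 0) : ℝ × ℝ))
          (mfderiv 𝓘(ℝ, ℝ × ℝ) 𝓘(ℝ, E) u z ((0, 1) : ℝ × ℝ)) =
        fderiv ℝ (Θ (0, 1)) z (1, 0) - fderiv ℝ (Θ (1, 0)) z (0, 1) := hω
    rw [hω'] at hle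
    exact laplacian_bound h0 hs ht hle

end LiouvilleManifold

/-! ### The maximum principle on the strip and the choice of c. -/

section Calculus

/-- The second derivative test at a local maximum. -/
theorem second_deriv_nonpos_of_isLocalMax {F F' : ℝ → ℝ} {x A : ℝ} (hmax : IsLocalMax F x)
    (hF : ∀ᶠ y in 𝓝 x, HasDerivAt F (F' y) y) (hF' : HasDerivAt F' A x) : F' x = 0 ∧ A ≤ 0 := by
  have h0 : F' x = 0 := hmax.hasDerivAt_eq_zero hF.self_of_nhds
  refine ⟨h0, ?_⟩
  -- A positive second derivative would make x a local minimum too, so F would be locally constant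
  -- and A = 0.
  by_contra! hA
  have hd : deriv F =ᶠ[𝓝 x] F' := hF.mono fun y hy => hy.deriv
  have hd2 : deriv (deriv F) x = A := by rw [hd.deriv_eq, hF'.deriv]
  have hmin := isLocalMin_of_deriv_deriv_pos (by rw [hd2]; exact hA)
    (by rw [hd.self_of_nhds, h0]) hF.self_of_nhds.continuousAt
  have hconst : F =ᶠ[𝓝 x] fun _ => F x := by
    filter_upwards [hmax, hmin] with y h1 h2
    exact le_antisymm h1 h2
  have h1 : deriv F =ᶠ[𝓝 x] fun _ => 0 := by
    filter_upwards [hconst.eventuallyEq_nhds] with y hy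
    rw [hy.deriv_eq, deriv_const]
  rw [h1.deriv_eq, deriv_const] at hd2
  exact hA.ne hd2

theorem nonpos_of_hasDerivWithinAt_of_max_left {F : ℝ → ℝ} {d : ℝ}
    (hF : HasDerivWithinAt F d (Icc 0 1) 0) (hmax : ∀ᶠ t in 𝓝[Icc 0 1] 0, F t ≤ F 0) : d ≤ 0 := by
  have h1 : HasDerivWithinAt F d (Ioi 0) 0 := by
    refine (hF.mono_of_mem_nhdsWithin ?_)
    exact Icc_mem_nhdsGT one_pos
  have h2 := hasDerivWithinAt_iff_tendsto_slope' (self_notMem_Ioi) |>.1 h1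
  refine le_of_tendsto h2 ?_
  have h3 : ∀ᶠ t in 𝓝[>] (0 : ℝ), F t ≤ F 0 :=
    hmax.filter_mono (nhdsWithin_le_of_mem (Icc_mem_nhdsGT one_pos))
  filter_upwards [h3, self_mem_nhdsWithin] with t ht ht0
  rw [slope_def_field]
  exact div_nonpos_of_nonpos_of_nonneg (sub_nonpos.2 ht) (by simpa using (le_of_lt ht0))

theorem nonneg_of_hasDerivWithinAt_of_max_right {F : ℝ → ℝ} {d : ℝ}
    (hF : HasDerivWithinAt F d (Icc 0 1) 1) (hmax : ∀ᶠ t in 𝓝[Icc 0 1] 1, F t ≤ F 1) : 0 ≤ d := by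
  have h1 : HasDerivWithinAt F d (Iio 1) 1 := by
    refine (hF.mono_of_mem_nhdsWithin ?_)
    exact Icc_mem_nhdsLT one_pos
  have h2 := hasDerivWithinAt_iff_tendsto_slope' (self_notMem_Iio) |>.1 h1
  refine ge_of_tendsto h2 ?_
  have h3 : ∀ᶠ t in 𝓝[<] (1 : ℝ), F t ≤ F 1 :=
    hmax.filter_mono (nhdsWithin_le_of_mem (Icc_mem_nhdsLT one_pos))
  filter_upwards [h3, self_mem_nhdsWithin] with t ht ht0
  rw [slope_def_field]
  exact div_nonneg_of_nonpos (sub_nonpos.2 ht) (by simpa using (le_of_lt ht0))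

/-- The maximum principle on a rectangle for subsolutions of `Δ f + 2 c ρ ∂_s f ≥ -2 c' ρ` whose
normal derivative on the lower boundary is bounded below by `-C χ(s)`. -/
theorem le_of_subsolution {S C m ρ₀ : ℝ} {f ρ : ℝ × ℝ → ℝ} {c χ : ℝ → ℝ} {D : Set (ℝ × ℝ)}
    (hC : 0 ≤ C) (hχ : ContDiff ℝ ∞ χ) (hχ0 : ∀ s, 0 ≤ χ s) (hχ1 : ∀ s, χ s ≤ 1)
    (hc : ∀ s, 0 < c s)
    (hcχ : ∀ s, ∀ τ ∈ Icc (0 : ℝ) 1, ∀ r ≥ ρ₀, 0 ≤ 2 * r * (-deriv c s + c s * (C * deriv χ s * τ)) +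
      C * deriv (deriv χ) s * τ - 2 * C * χ s)
    (hρ₀ : 0 ≤ ρ₀)
    (hD : IsCompact D) (hDs : D ⊆ Icc (-S) S ×ˢ Icc 0 1) (hf : ContinuousOn f D)
    (hgood : ∀ z ∈ D, m < f z → ρ₀ ≤ ρ z ∧ D ∈ 𝓝[strip] z)
    (hint : ∀ z ∈ D, m < f z → z.2 ∈ Ioo (0 : ℝ) 1 → ∃ (P Q : ℝ × ℝ → ℝ) (A B : ℝ),
      (∀ᶠ y in 𝓝 z, HasFDerivAt f
        (P y • ContinuousLinearMap.fst ℝ ℝ ℝ + Q y • ContinuousLinearMap.snd ℝ ℝ ℝ) y) ∧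
      HasDerivAt (fun s => P (s, z.2)) A z.1 ∧ HasDerivAt (fun t => Q (z.1, t)) B z.2 ∧
      -2 * deriv c z.1 * ρ z ≤ A + B + 2 * c z.1 * ρ z * P z)
    (hlow : ∀ s, (s, (0 : ℝ)) ∈ D → m < f (s, 0) →
      ∃ d, -(C * χ s) ≤ d ∧ HasDerivWithinAt (fun t => f (s, t)) d (Icc 0 1) 0)
    (hup : ∀ s, (s, (1 : ℝ)) ∈ D → m < f (s, 1) →
      HasDerivWithinAt (fun t => f (s, t)) 0 (Icc 0 1) 1) :
    ∀ z ∈ D, f z ≤ m + C + 1 := by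
  intro z₀ hz₀
  -- Chosen so that the correction multiplied by δ is at most 1 on the rectangle; this is the 1 in
  -- the bound `m + C + 1`.
  set δ : ℝ := 1 / (8 * S ^ 2 + 1) with hδ
  have hδ0 : 0 < δ := by positivity
  -- The term Cχ t(1 - t) has t-derivative Cχ at t = 0 and cancels the boundary defect; δ makes all
  -- inequalities strict. The square is centred at the left end -S so that its s-derivative is
  -- nonnegative, the right sign against the drift term.
  let k : ℝ × ℝ → ℝ := fun z => C * χ z.1 * (z.2 * (1 - z.2)) + δ * (2 * (z.1 + S) ^ 2 + z.2 * (1 - z.2))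
  have hτ : ∀ t ∈ Icc (0 : ℝ) 1, t * (1 - t) ∈ Icc (0 : ℝ) 1 := fun t ht =>
    ⟨mul_nonneg ht.1 (sub_nonneg.2 ht.2), by nlinarith [ht.1, ht.2]⟩
  have hk0 : ∀ z ∈ D, 0 ≤ k z ∧ k z ≤ C + 1 := by
    intro z hz
    obtain ⟨⟨h1, h2⟩, h3⟩ := hDs hz
    obtain ⟨h4, h5⟩ := hτ _ h3
    have hS : 0 ≤ S := by linarith
    have e1 : C * χ z.1 * (z.2 * (1 - z.2)) ≤ C := by
      have := mul_le_mul (hχ1 z.1) h5 h4 zero_le_one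
      nlinarith
    have e2 : 2 * (z.1 + S) ^ 2 + z.2 * (1 - z.2) ≤ 8 * S ^ 2 + 1 := by nlinarith
    have e3 : δ * (2 * (z.1 + S) ^ 2 + z.2 * (1 - z.2)) ≤ 1 := by
      rw [hδ, one_div, inv_mul_le_iff₀ (by positivity), mul_one]
      exact e2
    have e4 := mul_nonneg (mul_nonneg hC (hχ0 z.1)) h4
    exact ⟨add_nonneg e4 (mul_nonneg hδ0.le (by positivity)), add_le_add e1 e3⟩
  have hkc : Continuous k := by
    have := hχ.continuous
    fun_prop
  obtain ⟨z, hz, hmax⟩ := hD.exists_isMaxOn ⟨z₀, hz₀⟩ (hf.add hkc.continuousOn)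
  have hmax' : ∀ y ∈ D, f y + k y ≤ f z + k z := fun y hy => hmax hy
  -- If f ≤ m at the maximum point of f + k, the bound follows from 0 ≤ k ≤ C + 1. The remaining
  -- case is contradictory. There D is a neighbourhood in the strip, so neither the vertical sides
  -- nor the part of the edge of D inside the strip matters.
  by_cases hfz : f z ≤ m
  · have h1 := hmax' z₀ hz₀
    have h2 := (hk0 z hz).2
    have h3 := (hk0 z₀ hz₀).1
    linarith
  exfalso
  push Not at hfz
  obtain ⟨hρz, hnhds⟩ := hgood z hz hfz
  obtain ⟨s, t⟩ := z
  obtain ⟨⟨hs1, hs2⟩, ht⟩ := hDs hz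
  simp only at hs1 hs2 ht
  have hlineT : ∀ᶠ t' in 𝓝[Icc 0 1] t, f (s, t') + k (s, t') ≤ f (s, t) + k (s, t) := by
    have : Tendsto (fun t' : ℝ => (s, t')) (𝓝[Icc 0 1] t) (𝓝[strip] (s, t)) := by
      refine tendsto_nhdsWithin_iff.2 ⟨?_, ?_⟩
      · exact ((Continuous.prodMk_right s).tendsto t).mono_left nhdsWithin_le_nhds
      · filter_upwards [self_mem_nhdsWithin] with t' ht'
        exact ⟨mem_univ _, ht'⟩
    filter_upwards [this.eventually hnhds] with t' ht'
    exact hmax' _ ht'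
  have hkt : ∀ t, HasDerivAt (fun t => k (s, t)) ((C * χ s + δ) * (1 - 2 * t)) t := by
    intro t
    have h1 : HasDerivAt (fun t : ℝ => t * (1 - t)) (1 * (1 - t) + t * (0 - 1)) t :=
      (hasDerivAt_id t).mul ((hasDerivAt_const t (1 : ℝ)).sub (hasDerivAt_id t))
    have h2 := (h1.const_mul (C * χ s)).add ((h1.const_add (2 * (s + S) ^ 2)).const_mul δ)
    refine h2.congr_deriv ?_
    ring
  -- At t = 0 the t-derivative of f + k is at least δ > 0, at t = 1 it is -(Cχ + δ) < 0; neither is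
  -- compatible with a maximum.
  rcases eq_or_lt_of_le ht.1 with h0 | h0
  · subst h0
    obtain ⟨d, hd, hder⟩ := hlow s hz hfz
    have := nonpos_of_hasDerivWithinAt_of_max_left (hder.add (hkt 0).hasDerivWithinAt) hlineT
    linarith
  rcases eq_or_lt_of_le ht.2 with h1 | h1
  · subst h1
    have := nonneg_of_hasDerivWithinAt_of_max_right ((hup s hz hfz).add (hkt 1).hasDerivWithinAt) hlineT
    have := mul_nonneg hC (hχ0 s)
    linarith
  obtain ⟨P, Q, A, B, hder, hA, hB, hle⟩ := hint _ hz hfz ⟨h0, h1⟩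
  have hDn : D ∈ 𝓝 (s, t) := by
    rwa [nhdsWithin_eq_nhds.2 (LiouvilleManifold.strip_mem_nhds (z := (s, t)) ⟨h0, h1⟩)] at hnhds
  have hcs : Tendsto (fun s' : ℝ => (s', t)) (𝓝 s) (𝓝 (s, t)) := (Continuous.prodMk_left t).tendsto s
  have hct : Tendsto (fun t' : ℝ => (s, t')) (𝓝 t) (𝓝 (s, t)) := (Continuous.prodMk_right s).tendsto t
  have hks : ∀ s, HasDerivAt (fun s => k (s, t)) (C * deriv χ s * (t * (1 - t)) + δ * (4 * (s + S))) s := by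
    intro s
    have h1 : HasDerivAt χ (deriv χ s) s := (hχ.differentiable (by simp) s).hasDerivAt
    have h2 : HasDerivAt (fun s : ℝ => 2 * (s + S) ^ 2 + t * (1 - t)) (2 * (2 * (s + S) ^ 1 * 1)) s :=
      (((hasDerivAt_id s).add_const S).pow 2 |>.const_mul 2).add_const _
    have h3 := ((h1.const_mul C).mul_const (t * (1 - t))).add (h2.const_mul δ)
    refine h3.congr_deriv ?_
    ring
  obtain ⟨e1, e2⟩ := second_deriv_nonpos_of_isLocalMax (F := fun s => f (s, t) + k (s, t))
    (F' := fun s => P (s, t) + (C * deriv χ s * (t * (1 - t)) + δ * (4 * (s + S))))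
    (A := A + (C * deriv (deriv χ) s * (t * (1 - t)) + δ * 4))
    ((hcs.eventually hDn).mono fun y hy => hmax' _ hy)
    (by
      filter_upwards [hcs.eventually hder] with y hy
      have := hy.comp_hasDerivAt (f := fun s => (s, t)) y ((hasDerivAt_id y).prodMk (hasDerivAt_const y t))
      exact (this.add (hks y)).congr_deriv (by simp))
    (by
      have h1 : HasDerivAt (deriv χ) (deriv (deriv χ) s) s :=
        ((contDiff_infty_iff_deriv.1 hχ).2.differentiable (by simp) s).hasDerivAt
      have h2 : HasDerivAt (fun s : ℝ => 4 * (s + S)) (4 * 1) s :=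
        ((hasDerivAt_id s).add_const S).const_mul 4
      have := hA.add (((h1.const_mul C).mul_const (t * (1 - t))).add (h2.const_mul δ))
      exact this.congr_deriv (by simp))
  obtain ⟨-, e3⟩ := second_deriv_nonpos_of_isLocalMax (F := fun t => f (s, t) + k (s, t))
    (F' := fun t => Q (s, t) + (C * χ s + δ) * (1 - 2 * t))
    (A := B + (C * χ s + δ) * (-2))
    ((hct.eventually hDn).mono fun y hy => hmax' _ hy)
    (by
      filter_upwards [hct.eventually hder] with y hy
      have := hy.comp_hasDerivAt (f := fun t => (s, t)) y ((hasDerivAt_const y s).prodMk (hasDerivAt_id y))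
      exact (this.add (hkt y)).congr_deriv (by simp))
    (by
      have h2 : HasDerivAt (fun t : ℝ => 1 - 2 * t) (-(2 * 1)) t :=
        ((hasDerivAt_id t).const_mul 2).const_sub 1
      have := hB.add (h2.const_mul (C * χ s + δ))
      exact this.congr_deriv (by simp))
  have e4 := hcχ s _ (hτ t ht) _ hρz
  simp only at hle e1
  -- At an interior maximum the gradient of f is minus that of k. Inserting this in the differential
  -- inequality and using `hcχ` with τ = t(1 - t) leaves the contradiction 0 ≤ -2δ, since the
  -- correction has Laplacian 4δ - 2δ.
  have hP : P (s, t) = -(C * deriv χ s * (t * (1 - t)) + δ * (4 * (s + S))) := by linarith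
  rw [hP] at hle
  have e5 : 0 ≤ 2 * c s * ρ (s, t) * (δ * (4 * (s + S))) := by
    have := hc s
    have : 0 ≤ s + S := by linarith
    have : 0 ≤ ρ (s, t) := hρ₀.trans hρz
    positivity
  nlinarith

/-- The functions that control the growth of the Hamiltonian. -/
theorem exists_growth_profile (A C : ℝ) (hC : 0 ≤ C) : ∃ (c χ : ℝ → ℝ) (ρ₀ : ℝ),
    ContDiff ℝ ∞ c ∧ (∀ s, 0 < c s) ∧ (∀ s ≤ -1, c s = c (-1)) ∧ (∀ s ≥ 2, c s = c 2) ∧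
    (∀ s ∈ Icc (0 : ℝ) 1, deriv c s ≤ -A) ∧
    ContDiff ℝ ∞ χ ∧ (∀ s, 0 ≤ χ s) ∧ (∀ s, χ s ≤ 1) ∧ (∀ s ∈ Icc (0 : ℝ) 1, χ s = 1) ∧ 0 ≤ ρ₀ ∧
    ∀ s, ∀ τ ∈ Icc (0 : ℝ) 1, ∀ r ≥ ρ₀, 0 ≤ 2 * r * (-deriv c s + c s * (C * deriv χ s * τ)) +
      C * deriv (deriv χ) s * τ - 2 * C * χ s := by
  -- χ is 1 on [0, 1] and vanishes outside [-1/2, 3/2]; β is 1 on all of [-1/2, 3/2] and vanishes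
  -- outside [-1, 2].
  let χ : ContDiffBump (1 / 2 : ℝ) := ⟨1 / 2, 1, by norm_num, by norm_num⟩
  let β : ContDiffBump (1 / 2 : ℝ) := ⟨1, 3 / 2, by norm_num, by norm_num⟩
  have hχ : ContDiff ℝ ∞ χ := χ.contDiff
  have hβ : ContDiff ℝ ∞ β := β.contDiff
  have hβ1 : ∀ s ∈ Icc (-1 / 2 : ℝ) (3 / 2), β s = 1 := fun s hs => β.one_of_mem_closedBall (by
    rw [Metric.mem_closedBall, Real.dist_eq, abs_le]
    constructor <;> simp only [β] <;> linarith [hs.1, hs.2])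
  have hβ0 : ∀ s, s ≤ -1 ∨ 2 ≤ s → β s = 0 := fun s hs => β.zero_of_le_dist (by
    rw [Real.dist_eq, le_abs]
    simp only [β]
    rcases hs with hs | hs
    · right; linarith
    · left; linarith)
  have hχ0 : ∀ s, s ∉ Icc (-1 / 2 : ℝ) (3 / 2) → χ =ᶠ[𝓝 s] fun _ => 0 := by
    intro s hs
    filter_upwards [isClosed_Icc.isOpen_compl.mem_nhds hs] with y hy
    refine χ.zero_of_le_dist ?_
    rw [Real.dist_eq, le_abs]
    simp only [χ]
    by_contra! hn
    exact hy ⟨by linarith, by linarith⟩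
  have hd1 : ContDiff ℝ ∞ (deriv χ) := (contDiff_infty_iff_deriv.1 hχ).2
  have hd2 : ContDiff ℝ ∞ (deriv (deriv χ)) := (contDiff_infty_iff_deriv.1 hd1).2
  obtain ⟨K₁, hK₁⟩ := (isCompact_Icc (a := (-1 / 2 : ℝ)) (b := 3 / 2)).exists_bound_of_continuousOn
    hd1.continuous.continuousOn
  obtain ⟨K₂, hK₂⟩ := (isCompact_Icc (a := (-1 / 2 : ℝ)) (b := 3 / 2)).exists_bound_of_continuousOn
    hd2.continuous.continuousOn
  have hK₁0 : 0 ≤ K₁ := (norm_nonneg _).trans (hK₁ 0 (by norm_num))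
  have hK₂0 : 0 ≤ K₂ := (norm_nonneg _).trans (hK₂ 0 (by norm_num))
  -- With c' = -Λβc, on the support of χ one gets -c' + c C χ' τ ≥ c(Λ - C K₁) = c.
  let Λ : ℝ := C * K₁ + 1
  have hΛ : 0 < Λ := by positivity
  let m : ℝ → ℝ := fun s => ∫ x in (0 : ℝ)..s, β x
  have hm : ∀ s, HasDerivAt m (β s) s := fun s =>
    intervalIntegral.integral_hasDerivAt_right (hβ.continuous.intervalIntegrable _ _)
      (hβ.continuous.stronglyMeasurableAtFilter _ _) hβ.continuous.continuousAt
  have hmd : deriv m = β := funext fun s => (hm s).deriv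
  have hmsm : ContDiff ℝ ∞ m := contDiff_infty_iff_deriv.2
    ⟨fun s => (hm s).differentiableAt, by rw [hmd]; exact hβ⟩
  let e : ℝ → ℝ := fun s => Real.exp (-Λ * m s)
  have hesm : ContDiff ℝ ∞ e := (contDiff_const.mul hmsm).exp
  have he : ∀ s, HasDerivAt e (e s * (-Λ * β s)) s := fun s => ((hm s).const_mul (-Λ)).exp
  obtain ⟨s₁, -, hs₁⟩ := (isCompact_Icc (a := (-1 / 2 : ℝ)) (b := 3 / 2)).exists_isMinOn
    ⟨0, by norm_num⟩ hesm.continuous.continuousOn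
  have hs₁' : ∀ s ∈ Icc (-1 / 2 : ℝ) (3 / 2), e s₁ ≤ e s := fun s hs => hs₁ hs
  have he₁ : 0 < e s₁ := Real.exp_pos _
  -- Rescaling c preserves c' = -Λβc, so this factor can enforce c' ≤ -A on [0, 1] independently of
  -- Λ.
  let b : ℝ := |A| / (Λ * e s₁) + 1
  have hb : 0 < b := by positivity
  have hcd : ∀ s, deriv (fun s => b * e s) s = b * (e s * (-Λ * β s)) := fun s =>
    ((he s).const_mul b).deriv
  have hconst : ∀ T : Set ℝ, Convex ℝ T → (∀ s ∈ T, β s = 0) → ∀ s ∈ T, ∀ s' ∈ T, m s = m s' := by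
    intro T hT hβT s hs s' hs'
    have := hT.norm_image_sub_le_of_norm_hasDerivWithin_le (C := 0)
      (fun s _ => (hm s).hasDerivWithinAt) (fun s hs => by rw [hβT s hs, norm_zero]) hs' hs
    rw [zero_mul] at this
    exact sub_eq_zero.1 (norm_le_zero_iff.1 this)
  -- The threshold ρ₀ makes 2 r c ≥ C K₂ + 2C on [-1/2, 3/2], enough to dominate the terms with χ''
  -- and χ.
  refine ⟨fun s => b * e s, χ, (C * K₂ + 2 * C) / (2 * (b * e s₁)), contDiff_const.mul hesm,
    fun s => mul_pos hb (Real.exp_pos _), ?_, ?_, ?_, hχ, fun s => χ.nonneg, fun s => χ.le_one,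
    fun s hs => χ.one_of_mem_closedBall ?_, by positivity, ?_⟩
  · intro s hs
    have := hconst (Iic (-1)) (convex_Iic _) (fun s hs => hβ0 s (Or.inl hs)) s hs (-1) self_mem_Iic
    simp only [e, this]
  · intro s hs
    have := hconst (Ici 2) (convex_Ici _) (fun s hs => hβ0 s (Or.inr hs)) s hs 2 self_mem_Ici
    simp only [e, this]
  · intro s hs
    rw [hcd, hβ1 s ⟨by linarith [hs.1], by linarith [hs.2]⟩]
    have h1 := hs₁' s ⟨by linarith [hs.1], by linarith [hs.2]⟩
    have h2 : |A| ≤ b * (Λ * e s₁) := by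
      have : |A| / (Λ * e s₁) * (Λ * e s₁) = |A| := by field_simp
      have h3 : 0 < Λ * e s₁ := by positivity
      simp only [b]
      rw [add_mul, this]
      linarith
    have h3 : b * (Λ * e s₁) ≤ b * (Λ * e s) := by gcongr
    have := le_abs_self A
    nlinarith
  · rw [Metric.mem_closedBall, Real.dist_eq, abs_le]
    constructor <;> simp only [χ] <;> linarith [hs.1, hs.2]
  · intro s τ hτ r hr
    have hr0 : 0 ≤ r := le_trans (by positivity) hr
    rw [hcd]
    have hes : 0 < e s := Real.exp_pos _
    by_cases hs : s ∈ Icc (-1 / 2 : ℝ) (3 / 2)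
    · have h1 := hs₁' s hs
      have h2 := abs_le.1 (hK₁ s hs)
      have h3 := abs_le.1 (hK₂ s hs)
      rw [hβ1 s hs]
      have h4 : -(C * K₁) ≤ C * deriv χ s * τ := by
        have : -K₁ ≤ deriv χ s * τ := by nlinarith [hτ.1, hτ.2]
        nlinarith
      have h5 : -(C * K₂) ≤ C * deriv (deriv χ) s * τ := by
        have : -K₂ ≤ deriv (deriv χ) s * τ := by nlinarith [hτ.1, hτ.2]
        nlinarith
      have h6 : χ s ≤ 1 := χ.le_one
      have h7 : C * K₂ + 2 * C ≤ 2 * r * (b * e s₁) := by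
        have h8 := (div_le_iff₀ (by positivity)).1 hr
        linarith
      have h9 : 2 * r * (b * e s₁) ≤ 2 * r * (b * e s) := by gcongr
      have h10 : 2 * r * (b * e s) * 1 ≤ 2 * r * (b * e s) * (Λ + C * deriv χ s * τ) := by
        refine mul_le_mul_of_nonneg_left ?_ (by positivity)
        simp only [Λ]
        linarith
      have h11 : C * χ s ≤ C * 1 := by gcongr
      linarith
    · have h0 := hχ0 s hs
      have h1 : deriv χ =ᶠ[𝓝 s] fun _ => 0 := by
        filter_upwards [h0.eventuallyEq_nhds] with y hy
        rw [hy.deriv_eq, deriv_const]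
      have h2 : deriv (deriv χ) s = 0 := by rw [h1.deriv_eq, deriv_const]
      rw [h0.self_of_nhds, h1.self_of_nhds, h2]
      have : 0 ≤ β s := β.nonneg
      have : 0 ≤ 2 * r * (b * (e s * (Λ * β s))) := by positivity
      linarith

end Calculus

/-! ### Continuity of a one-form evaluated on derivatives. -/

section Continuity

variable {E : Type*} [NormedAddCommGroup E] [NormedSpace ℝ E]
  {M : Type*} [TopologicalSpace M] [ChartedSpace E M] [IsManifold 𝓘(ℝ, E) ∞ M]

theorem IsSmoothOneForm.continuous_pairing {θ : ∀ x : M, TangentSpace 𝓘(ℝ, E) x →L[ℝ] ℝ}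
    (hθ : IsSmoothOneForm θ) : Continuous (fun p : TangentBundle 𝓘(ℝ, E) M => θ p.1 p.2) := by
  rw [continuous_iff_continuousAt]
  rintro p
  have hp := mem_chart_source E p.1
  have h1 := ((contMDiffAt_oneForm_iff p.1 hp).1 (hθ p.1)).continuousAt
  have hpr : ContinuousAt (TotalSpace.proj : TangentBundle 𝓘(ℝ, E) M → M) p :=
    (FiberBundle.continuous_proj E (TangentSpace 𝓘(ℝ, E) : M → Type _)).continuousAt
  have h2 : ContinuousAt (fun q : TangentBundle 𝓘(ℝ, E) M =>
      (trivializationAt E (TangentSpace 𝓘(ℝ, E)) p.1 q).2) p :=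
    continuous_snd.continuousAt.comp ((trivializationAt E (TangentSpace 𝓘(ℝ, E)) p.1).continuousAt
      (by simp))
  refine (ContinuousAt.clm_apply (h1.comp hpr) h2).congr ?_
  filter_upwards [hpr.eventually ((chartAt E p.1).open_source.mem_nhds hp)] with q hq
  have h3 : (trivializationAt E (TangentSpace 𝓘(ℝ, E)) p.1 q).2 = chartCoord p.1 q.1 q.2 := by
    unfold chartCoord
    rw [Trivialization.continuousLinearMapAt_apply, Trivialization.coe_linearMapAt_of_mem]
    exact hq
  rw [h3]
  exact congrArg (θ q.1) (chartFrame_chartCoord hq q.2)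

/-- Stated with derivatives within a set so that continuity reaches the boundary, in particular the
endpoints of the time interval of the flow. -/
theorem IsSmoothOneForm.continuousOn_mfderivWithin {V : Type*} [NormedAddCommGroup V]
    [NormedSpace ℝ V] {θ : ∀ x : M, TangentSpace 𝓘(ℝ, E) x →L[ℝ] ℝ} (hθ : IsSmoothOneForm θ)
    {F : V → M} {s : Set V} (hF : ContMDiffOn 𝓘(ℝ, V) 𝓘(ℝ, E) ∞ F s) (hs : UniqueDiffOn ℝ s) (v : V) :
    ContinuousOn (fun z => θ (F z) (mfderivWithin 𝓘(ℝ, V) 𝓘(ℝ, E) F s z v)) s := by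
  have h1 := hF.continuousOn_tangentMapWithin (by simp) hs.uniqueMDiffOn
  have h2 : Continuous (fun z : V => (⟨z, v⟩ : TangentBundle 𝓘(ℝ, V) V)) :=
    (tangentBundleModelSpaceHomeomorph 𝓘(ℝ, V)).symm.continuous.comp (Continuous.prodMk_left v)
  exact hθ.continuous_pairing.comp_continuousOn (h1.comp h2.continuousOn fun z hz => hz)

end Continuity

/-! ### Uniform bounds for Hamiltonians linear at infinity. -/

namespace LiouvilleManifold

variable {E M E' N : Type*}
  [NormedAddCommGroup E] [NormedSpace ℝ E] [TopologicalSpace M] [ChartedSpace E M]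
  [NormedAddCommGroup E'] [NormedSpace ℝ E'] [TopologicalSpace N] [ChartedSpace E' N]
  [IsManifold 𝓘(ℝ, E) ∞ M] [IsManifold 𝓘(ℝ, E') ∞ N] [FiniteDimensional ℝ E]
  {X : LiouvilleManifold E M E' N} {W : ℝ → M → ℝ}

theorem contMDiff_slice_of_contMDiffOn {F : Type*} {Y : Type*} [NormedAddCommGroup F] [NormedSpace ℝ F]
    [TopologicalSpace Y] [ChartedSpace F Y] {g : ℝ → M → Y}
    (hg : ContMDiffOn (𝓘(ℝ, ℝ).prod 𝓘(ℝ, E)) 𝓘(ℝ, F) ∞ (fun p : ℝ × M => g p.1 p.2) (Icc 0 1 ×ˢ univ))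
    {s : ℝ} (hs : s ∈ Icc (0 : ℝ) 1) : ContMDiff 𝓘(ℝ, E) 𝓘(ℝ, F) ∞ (g s) := by
  have h : ContMDiff 𝓘(ℝ, E) (𝓘(ℝ, ℝ).prod 𝓘(ℝ, E)) ∞ (fun x : M => (s, x)) :=
    contMDiff_const.prodMk contMDiff_id
  exact contMDiffOn_univ.1 (hg.comp h.contMDiffOn fun x _ => ⟨hs, mem_univ x⟩)

/-- The map `(s, b) ↦ (s, e⁻¹ b)` for the chart `e` at `x₀`. -/
theorem contMDiffOn_prod_extChartAt_symm (x₀ : M) (T : Set ℝ) :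
    ContMDiffOn 𝓘(ℝ, ℝ × E) (𝓘(ℝ, ℝ).prod 𝓘(ℝ, E)) ∞
      (fun p : ℝ × E => (p.1, (extChartAt 𝓘(ℝ, E) x₀).symm p.2))
      (T ×ˢ (extChartAt 𝓘(ℝ, E) x₀).target) := by
  have h1 : ContMDiff 𝓘(ℝ, ℝ × E) 𝓘(ℝ, ℝ) ∞ (Prod.fst : ℝ × E → ℝ) := contDiff_fst.contMDiff
  have h2 : ContMDiff 𝓘(ℝ, ℝ × E) 𝓘(ℝ, E) ∞ (Prod.snd : ℝ × E → E) := contDiff_snd.contMDiff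
  exact h1.contMDiffOn.prodMk ((contMDiffOn_extChartAt_symm x₀).comp h2.contMDiffOn fun p hp => hp.2)

theorem uniqueDiffOn_Icc_prod_target (x₀ : M) :
    UniqueDiffOn ℝ (Icc (0 : ℝ) 1 ×ˢ (extChartAt 𝓘(ℝ, E) x₀).target) :=
  (uniqueDiffOn_Icc one_pos).prod (isOpen_extChartAt_target x₀).uniqueDiffOn

/-- Joint continuity in (s, x) is needed for a bound uniform in s on a compact slice. In a chart the
spatial differential is the joint derivative, taken within the closed time interval, applied to
vectors with zero time component. -/
theorem IsLinearHamiltonian.continuousOn_dfun_reeb (hW : X.IsLinearHamiltonian W) :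
    ContinuousOn (fun p : ℝ × M => dfun (W p.1) p.2 (X.reeb p.2)) (Icc 0 1 ×ˢ X.cone.target) := by
  rintro ⟨s₀, x₀⟩ ⟨hs₀, hx₀⟩
  have hc := mem_chart_source E x₀
  let G : ℝ × E → ℝ := fun p => W p.1 ((extChartAt 𝓘(ℝ, E) x₀).symm p.2)
  set T := Icc (0 : ℝ) 1 ×ˢ (extChartAt 𝓘(ℝ, E) x₀).target
  have hG : ContDiffOn ℝ ∞ G T := by
    rw [← contMDiffOn_iff_contDiffOn]
    exact hW.1.comp (contMDiffOn_prod_extChartAt_symm x₀ (Icc 0 1)) fun p hp => ⟨hp.1, mem_univ _⟩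
  have hG' := hG.continuousOn_fderivWithin (uniqueDiffOn_Icc_prod_target x₀) (by simp)
  have hmaps : MapsTo (fun p : ℝ × M => (p.1, extChartAt 𝓘(ℝ, E) x₀ p.2))
      (Icc (0 : ℝ) 1 ×ˢ (chartAt E x₀).source) T := fun p hp =>
    ⟨hp.1, (extChartAt 𝓘(ℝ, E) x₀).map_source (by simpa using hp.2)⟩
  have hcont : ContinuousOn (fun p : ℝ × M => (p.1, extChartAt 𝓘(ℝ, E) x₀ p.2))
      (Icc (0 : ℝ) 1 ×ˢ (chartAt E x₀).source) := by
    refine continuousOn_fst.prodMk ((continuousOn_extChartAt x₀).comp continuousOn_snd fun p hp => ?_)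
    simpa using hp.2
  have h1 : ContinuousWithinAt (fun p : ℝ × M => fderivWithin ℝ G T (p.1, extChartAt 𝓘(ℝ, E) x₀ p.2))
      (Icc (0 : ℝ) 1 ×ˢ (chartAt E x₀).source) (s₀, x₀) := hG'.comp hcont hmaps _ ⟨hs₀, hc⟩
  have h2 : ContinuousWithinAt (fun p : ℝ × M => ((0 : ℝ), chartCoord x₀ p.2 (X.reeb p.2)))
      (Icc (0 : ℝ) 1 ×ˢ (chartAt E x₀).source) (s₀, x₀) := by
    have h3 : ContinuousAt (fun p : ℝ × M => chartCoord x₀ p.2 (X.reeb p.2)) (s₀, x₀) :=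
      ContinuousAt.comp (f := Prod.snd) (x := (s₀, x₀)) (X.contMDiffAt_reeb_coord hc hx₀).continuousAt
        continuousAt_snd
    exact (continuousAt_const.prodMk h3).continuousWithinAt
  have h4 := h1.clm_apply h2
  have h5 : Icc (0 : ℝ) 1 ×ˢ (chartAt E x₀).source ∈ 𝓝[Icc 0 1 ×ˢ X.cone.target] (s₀, x₀) := by
    refine mem_nhdsWithin.2 ⟨univ ×ˢ (chartAt E x₀).source, isOpen_univ.prod (chartAt E x₀).open_source,
      ⟨mem_univ _, hc⟩, ?_⟩
    rintro ⟨s, x⟩ ⟨⟨-, hx⟩, ⟨hs, -⟩⟩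
    exact ⟨hs, hx⟩
  have hpt : ∀ p ∈ Icc (0 : ℝ) 1 ×ˢ (chartAt E x₀).source, dfun (W p.1) p.2 (X.reeb p.2) =
      fderivWithin ℝ G T (p.1, extChartAt 𝓘(ℝ, E) x₀ p.2) (0, chartCoord x₀ p.2 (X.reeb p.2)) := by
    rintro ⟨s, x⟩ ⟨hs, hx⟩
    have hb : extChartAt 𝓘(ℝ, E) x₀ x ∈ (extChartAt 𝓘(ℝ, E) x₀).target :=
      (extChartAt 𝓘(ℝ, E) x₀).map_source (by simpa using hx)
    have e1 := congrArg (fun B : E →L[ℝ] ℝ => B (chartCoord x₀ x (X.reeb x)))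
      (dfun_comp_chartFrame hx
        ((contMDiff_slice_of_contMDiffOn hW.1 hs).contMDiffAt.mdifferentiableAt (by simp) (x := x)))
    have e2 : dfun (W s) x (chartFrame x₀ x (chartCoord x₀ x (X.reeb x))) = _ := e1
    rw [chartFrame_chartCoord hx] at e2
    have e3 := (hG.differentiableOn (by simp) (s, extChartAt 𝓘(ℝ, E) x₀ x) ⟨hs, hb⟩).hasFDerivWithinAt
    have e4 : HasFDerivAt (fun b : E => (s, b)) (ContinuousLinearMap.inr ℝ ℝ E)
      (extChartAt 𝓘(ℝ, E) x₀ x) := hasFDerivAt_prodMk_right s _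
    have e5 := (e3.comp _ e4.hasFDerivWithinAt (fun b hb => ⟨hs, hb⟩ :
      MapsTo (fun b : E => (s, b)) (extChartAt 𝓘(ℝ, E) x₀).target T)).hasFDerivAt
      ((isOpen_extChartAt_target x₀).mem_nhds hb)
    rw [e2]
    exact congrArg (fun B : E →L[ℝ] ℝ => B (chartCoord x₀ x (X.reeb x))) e5.fderiv
  exact (h4.congr hpt (hpt _ ⟨hs₀, hc⟩)).mono_of_mem_nhdsWithin h5

/-- Bounds for a Hamiltonian that is linear at infinity. -/
theorem IsLinearHamiltonian.exists_bound [CompactSpace N] (hW : X.IsLinearHamiltonian W) :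
    ∃ R ≥ 1, ∃ C ≥ 0, ∀ s ∈ Icc (0 : ℝ) 1, ∀ x ∈ X.farCone R,
      |W s x| ≤ C * X.radius x ∧ |dfun (W s) x (X.reeb x)| ≤ C * X.radius x ∧
      dfun (W s) x (X.liouville x) = W s x := by
  obtain ⟨hsm, R, hR, W₀, hlin⟩ := hW
  have hW' : X.IsLinearHamiltonian W := ⟨hsm, R, hR, W₀, hlin⟩
  -- Bounds on the single compact slice r = r₁ suffice: W and its Reeb derivative both scale
  -- linearly with r beyond R.
  set r₁ := R + 1
  have hr₁ : 0 < r₁ := by positivity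
  have hRr₁ : R < r₁ := lt_add_one R
  have hK : IsCompact (Icc (0 : ℝ) 1 ×ˢ (X.cone '' (univ ×ˢ Icc r₁ r₁))) :=
    isCompact_Icc.prod (X.isCompact_image_cone hr₁)
  have hsub : Icc (0 : ℝ) 1 ×ˢ (X.cone '' (univ ×ˢ Icc r₁ r₁)) ⊆ Icc (0 : ℝ) 1 ×ˢ X.cone.target := by
    rintro ⟨s, _⟩ ⟨hs, ⟨⟨q, r⟩, ⟨-, hr⟩, rfl⟩⟩
    exact ⟨hs, X.cone_mem_target (hr₁.trans_le hr.1)⟩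
  obtain ⟨K₁, hK₁⟩ := hK.exists_bound_of_continuousOn (hsm.continuousOn.mono fun p hp => ⟨hp.1, mem_univ _⟩)
  obtain ⟨K₂, hK₂⟩ := hK.exists_bound_of_continuousOn (hW'.continuousOn_dfun_reeb.mono hsub)
  refine ⟨max R 1, le_max_right _ _, max 0 (max (K₁ / r₁) (K₂ / r₁)), le_max_left _ _, fun s hs x hx => ?_⟩
  obtain ⟨⟨q, r⟩, ⟨-, hr⟩, rfl⟩ := hx
  have hRr : R < r := (le_max_left R 1).trans_lt hr
  have hr0 : 0 < r := hR.trans hRr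
  have hd := fun x => (contMDiff_slice_of_contMDiffOn hsm hs).contMDiffAt.mdifferentiableAt (by simp) (x := x)
  have hmem : (s, X.cone (q, r₁)) ∈ Icc (0 : ℝ) 1 ×ˢ (X.cone '' (univ ×ˢ Icc r₁ r₁)) :=
    ⟨hs, _, ⟨mem_univ _, left_mem_Icc.2 le_rfl⟩, rfl⟩
  rw [X.radius_cone hr0]
  refine ⟨?_, ?_, X.mfderiv_liouville_of_linear hR (hlin s hs) hRr (hd _)⟩
  · have h1 : |W s (X.cone (q, r₁))| ≤ K₁ := hK₁ _ hmem
    rw [hlin s hs q r₁ hRr₁, abs_mul, abs_of_pos hr₁] at h1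
    rw [hlin s hs q r hRr, abs_mul, abs_of_pos hr0, mul_comm]
    refine mul_le_mul_of_nonneg_right ?_ hr0.le
    refine le_trans ?_ ((le_max_left _ _).trans (le_max_right _ _))
    rw [le_div_iff₀ hr₁, mul_comm]
    exact h1
  · have h1 : |dfun (W s) (X.cone (q, r₁)) (X.reeb (X.cone (q, r₁)))| ≤ K₂ := hK₂ _ hmem
    have h2 := X.mfderiv_reeb_of_linear hR (hlin s hs) (q := q) hRr hRr₁ hd
    have h3 : dfun (W s) (X.cone (q, r)) (X.reeb (X.cone (q, r))) =
        dfun (W s) (X.cone (q, r₁)) (X.reeb (X.cone (q, r₁))) / r₁ * r := by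
      field_simp
      linarith
    rw [h3, abs_mul, abs_of_pos hr0, abs_div, abs_of_pos hr₁]
    refine mul_le_mul_of_nonneg_right ?_ hr0.le
    refine le_trans ?_ ((le_max_right _ _).trans (le_max_right _ _))
    exact div_le_div_of_nonneg_right h1 hr₁.le

theorem isClosed_image_cone_Ici {R : ℝ} (hR : 1 ≤ R) : IsClosed (X.cone '' (univ ×ˢ Ici R)) := by
  have h : X.cone '' (univ ×ˢ Ici R) = X.infiniteCone ∩ (X.cone '' (univ ×ˢ Ioo 0 R))ᶜ := by
    ext x
    constructor
    · rintro ⟨⟨q, r⟩, ⟨-, hr⟩, rfl⟩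
      have hr' : R ≤ r := hr
      refine ⟨⟨_, ⟨mem_univ _, hR.trans hr'⟩, rfl⟩, ?_⟩
      rintro ⟨⟨q', r'⟩, ⟨-, h1, h2⟩, h3⟩
      have := congrArg X.radius h3
      have h1' : 0 < r' := h1
      have h2' : r' < R := h2
      rw [X.radius_cone h1', X.radius_cone (by linarith)] at this
      linarith
    · rintro ⟨⟨⟨q, r⟩, ⟨-, hr⟩, rfl⟩, h⟩
      refine ⟨_, ⟨mem_univ _, ?_⟩, rfl⟩
      by_contra hn
      exact h ⟨_, ⟨mem_univ _, lt_of_lt_of_le one_pos hr, not_le.1 hn⟩, rfl⟩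
  rw [h]
  refine X.isClosed_infiniteCone.inter (X.cone.isOpen_image_of_subset_source
    (isOpen_univ.prod isOpen_Ioo) fun p hp => ?_).isClosed_compl
  rw [X.cone_source]
  exact ⟨hp.1, hp.2.1⟩

end LiouvilleManifold

/-! ### Trajectories of the flow on the end. -/

namespace LiouvilleManifold

variable {E M E' N : Type*}
  [NormedAddCommGroup E] [NormedSpace ℝ E] [TopologicalSpace M] [ChartedSpace E M]
  [NormedAddCommGroup E'] [NormedSpace ℝ E'] [TopologicalSpace N] [ChartedSpace E' N]
  [IsManifold 𝓘(ℝ, E) ∞ M] [IsManifold 𝓘(ℝ, E') ∞ N] [FiniteDimensional ℝ E]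
  {X : LiouvilleManifold E M E' N} {W : ℝ → M → ℝ} {φ : ℝ → M → M}

/-- Bounds on `W` and its derivatives beyond `R`. -/
def IsBoundedBeyond (X : LiouvilleManifold E M E' N) (W : ℝ → M → ℝ) (R C : ℝ) : Prop :=
  1 ≤ R ∧ 0 ≤ C ∧ ∀ s ∈ Icc (0 : ℝ) 1, ∀ x ∈ X.farCone R,
    |W s x| ≤ C * X.radius x ∧ |dfun (W s) x (X.reeb x)| ≤ C * X.radius x ∧
    dfun (W s) x (X.liouville x) = W s x

/-- dr(X_W) = -dW(R), which is bounded by C r far out; hence log r changes at rate at most C along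
the flow. -/
theorem IsHamiltonianFlow.hasDerivWithinAt_radius (hφ : X.IsHamiltonianFlow W φ) {s : ℝ}
    (hs : s ∈ Icc (0 : ℝ) 1) {x : M} (hx : φ s x ∈ X.cone.target) :
    HasDerivWithinAt (fun s => X.radius (φ s x)) (-dfun (W s) (φ s x) (X.reeb (φ s x))) (Icc 0 1) s := by
  have h1 := (X.mdifferentiableAt_radius hx).hasMFDerivAt.comp_hasMFDerivWithinAt s (hφ.2.2 s hs x)
  have h2 : HasFDerivWithinAt (fun s => X.radius (φ s x)) ((X.dr (φ s x) : E →L[ℝ] ℝ).comp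
      (velocity (X.hamiltonianVectorField (W s) (φ s x)) : ℝ →L[ℝ] E)) (Icc 0 1) s :=
    hasMFDerivWithinAt_iff_hasFDerivWithinAt.1 h1
  refine h2.hasDerivWithinAt.congr_deriv ?_
  rw [← X.dr_hamiltonianVectorField]
  exact congrArg (X.dr (φ s x)) (one_smul ℝ (X.hamiltonianVectorField (W s) (φ s x)))

theorem IsHamiltonianFlow.continuousOn_trajectory (hφ : X.IsHamiltonianFlow W φ) (x : M) :
    ContinuousOn (fun s => φ s x) (Icc 0 1) := fun s hs => (hφ.2.2 s hs x).continuousWithinAt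

/-- Trajectories that are far out at time `s` have been far out all along. -/
theorem IsHamiltonianFlow.mem_farCone (hφ : X.IsHamiltonianFlow W φ) {R₀ C : ℝ}
    (hb : X.IsBoundedBeyond W R₀ C) {R : ℝ} (hR : R₀ ≤ R) {x : M} {s : ℝ} (hs : s ∈ Icc (0 : ℝ) 1)
    (hx : φ s x ∈ X.farCone (R * Real.exp C)) {σ : ℝ} (hσ : σ ∈ Icc 0 s) : φ σ x ∈ X.farCone R := by
  obtain ⟨hR₀, hC, hb⟩ := hb
  have hR0 : 0 < R := one_pos.trans_le (hR₀.trans hR)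
  have hexp : 1 ≤ Real.exp C := Real.one_le_exp hC
  have hRexp : R ≤ R * Real.exp C := le_mul_of_one_le_right hR0.le hexp
  obtain ⟨hxt, hxr⟩ := (X.mem_farCone (hR0.le.trans hRexp)).1 hx
  by_contra hcon
  have hsub : Icc 0 s ⊆ Icc (0 : ℝ) 1 := Icc_subset_Icc_right hs.2
  have hcont := (hφ.continuousOn_trajectory x).mono hsub
  have hBcl : IsClosed (Icc 0 s ∩ (fun σ => φ σ x) ⁻¹' (X.farCone R)ᶜ) :=
    hcont.preimage_isClosed_of_isClosed isClosed_Icc (X.isOpen_farCone hR0.le).isClosed_compl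
  -- τ is the last time at which the trajectory is not beyond R. On (τ, s] the estimate for log r
  -- keeps the radius at least ρ > R.
  obtain ⟨τ, ⟨hτ, hτB⟩, hmax⟩ := (isCompact_Icc.of_isClosed_subset hBcl inter_subset_left).exists_isGreatest
    ⟨σ, hσ, hcon⟩
  have hτs : τ < s := by
    refine lt_of_le_of_ne hτ.2 fun h => hτB ?_
    rw [h]
    exact X.farCone_subset_farCone hRexp hx
  have hfar : ∀ σ ∈ Ioc τ s, φ σ x ∈ X.farCone R := by
    intro σ hσ
    by_contra hn
    exact (hmax ⟨⟨hτ.1.trans hσ.1.le, hσ.2⟩, hn⟩).not_gt hσ.1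
  set ρ : ℝ := X.radius (φ s x) * Real.exp (-C) with hρ
  have hRρ : R < ρ := by
    rw [hρ, Real.exp_neg, ← div_eq_mul_inv, lt_div_iff₀ (Real.exp_pos C)]
    exact hxr
  have hbound : ∀ σ ∈ Ioc τ s, φ σ x ∈ X.cone '' (univ ×ˢ Ici ρ) := by
    intro σ hσ
    have hder : ∀ σ' ∈ Icc σ s, HasDerivWithinAt (fun s => Real.log (X.radius (φ s x)))
        (-dfun (W σ') (φ σ' x) (X.reeb (φ σ' x)) / X.radius (φ σ' x)) (Icc σ s) σ' := by
      intro σ' hσ'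
      have h1 := (X.mem_farCone hR0.le).1 (hfar σ' ⟨hσ.1.trans_le hσ'.1, hσ'.2⟩)
      have h01 : Icc σ s ⊆ Icc (0 : ℝ) 1 := (Icc_subset_Icc_left (hτ.1.trans hσ.1.le)).trans hsub
      exact ((hφ.hasDerivWithinAt_radius (h01 hσ') h1.1).mono h01).log (X.radius_pos h1.1).ne'
    have hle := (convex_Icc σ s).norm_image_sub_le_of_norm_hasDerivWithin_le (C := C) hder (fun σ' hσ' => by
      have h0 := hfar σ' ⟨hσ.1.trans_le hσ'.1, hσ'.2⟩
      have h1 := X.radius_pos ((X.mem_farCone hR0.le).1 h0).1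
      have h2 := (hb σ' (hsub ⟨hτ.1.trans (hσ.1.le.trans hσ'.1), hσ'.2⟩) _ (X.farCone_subset_farCone hR h0)).2.1
      rw [Real.norm_eq_abs, abs_div, abs_neg, abs_of_pos h1, div_le_iff₀ h1]
      exact h2) (left_mem_Icc.2 hσ.2) (right_mem_Icc.2 hσ.2)
    have h1 := (X.mem_farCone hR0.le).1 (hfar σ hσ)
    have h2 := X.radius_pos h1.1
    have h3 := X.radius_pos hxt
    have h4 : Real.log (X.radius (φ s x)) - C ≤ Real.log (X.radius (φ σ x)) := by
      have h5 := (le_abs_self _).trans hle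
      have h6 : ‖s - σ‖ ≤ 1 := by
        rw [Real.norm_eq_abs, abs_of_nonneg (by linarith [hσ.2])]
        linarith [hσ.1, hτ.1, hs.2]
      nlinarith
    refine ⟨_, ⟨mem_univ _, ?_⟩, X.cone_symm_fst_radius h1.1⟩
    have h5 := Real.exp_le_exp.2 h4
    rw [Real.exp_log h2, sub_eq_add_neg, Real.exp_add, Real.exp_log h3] at h5
    exact h5
  -- Since N × [ρ, ∞) is closed in M, the limit at τ still lies in it. This topological argument is
  -- needed as the radial coordinate has no meaning off the end.
  have hτ' : φ τ x ∈ X.cone '' (univ ×ˢ Ici ρ) := by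
    have hcl := X.isClosed_image_cone_Ici (hR₀.trans (hR.trans hRρ.le))
    have ht : Tendsto (fun σ => φ σ x) (𝓝[Ioc τ s] τ) (𝓝 (φ τ x)) :=
      (hcont τ hτ).mono_left (nhdsWithin_mono _ fun σ hσ => ⟨hτ.1.trans hσ.1.le, hσ.2⟩)
    have : (𝓝[Ioc τ s] τ).NeBot := by
      rw [nhdsWithin_Ioc_eq_nhdsGT hτs]
      infer_instance
    exact hcl.mem_of_tendsto ht (by
      filter_upwards [self_mem_nhdsWithin] with σ hσ
      exact hbound σ hσ)
  refine hτB ?_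
  obtain ⟨⟨q, r⟩, ⟨-, hr⟩, h⟩ := hτ'
  change φ τ x ∈ X.farCone R
  rw [← h]
  exact ⟨_, ⟨mem_univ _, hRρ.trans_le hr⟩, rfl⟩

/-- The flow in the chart at `x₀`. -/
def flowInChart (φ : ℝ → M → M) (x₀ : M) (p : ℝ × E) : M := φ p.1 ((extChartAt 𝓘(ℝ, E) x₀).symm p.2)

theorem IsHamiltonianFlow.contMDiffOn_flowInChart (hφ : X.IsHamiltonianFlow W φ) (x₀ : M) :
    ContMDiffOn 𝓘(ℝ, ℝ × E) 𝓘(ℝ, E) ∞ (flowInChart φ x₀)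
      (Icc 0 1 ×ˢ (extChartAt 𝓘(ℝ, E) x₀).target) :=
  hφ.1.comp (contMDiffOn_prod_extChartAt_symm x₀ (Icc 0 1)) fun _ hp => ⟨hp.1, mem_univ _⟩

theorem IsHamiltonianFlow.contMDiffAt_flowInChart (hφ : X.IsHamiltonianFlow W φ) (x₀ : M) {p : ℝ × E}
    (hp : p.1 ∈ Ioo (0 : ℝ) 1) (hp' : p.2 ∈ (extChartAt 𝓘(ℝ, E) x₀).target) :
    ContMDiffAt 𝓘(ℝ, ℝ × E) 𝓘(ℝ, E) ∞ (flowInChart φ x₀) p :=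
  (hφ.contMDiffOn_flowInChart x₀).contMDiffAt
    (prod_mem_nhds (Icc_mem_nhds hp.1 hp.2) ((isOpen_extChartAt_target x₀).mem_nhds hp'))

theorem IsHamiltonianFlow.mfderiv_flowInChart_time (hφ : X.IsHamiltonianFlow W φ) (x₀ : M) {p : ℝ × E}
    (hp : p.1 ∈ Ioo (0 : ℝ) 1) (hp' : p.2 ∈ (extChartAt 𝓘(ℝ, E) x₀).target) :
    (mfderiv 𝓘(ℝ, ℝ × E) 𝓘(ℝ, E) (flowInChart φ x₀) p ((1, 0) : ℝ × E) : E) =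
      X.hamiltonianVectorField (W p.1) (flowInChart φ x₀ p) := by
  have h1 := ((hφ.contMDiffAt_flowInChart x₀ hp hp').mdifferentiableAt (by simp)).hasMFDerivAt
  have h2 : HasMFDerivAt 𝓘(ℝ, ℝ) 𝓘(ℝ, ℝ × E) (fun s : ℝ => (s, p.2)) p.1 (ContinuousLinearMap.inl ℝ ℝ E) :=
    (hasFDerivAt_prodMk_left p.1 p.2).hasMFDerivAt
  have h3 := HasMFDerivAt.comp p.1 (g := flowInChart φ x₀) h1 h2
  have h4 := (hφ.2.2 p.1 (Ioo_subset_Icc_self hp) ((extChartAt 𝓘(ℝ, E) x₀).symm p.2)).hasMFDerivAt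
    (Icc_mem_nhds hp.1 hp.2)
  have h5 := congrArg (fun B : ℝ →L[ℝ] E => B 1) (hasMFDerivAt_unique h3 h4)
  refine Eq.trans h5 ?_
  exact one_smul ℝ (X.hamiltonianVectorField (W p.1) (flowInChart φ x₀ p) : E)

end LiouvilleManifold

/-! ### Invariance of θ under the flow far out. -/

namespace LiouvilleManifold

variable {E M E' N : Type*}
  [NormedAddCommGroup E] [NormedSpace ℝ E] [TopologicalSpace M] [ChartedSpace E M]
  [NormedAddCommGroup E'] [NormedSpace ℝ E'] [TopologicalSpace N] [ChartedSpace E' N]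
  [IsManifold 𝓘(ℝ, E) ∞ M] [IsManifold 𝓘(ℝ, E') ∞ N] [FiniteDimensional ℝ E]
  {X : LiouvilleManifold E M E' N} {W : ℝ → M → ℝ} {φ : ℝ → M → M}

theorem IsHamiltonianFlow.contMDiff_flow (hφ : X.IsHamiltonianFlow W φ) {s : ℝ}
    (hs : s ∈ Icc (0 : ℝ) 1) : ContMDiff 𝓘(ℝ, E) 𝓘(ℝ, E) ∞ (φ s) :=
  contMDiff_slice_of_contMDiffOn hφ.1 hs

theorem mfderiv_extChartAt_symm_mem (x₀ : M) {b : E} (hb : b ∈ (extChartAt 𝓘(ℝ, E) x₀).target) :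
    MDifferentiableAt 𝓘(ℝ, E) 𝓘(ℝ, E) (extChartAt 𝓘(ℝ, E) x₀).symm b :=
  ((contMDiffOn_extChartAt_symm (n := ∞) x₀).contMDiffAt
    ((isOpen_extChartAt_target x₀).mem_nhds hb)).mdifferentiableAt (by simp)

theorem θ_mfderiv_comp_extChartAt_symm {ψ : M → M} (hψ : ContMDiff 𝓘(ℝ, E) 𝓘(ℝ, E) ∞ ψ) (x₀ : M)
    (v : E) : X.θ (ψ ((extChartAt 𝓘(ℝ, E) x₀).symm (extChartAt 𝓘(ℝ, E) x₀ x₀)))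
      (mfderiv 𝓘(ℝ, E) 𝓘(ℝ, E) (ψ ∘ (extChartAt 𝓘(ℝ, E) x₀).symm) (extChartAt 𝓘(ℝ, E) x₀ x₀) v) =
      X.θ (ψ x₀) (mfderiv 𝓘(ℝ, E) 𝓘(ℝ, E) ψ x₀ v) := by
  have hb := mem_extChartAt_target (I := 𝓘(ℝ, E)) x₀
  have h1 := mfderiv_comp (extChartAt 𝓘(ℝ, E) x₀ x₀) ((hψ _).mdifferentiableAt (by simp))
    (mfderiv_extChartAt_symm_mem x₀ hb)
  have h2 := congrArg (fun B : E →L[ℝ] E => B v) h1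
  have h3 : (mfderiv 𝓘(ℝ, E) 𝓘(ℝ, E) (ψ ∘ (extChartAt 𝓘(ℝ, E) x₀).symm) (extChartAt 𝓘(ℝ, E) x₀ x₀) v : E) =
      mfderiv 𝓘(ℝ, E) 𝓘(ℝ, E) ψ ((extChartAt 𝓘(ℝ, E) x₀).symm (extChartAt 𝓘(ℝ, E) x₀ x₀)) v := by
    refine h2.trans ?_
    exact congrArg (fun w : E => (mfderiv 𝓘(ℝ, E) 𝓘(ℝ, E) ψ ((extChartAt 𝓘(ℝ, E) x₀).symm (extChartAt 𝓘(ℝ, E) x₀ x₀)) w : E))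
      (mfderiv_extChartAt_symm_self x₀ v)
  have hcongr : ∀ y (_ : y = x₀), X.θ (ψ y) (mfderiv 𝓘(ℝ, E) 𝓘(ℝ, E) ψ y v) =
      X.θ (ψ x₀) (mfderiv 𝓘(ℝ, E) 𝓘(ℝ, E) ψ x₀ v) := by
    intro y h; subst h; rfl
  refine Eq.trans ?_ (hcongr _ ((extChartAt 𝓘(ℝ, E) x₀).left_inv (mem_extChartAt_source x₀)))
  exact congrArg (fun w : E => X.θ (ψ ((extChartAt 𝓘(ℝ, E) x₀).symm (extChartAt 𝓘(ℝ, E) x₀ x₀))) w) h3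

/-- The flow preserves the Liouville form far out. -/
theorem IsHamiltonianFlow.θ_mfderiv (hφ : X.IsHamiltonianFlow W φ) (hW : X.IsLinearHamiltonian W)
    {R C : ℝ} (hb : X.IsBoundedBeyond W R C)
    {x : M} {s : ℝ} (hs : s ∈ Icc (0 : ℝ) 1) (hx : ∀ σ ∈ Icc 0 s, φ σ x ∈ X.farCone R) (v : E) :
    X.θ (φ s x) (mfderiv 𝓘(ℝ, E) 𝓘(ℝ, E) (φ s) x v) = X.θ x v := by
  have hR0 : 0 ≤ R := zero_le_one.trans hb.1
  set b₀ := extChartAt 𝓘(ℝ, E) x x with hb₀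
  have hbt : b₀ ∈ (extChartAt 𝓘(ℝ, E) x).target := mem_extChartAt_target x
  have hl : (extChartAt 𝓘(ℝ, E) x).symm b₀ = x := (extChartAt 𝓘(ℝ, E) x).left_inv (mem_extChartAt_source x)
  set T := Icc (0 : ℝ) 1 ×ˢ (extChartAt 𝓘(ℝ, E) x).target
  let F : ℝ × E → M := flowInChart φ x
  have hF : ContMDiffOn 𝓘(ℝ, ℝ × E) 𝓘(ℝ, E) ∞ F T := hφ.contMDiffOn_flowInChart x
  let h : ℝ → ℝ := fun σ => X.θ (F (σ, b₀)) (mfderivWithin 𝓘(ℝ, ℝ × E) 𝓘(ℝ, E) F T (σ, b₀) ((0, v) : ℝ × E))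
  have hcont : ContinuousOn h (Icc 0 1) :=
    (IsSmoothOneForm.continuousOn_mfderivWithin X.smooth_θ hF (uniqueDiffOn_Icc_prod_target x) (0, v)).comp
      (f := fun σ : ℝ => (σ, b₀)) (Continuous.prodMk_left b₀).continuousOn fun σ hσ => ⟨hσ, hbt⟩
  have hval : ∀ σ ∈ Icc (0 : ℝ) 1, h σ = X.θ (φ σ x) (mfderiv 𝓘(ℝ, E) 𝓘(ℝ, E) (φ σ) x v) := by
    intro σ hσ
    refine Eq.trans ?_ (θ_mfderiv_comp_extChartAt_symm (hφ.contMDiff_flow hσ) x v)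
    have e1 := ((hF.mdifferentiableOn (by simp)) (σ, b₀) ⟨hσ, hbt⟩).hasMFDerivWithinAt
    have e2 : HasMFDerivWithinAt 𝓘(ℝ, E) 𝓘(ℝ, ℝ × E) (fun b : E => (σ, b)) (extChartAt 𝓘(ℝ, E) x).target b₀
        (ContinuousLinearMap.inr ℝ ℝ E) := (hasFDerivAt_prodMk_right σ b₀).hasMFDerivAt.hasMFDerivWithinAt
    have e3 := (HasMFDerivWithinAt.comp b₀ (g := F) e1 e2 fun b hb => ⟨hσ, hb⟩).hasMFDerivAt
      ((isOpen_extChartAt_target x).mem_nhds hbt)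
    exact congrArg (fun B : E →L[ℝ] E => X.θ (F (σ, b₀)) (B v)) e3.mfderiv.symm
  have hder : ∀ σ ∈ Ioo 0 s, HasDerivAt h 0 σ := by
    intro σ hσ
    have hσ1 : σ ∈ Ioo (0 : ℝ) 1 := ⟨hσ.1, hσ.2.trans_le hs.2⟩
    let Θ : ℝ × E → ℝ × E → ℝ := fun w p => X.θ (F p) (mfderiv 𝓘(ℝ, ℝ × E) 𝓘(ℝ, E) F p w)
    have hz : ContMDiffAt 𝓘(ℝ, ℝ × E) 𝓘(ℝ, E) ∞ F (σ, b₀) := hφ.contMDiffAt_flowInChart x hσ1 hbt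
    have hnear : ∀ᶠ p in 𝓝 (σ, b₀), p.1 ∈ Ioo (0 : ℝ) 1 ∧ p.2 ∈ (extChartAt 𝓘(ℝ, E) x).target ∧
        F p ∈ X.farCone R := by
      have hfar : F (σ, b₀) ∈ X.farCone R := by
        change φ σ ((extChartAt 𝓘(ℝ, E) x).symm b₀) ∈ _
        rw [hl]
        exact hx σ ⟨hσ.1.le, hσ.2.le⟩
      filter_upwards [(isOpen_Ioo.preimage continuous_fst).mem_nhds (x := (σ, b₀)) hσ1,
        ((isOpen_extChartAt_target x).preimage continuous_snd).mem_nhds (x := (σ, b₀)) hbt,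
        hz.continuousAt.eventually ((X.isOpen_farCone hR0).mem_nhds hfar)] with p h1 h2 h3
      exact ⟨h1, h2, h3⟩
    have hΘd : ∀ w, DifferentiableAt ℝ (Θ w) (σ, b₀) := fun w =>
      (oneForm_mfderiv_contDiffAt X.smooth_θ hz w).differentiableAt (by simp)
    -- θ(X_W) = dW(Z) = W by homogeneity; this is where linearity at infinity enters.
    have hΘ1 : Θ (1, 0) =ᶠ[𝓝 (σ, b₀)] fun p => W p.1 (F p) := by
      filter_upwards [hnear] with p ⟨h1, h2, h3⟩
      refine (congrArg (fun w : E => X.θ (F p) w) (hφ.mfderiv_flowInChart_time x h1 h2)).trans ?_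
      exact (X.θ_hamiltonianVectorField (W p.1) (F p)).trans
        (hb.2.2 p.1 (Ioo_subset_Icc_self h1) _ h3).2.2
    -- Cartan's formula by hand: ω(X_W, F_v) = ∂_σ θ(F_v) - ∂_v(W ∘ F), and the left side is
    -- -dW(F_v), so ∂_σ θ(F_v) = 0.
    have hω := extDerivOneForm_mfderiv X.smooth_θ hz (1, 0) (0, v)
    have hω' : X.symplForm (F (σ, b₀)) (X.hamiltonianVectorField (W σ) (F (σ, b₀)))
        (mfderiv 𝓘(ℝ, ℝ × E) 𝓘(ℝ, E) F (σ, b₀) ((0, v) : ℝ × E)) =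
        fderiv ℝ (Θ (0, v)) (σ, b₀) (1, 0) - fderiv ℝ (Θ (1, 0)) (σ, b₀) (0, v) := by
      refine Eq.trans ?_ hω
      exact congrArg (fun w : E => X.symplForm (F (σ, b₀)) w
        (mfderiv 𝓘(ℝ, ℝ × E) 𝓘(ℝ, E) F (σ, b₀) ((0, v) : ℝ × E))) (hφ.mfderiv_flowInChart_time x hσ1 hbt).symm
    rw [symplForm_hamiltonianVectorField'] at hω'
    have e2 : HasFDerivAt (fun b : E => (σ, b)) (ContinuousLinearMap.inr ℝ ℝ E) b₀ :=
      hasFDerivAt_prodMk_right σ b₀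
    have hW1 : fderiv ℝ (Θ (1, 0)) (σ, b₀) (0, v) = dfun (W σ) (F (σ, b₀))
        (mfderiv 𝓘(ℝ, ℝ × E) 𝓘(ℝ, E) F (σ, b₀) ((0, v) : ℝ × E)) := by
      have e3 := ((hΘd (1, 0)).hasFDerivAt.congr_of_eventuallyEq hΘ1.symm).comp b₀ e2
      have e4 := HasMFDerivAt.comp b₀ (g := F) (hz.mdifferentiableAt (by simp)).hasMFDerivAt e2.hasMFDerivAt
      have e5 : HasMFDerivAt 𝓘(ℝ, E) 𝓘(ℝ, ℝ) (W σ) (F (σ, b₀)) (dfun (W σ) (F (σ, b₀))) :=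
        ((contMDiff_slice_of_contMDiffOn hW.1 (Ioo_subset_Icc_self hσ1)).contMDiffAt.mdifferentiableAt
          (by simp)).hasMFDerivAt
      have e6 := HasMFDerivAt.comp b₀ (g := W σ) (f := F ∘ fun b : E => (σ, b)) e5 e4
      have e7 : HasFDerivAt (fun b : E => W σ (F (σ, b))) ((dfun (W σ) (F (σ, b₀)) : E →L[ℝ] ℝ).comp
          ((mfderiv 𝓘(ℝ, ℝ × E) 𝓘(ℝ, E) F (σ, b₀) : ℝ × E →L[ℝ] E).comp
            (ContinuousLinearMap.inr ℝ ℝ E))) b₀ := hasMFDerivAt_iff_hasFDerivAt.1 e6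
      exact (congrArg (fun B : E →L[ℝ] ℝ => B v) (e7.unique e3)).symm
    rw [hW1] at hω'
    have hzero : fderiv ℝ (Θ (0, v)) (σ, b₀) (1, 0) = 0 := by linarith
    have h3 := (hΘd (0, v)).hasFDerivAt.comp_hasDerivAt (f := fun σ : ℝ => (σ, b₀)) σ
      ((hasDerivAt_id σ).prodMk (hasDerivAt_const σ b₀))
    rw [hzero] at h3
    refine h3.congr_of_eventuallyEq ?_
    filter_upwards [Ioo_mem_nhds hσ1.1 hσ1.2] with τ hτ
    have hT : T ∈ 𝓝 (τ, b₀) := prod_mem_nhds (Icc_mem_nhds hτ.1 hτ.2) ((isOpen_extChartAt_target x).mem_nhds hbt)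
    simp only [h, Θ, Function.comp, mfderivWithin_of_mem_nhds hT]
  have hh0 : h 0 = X.θ x v := by
    rw [hval 0 ⟨le_rfl, zero_le_one⟩]
    have hcongr : ∀ ψ : M → M, ψ = id → X.θ (ψ x) (mfderiv 𝓘(ℝ, E) 𝓘(ℝ, E) ψ x v) = X.θ x v := by
      intro ψ hψ
      subst hψ
      rw [mfderiv_id]
      rfl
    exact hcongr _ (funext hφ.2.1)
  rw [← hval s hs, ← hh0]
  rcases eq_or_lt_of_le hs.1 with h0 | h0
  · rw [← h0]
  · obtain ⟨c, -, hc⟩ := exists_hasDerivAt_eq_slope h (fun _ => 0) h0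
      (hcont.mono (Icc_subset_Icc_right hs.2)) hder
    rw [eq_comm, div_eq_zero_iff] at hc
    rcases hc with hc | hc <;> linarith

/-- The flow is immersive far out. -/
theorem IsHamiltonianFlow.mfderiv_injective (hφ : X.IsHamiltonianFlow W φ) (hW : X.IsLinearHamiltonian W)
    {R C : ℝ} (hb : X.IsBoundedBeyond W R C) {x : M} {s : ℝ} (hs : s ∈ Icc (0 : ℝ) 1)
    (hx : φ s x ∈ X.farCone (R * Real.exp C)) {v : E}
    (hv : (mfderiv 𝓘(ℝ, E) 𝓘(ℝ, E) (φ s) x v : E) = 0) : v = 0 := by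
  have hR0 : 0 ≤ R := zero_le_one.trans hb.1
  have hφs := hφ.contMDiff_flow hs
  set b₀ := extChartAt 𝓘(ℝ, E) x x with hb₀
  have hbt : b₀ ∈ (extChartAt 𝓘(ℝ, E) x).target := mem_extChartAt_target x
  have hl : (extChartAt 𝓘(ℝ, E) x).symm b₀ = x := (extChartAt 𝓘(ℝ, E) x).left_inv (mem_extChartAt_source x)
  let e := (extChartAt 𝓘(ℝ, E) x).symm
  have he : ContMDiffAt 𝓘(ℝ, E) 𝓘(ℝ, E) ∞ e b₀ :=
    contMDiffAt_extChartAt_symm (mem_chart_source E x)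
  let G := φ s ∘ e
  have hG : ContMDiffAt 𝓘(ℝ, E) 𝓘(ℝ, E) ∞ G b₀ := (hφs _).comp b₀ he
  -- θ is preserved on a whole neighbourhood, so its derivative ω is preserved as well, and a
  -- nondegenerate form that is preserved forces an injective differential.
  have hnear : ∀ᶠ b in 𝓝 b₀, ∀ w : E, X.θ (G b) (mfderiv 𝓘(ℝ, E) 𝓘(ℝ, E) G b w) =
      X.θ (e b) (mfderiv 𝓘(ℝ, E) 𝓘(ℝ, E) e b w) := by
    have hfar : G b₀ ∈ X.farCone (R * Real.exp C) := by
      change φ s (e b₀) ∈ _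
      rw [show e b₀ = x from hl]
      exact hx
    filter_upwards [(isOpen_extChartAt_target x).mem_nhds hbt, hG.continuousAt.eventually
      ((X.isOpen_farCone (mul_nonneg hR0 (Real.exp_pos C).le)).mem_nhds hfar)] with b hb1 hb2 w
    have h1 := mfderiv_comp b ((hφs (e b)).mdifferentiableAt (by simp)) (mfderiv_extChartAt_symm_mem x hb1)
    have h2 := congrArg (fun B : E →L[ℝ] E => X.θ (G b) (B w)) h1
    refine h2.trans ?_
    exact hφ.θ_mfderiv hW hb hs (fun σ hσ => hφ.mem_farCone hb le_rfl hs hb2 hσ) _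
  have hω : ∀ w : E, extDerivOneForm X.θ (G b₀) (mfderiv 𝓘(ℝ, E) 𝓘(ℝ, E) G b₀ v)
      (mfderiv 𝓘(ℝ, E) 𝓘(ℝ, E) G b₀ w) = extDerivOneForm X.θ (e b₀) (mfderiv 𝓘(ℝ, E) 𝓘(ℝ, E) e b₀ v)
      (mfderiv 𝓘(ℝ, E) 𝓘(ℝ, E) e b₀ w) := by
    intro w
    rw [extDerivOneForm_mfderiv X.smooth_θ hG v w, extDerivOneForm_mfderiv X.smooth_θ he v w]
    have e1 : ∀ w : E, (fun b => X.θ (G b) (mfderiv 𝓘(ℝ, E) 𝓘(ℝ, E) G b w)) =ᶠ[𝓝 b₀]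
        fun b => X.θ (e b) (mfderiv 𝓘(ℝ, E) 𝓘(ℝ, E) e b w) := fun w => hnear.mono fun b hb => hb w
    rw [(e1 w).fderiv_eq, (e1 v).fderiv_eq]
  have hself : ∀ w : E, (mfderiv 𝓘(ℝ, E) 𝓘(ℝ, E) e b₀ w : E) = w := mfderiv_extChartAt_symm_self x
  have hG0 : (mfderiv 𝓘(ℝ, E) 𝓘(ℝ, E) G b₀ v : E) = 0 := by
    have h1 := mfderiv_comp b₀ ((hφs (e b₀)).mdifferentiableAt (by simp)) (mfderiv_extChartAt_symm_mem x hbt)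
    refine (congrArg (fun B : E →L[ℝ] E => B v) h1).trans ?_
    have hcongr : ∀ y (_ : y = x), (mfderiv 𝓘(ℝ, E) 𝓘(ℝ, E) (φ s) y v : E) =
      mfderiv 𝓘(ℝ, E) 𝓘(ℝ, E) (φ s) x v := by
      intro y h; subst h; rfl
    refine Eq.trans ?_ ((hcongr _ hl).trans hv)
    exact congrArg (fun w : E => (mfderiv 𝓘(ℝ, E) 𝓘(ℝ, E) (φ s) (e b₀) w : E)) (hself v)
  have hnd : ∀ y (_ : y = x) (v : E), (∀ w : E, X.symplForm y v w = 0) → v = 0 := by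
    intro y _ v h
    exact X.nondegenerate y v h
  refine hnd _ hl v fun w => ?_
  have h1 := hω w
  have h2 : extDerivOneForm X.θ (e b₀) (mfderiv 𝓘(ℝ, E) 𝓘(ℝ, E) e b₀ v) (mfderiv 𝓘(ℝ, E) 𝓘(ℝ, E) e b₀ w) =
      X.symplForm (e b₀) v w :=
    congrArg₂ (fun a b : E => X.symplForm (e b₀) a b) (hself v) (hself w)
  rw [← h2, ← h1]
  refine (congrArg (fun a : E => X.symplForm (G b₀) a (mfderiv 𝓘(ℝ, E) 𝓘(ℝ, E) G b₀ w)) hG0).trans ?_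
  have := X.symplForm_smul_left (G b₀) 0 (0 : E) (mfderiv 𝓘(ℝ, E) 𝓘(ℝ, E) G b₀ w)
  rw [zero_mul] at this
  refine Eq.trans ?_ this
  exact congrArg (fun a : E => X.symplForm (G b₀) a (mfderiv 𝓘(ℝ, E) 𝓘(ℝ, E) G b₀ w)) (zero_smul ℝ (0 : E)).symm

end LiouvilleManifold

/-! ### Lifting curves on a dense set of times by Baire category. -/

section Lifting

/-- If the graph of `γ` is covered by `Ψ` restricted to the locally compact set `L`, then at a dense
set of times the lifts of `γ` to `L` stay in one of the given neighbourhoods. -/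
theorem subset_closure_of_lift {Y Z : Type*} [TopologicalSpace Y] [T2Space Y]
    [SecondCountableTopology Y] [TopologicalSpace Z] [T2Space Z] {O : Set ℝ} (hO : IsOpen O)
    {γ : ℝ → Z} (hγ : ContinuousOn γ O) {Ψ : ℝ × Y → Z} {L : Set Y}
    (hL : ∀ y ∈ L, ∀ U ∈ 𝓝 y, ∃ B ∈ 𝓝 y, B ⊆ U ∧ IsCompact (L ∩ B))
    (h : ∀ s ∈ O, ∃ y ∈ L, Ψ (s, y) = γ s) {P : ℝ → Prop}
    (hloc : ∀ s ∈ O, ∀ y ∈ L, Ψ (s, y) = γ s → ∃ U ∈ 𝓝 (s, y), ContinuousOn Ψ U ∧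
      ∀ s' ∈ O, (∀ᶠ σ in 𝓝 s', ∃ y ∈ L, (σ, y) ∈ U ∧ Ψ (σ, y) = γ σ) → P s') :
    O ⊆ closure {s | s ∈ O ∧ P s} := by
  let T : Set (ℝ × Y) := {p | p.1 ∈ O ∧ p.2 ∈ L ∧ Ψ p = γ p.1}
  have hex : ∀ p : T, ∃ (A : Set ℝ) (B : Set Y), A ∈ 𝓝 p.1.1 ∧ B ∈ 𝓝 p.1.2 ∧ IsCompact A ∧ A ⊆ O ∧
      IsCompact (L ∩ B) ∧ ContinuousOn Ψ (A ×ˢ B) ∧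
      ∀ s' ∈ O, (∀ᶠ σ in 𝓝 s', ∃ y ∈ L, (σ, y) ∈ A ×ˢ B ∧ Ψ (σ, y) = γ σ) → P s' := by
    rintro ⟨⟨s, y⟩, hs, hy, hsy⟩
    obtain ⟨U, hU, hUc, hUP⟩ := hloc s hs y hy hsy
    rw [nhds_prod_eq, mem_prod_iff] at hU
    obtain ⟨A, hA, B, hB, hAB⟩ := hU
    obtain ⟨A', hA', hA's, hA'c⟩ := local_compact_nhds (inter_mem hA (hO.mem_nhds hs))
    obtain ⟨B', hB', hB's, hB'c⟩ := hL y hy B hB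
    have hsub : A' ×ˢ B' ⊆ U := (prod_mono (hA's.trans inter_subset_left) hB's).trans hAB
    refine ⟨A', B', hA', hB', hA'c, hA's.trans inter_subset_right, hB'c, hUc.mono hsub,
      fun s' hs' h' => hUP s' hs' (h'.mono ?_)⟩
    rintro σ ⟨y, hy, hσ, he⟩
    exact ⟨y, hy, hsub hσ, he⟩
  choose A B hA hB hAc hAO hBc hΨ hP using hex
  -- Lindelöf property of the set of all pairs (time, lift): countably many good boxes suffice.
  obtain ⟨t, htc, htT⟩ : ∃ t : Set T, t.Countable ∧ (⋃ p ∈ t, ((fun p : T => (p : ℝ × Y)) ⁻¹' (A p ×ˢ B p))) = univ := by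
    refine TopologicalSpace.countable_cover_nhds fun p => ?_
    exact continuous_subtype_val.continuousAt.preimage_mem_nhds (prod_mem_nhds (hA p) (hB p))
  -- The times with a lift in a given box. They form a closed set, being the projection of a compact
  -- one; this uses compactness of `L ∩ B`.
  let S : T → Set ℝ := fun p => {σ | σ ∈ A p ∧ ∃ y ∈ L ∩ B p, Ψ (σ, y) = γ σ}
  have hS : ∀ p, IsClosed (S p) := by
    intro p
    have hK : IsCompact (A p ×ˢ (L ∩ B p)) := (hAc p).prod (hBc p)
    have h1 : ContinuousOn (fun q : ℝ × Y => (Ψ q, γ q.1)) (A p ×ˢ (L ∩ B p)) :=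
      ((hΨ p).mono (prod_mono_right inter_subset_right)).prodMk
        (hγ.comp continuousOn_fst fun q hq => hAO p hq.1)
    have h2 := (hK.of_isClosed_subset (h1.preimage_isClosed_of_isClosed hK.isClosed isClosed_diagonal)
      inter_subset_left).image continuous_fst
    convert h2.isClosed using 1
    ext σ
    constructor
    · rintro ⟨hσ, y, hy, he⟩
      exact ⟨(σ, y), ⟨⟨hσ, hy⟩, he⟩, rfl⟩
    · rintro ⟨⟨σ, y⟩, ⟨⟨hσ, hy⟩, he⟩, rfl⟩
      exact ⟨hσ, y, hy, he⟩
  have := htc.to_subtype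
  -- Adding the complement of O gives a countable closed cover of ℝ. By Baire the interiors are
  -- dense, and around an interior time all lifts can be taken in one box.
  let S' : Option t → Set ℝ := fun o => o.elim Oᶜ fun p => S p
  have hS' : ∀ o, IsClosed (S' o) := by
    rintro (_ | p)
    · exact hO.isClosed_compl
    · exact hS p
  have hcov : ⋃ o, S' o = univ := by
    refine eq_univ_of_forall fun s => ?_
    by_cases hs : s ∈ O
    · obtain ⟨y, hy, he⟩ := h s hs
      have h1 : (⟨(s, y), hs, hy, he⟩ : T) ∈ (⋃ p ∈ t, ((fun p : T => (p : ℝ × Y)) ⁻¹' (A p ×ˢ B p))) := by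
        rw [htT]; exact mem_univ _
      obtain ⟨p, hp, hpm⟩ := mem_iUnion₂.1 h1
      exact mem_iUnion.2 ⟨some ⟨p, hp⟩, hpm.1, y, ⟨hy, hpm.2⟩, he⟩
    · exact mem_iUnion.2 ⟨none, hs⟩
  have hd := dense_iUnion_interior_of_closed hS' hcov
  refine (hd.open_subset_closure_inter hO).trans (closure_mono ?_)
  rintro s ⟨hs, hs'⟩
  obtain ⟨o, ho⟩ := mem_iUnion.1 hs'
  refine ⟨hs, ?_⟩
  rcases o with _ | p
  · exact absurd hs (interior_subset ho)
  · refine hP p s hs ?_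
    filter_upwards [isOpen_interior.mem_nhds ho] with σ hσ
    obtain ⟨hσA, y, hy, he⟩ := interior_subset hσ
    exact ⟨y, hy.1, ⟨hσA, hy.2⟩, he⟩

end Lifting

/-! ### Differentiability of lifts through a local diffeomorphism. -/

section LocalInverse

variable {E : Type*} [NormedAddCommGroup E] [NormedSpace ℝ E] [FiniteDimensional ℝ E]
  {M : Type*} [TopologicalSpace M] [ChartedSpace E M] [IsManifold 𝓘(ℝ, E) ∞ M]

/-- Where `(s, y) ↦ (s, Ψ (s, y))` is a local diffeomorphism, lifts of differentiable curves are
differentiable. -/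
theorem exists_nhds_differentiable_lift {Ψ : ℝ × M → M} {z : ℝ × M}
    (hΨ : ContMDiffAt (𝓘(ℝ, ℝ).prod 𝓘(ℝ, E)) 𝓘(ℝ, E) ∞ Ψ z)
    (hinj : ∀ v : E, (mfderiv 𝓘(ℝ, E) 𝓘(ℝ, E) (fun y => Ψ (z.1, y)) z.2 v : E) = 0 → v = 0) :
    ∃ U ∈ 𝓝 z, ∀ (L : Set M) (γ : ℝ → M) (s : ℝ), MDifferentiableAt 𝓘(ℝ, ℝ) 𝓘(ℝ, E) γ s →
      (∀ᶠ σ in 𝓝 s, ∃ y ∈ L, (σ, y) ∈ U ∧ Ψ (σ, y) = γ σ) →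
      ∃ y : ℝ → M, MDifferentiableAt 𝓘(ℝ, ℝ) 𝓘(ℝ, E) y s ∧
        ∀ᶠ σ in 𝓝 s, y σ ∈ L ∧ (σ, y σ) ∈ U ∧ Ψ (σ, y σ) = γ σ := by
  obtain ⟨s₀, y₀⟩ := z
  set e := extChartAt 𝓘(ℝ, E) y₀ with he
  set e' := extChartAt 𝓘(ℝ, E) (Ψ (s₀, y₀)) with he'
  set b₀ := e y₀ with hb₀
  have hbt : b₀ ∈ e.target := mem_extChartAt_target y₀
  have hl : e.symm b₀ = y₀ := e.left_inv (mem_extChartAt_source y₀)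
  let κ : ℝ × E → ℝ × M := fun p => (p.1, e.symm p.2)
  have hκ : ContMDiffAt 𝓘(ℝ, ℝ × E) (𝓘(ℝ, ℝ).prod 𝓘(ℝ, E)) ∞ κ (s₀, b₀) :=
    (LiouvilleManifold.contMDiffOn_prod_extChartAt_symm y₀ univ).contMDiffAt
      (prod_mem_nhds univ_mem ((isOpen_extChartAt_target y₀).mem_nhds hbt))
  have hκ0 : κ (s₀, b₀) = (s₀, y₀) := by simp only [κ, hl]
  let F : ℝ × E → M := Ψ ∘ κ
  have hF : ContMDiffAt 𝓘(ℝ, ℝ × E) 𝓘(ℝ, E) ∞ F (s₀, b₀) := by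
    refine ContMDiffAt.comp (s₀, b₀) ?_ hκ
    rw [hκ0]; exact hΨ
  have hF0 : F (s₀, b₀) = Ψ (s₀, y₀) := by simp only [F, Function.comp, hκ0]
  have he's : F (s₀, b₀) ∈ e'.source := by rw [hF0]; exact mem_extChartAt_source _
  have heF : ContMDiffAt 𝓘(ℝ, ℝ × E) 𝓘(ℝ, E) ∞ (e' ∘ F) (s₀, b₀) :=
    (contMDiffAt_extChartAt' (by simpa [he'] using he's)).comp (s₀, b₀) hF
  -- Keeping the time as first component turns a family of immersions between spaces of equal
  -- dimension into one map with invertible derivative.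
  let G : ℝ × E → ℝ × E := fun p => (p.1, e' (F p))
  have hG : ContDiffAt ℝ ∞ G (s₀, b₀) := contDiffAt_fst.prodMk heF.contDiffAt
  have hFinj : ∀ v : E, (mfderiv 𝓘(ℝ, ℝ × E) 𝓘(ℝ, E) F (s₀, b₀) ((0, v) : ℝ × E) : E) = 0 → v = 0 := by
    intro v hv
    refine hinj v ?_
    have hψ : MDifferentiableAt 𝓘(ℝ, E) 𝓘(ℝ, E) (fun y => Ψ (s₀, y)) y₀ :=
      MDifferentiableAt.comp y₀ (g := Ψ) (f := fun y => (s₀, y)) (hΨ.mdifferentiableAt (by simp))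
        (mdifferentiableAt_const.prodMk mdifferentiableAt_id)
    have hψ' : MDifferentiableAt 𝓘(ℝ, E) 𝓘(ℝ, E) (fun y => Ψ (s₀, y)) (e.symm b₀) := by rw [hl]; exact hψ
    have h1 := mfderiv_comp b₀ hψ' (LiouvilleManifold.mfderiv_extChartAt_symm_mem y₀ hbt)
    have e2 : HasMFDerivAt 𝓘(ℝ, E) 𝓘(ℝ, ℝ × E) (fun b : E => (s₀, b)) b₀ (ContinuousLinearMap.inr ℝ ℝ E) :=
      (hasFDerivAt_prodMk_right s₀ b₀).hasMFDerivAt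
    have h2 := (HasMFDerivAt.comp b₀ (g := F) (hF.mdifferentiableAt (by simp)).hasMFDerivAt e2).mfderiv
    have h3 : (mfderiv 𝓘(ℝ, E) 𝓘(ℝ, E) (fun y => Ψ (s₀, y)) (e.symm b₀) v : E) = 0 := by
      refine Eq.trans ?_ hv
      refine Eq.trans ?_ (congrArg (fun B : E →L[ℝ] E => B v) (h1.symm.trans h2))
      exact congrArg (fun w : E => (mfderiv 𝓘(ℝ, E) 𝓘(ℝ, E) (fun y => Ψ (s₀, y)) (e.symm b₀) w : E))
        (LiouvilleManifold.mfderiv_extChartAt_symm_self y₀ v).symm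
    have hcongr : ∀ y (_ : y = y₀), (mfderiv 𝓘(ℝ, E) 𝓘(ℝ, E) (fun y => Ψ (s₀, y)) y v : E) =
        mfderiv 𝓘(ℝ, E) 𝓘(ℝ, E) (fun y => Ψ (s₀, y)) y₀ v := by
      intro y h; subst h; rfl
    exact (hcongr _ hl).symm.trans h3
  have hGinj : ∀ w : ℝ × E, fderiv ℝ G (s₀, b₀) w = 0 → w = 0 := by
    intro w hw
    have hd : DifferentiableAt ℝ (e' ∘ F) (s₀, b₀) := heF.contDiffAt.differentiableAt (by simp)
    have h1 : HasFDerivAt G ((ContinuousLinearMap.fst ℝ ℝ E).prod (fderiv ℝ (e' ∘ F) (s₀, b₀))) (s₀, b₀) :=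
      hasFDerivAt_fst.prodMk hd.hasFDerivAt
    rw [h1.fderiv] at hw
    obtain ⟨w₁, w₂⟩ := w
    have hw1 : w₁ = 0 := congrArg Prod.fst hw
    have hw2 : fderiv ℝ (e' ∘ F) (s₀, b₀) (w₁, w₂) = 0 := congrArg Prod.snd hw
    subst hw1
    have h2 : MDifferentiableAt 𝓘(ℝ, E) 𝓘(ℝ, E) e'.symm ((e' ∘ F) (s₀, b₀)) :=
      LiouvilleManifold.mfderiv_extChartAt_symm_mem _ (e'.map_source he's)
    have h3 : e'.symm ∘ (e' ∘ F) =ᶠ[𝓝 (s₀, b₀)] F := by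
      filter_upwards [hF.continuousAt.eventually ((isOpen_extChartAt_source _).mem_nhds he's)] with p hp
      exact e'.left_inv hp
    have h4 := (HasMFDerivAt.comp (s₀, b₀) h2.hasMFDerivAt hd.hasFDerivAt.hasMFDerivAt).congr_of_eventuallyEq h3.symm
    rw [hFinj w₂ ?_]
    · rfl
    refine (congrArg (fun B : ℝ × E →L[ℝ] E => B (0, w₂)) h4.mfderiv).trans ?_
    refine (congrArg (fun v : E => (mfderiv 𝓘(ℝ, E) 𝓘(ℝ, E) e'.symm ((e' ∘ F) (s₀, b₀)) v : E)) hw2).trans ?_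
    exact map_zero (mfderiv 𝓘(ℝ, E) 𝓘(ℝ, E) e'.symm ((e' ∘ F) (s₀, b₀)) : E →L[ℝ] E)
  have hGe : ∃ e : (ℝ × E) ≃L[ℝ] (ℝ × E), (e : (ℝ × E) →L[ℝ] (ℝ × E)) = fderiv ℝ G (s₀, b₀) := by
    have h1 : Function.Injective (fderiv ℝ G (s₀, b₀)).toLinearMap := by
      rw [← LinearMap.ker_eq_bot, LinearMap.ker_eq_bot']
      exact hGinj
    refine ⟨(LinearEquiv.ofInjectiveEndo _ h1).toContinuousLinearEquiv, ?_⟩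
    ext w <;> rfl
  obtain ⟨g, hg⟩ := hGe
  have hG' : HasFDerivAt G (g : (ℝ × E) →L[ℝ] (ℝ × E)) (s₀, b₀) := by
    rw [hg]
    exact (hG.differentiableAt (by simp)).hasFDerivAt
  have hn : (∞ : WithTop ℕ∞) ≠ 0 := by simp
  let inv := hG.localInverse hG' hn
  have hinvc : ContDiffAt ℝ ∞ inv (G (s₀, b₀)) := hG.to_localInverse hG' hn
  have hleft : ∀ᶠ w in 𝓝 (s₀, b₀), inv (G w) = w := (hG.hasStrictFDerivAt' hG' hn).eventually_left_inverse
  have hdiff : ∀ᶠ w in 𝓝 (s₀, b₀), DifferentiableAt ℝ inv (G w) := by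
    have h1 : ContDiffAt ℝ 1 inv (G (s₀, b₀)) := hinvc.of_le (by exact_mod_cast le_top)
    have h2 := h1.eventually (by simp)
    exact (hG.continuousAt.eventually h2).mono fun w hw => hw.differentiableAt (by simp)
  have hcoord : ContinuousAt (fun p : ℝ × M => (p.1, e p.2)) (s₀, y₀) :=
    continuousAt_fst.prodMk ((continuousAt_extChartAt y₀).comp (f := Prod.snd) (x := (s₀, y₀)) continuousAt_snd)
  refine ⟨{p | p.2 ∈ e.source ∧ Ψ p ∈ e'.source ∧ inv (G (p.1, e p.2)) = (p.1, e p.2) ∧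
      DifferentiableAt ℝ inv (G (p.1, e p.2))}, ?_, ?_⟩
  · filter_upwards [continuousAt_snd.eventually (extChartAt_source_mem_nhds (I := 𝓘(ℝ, E)) y₀),
      hΨ.continuousAt.eventually (extChartAt_source_mem_nhds (I := 𝓘(ℝ, E)) (Ψ (s₀, y₀))),
      hcoord.eventually hleft, hcoord.eventually hdiff] with p h1 h2 h3 h4
    exact ⟨h1, h2, h3, h4⟩
  intro L γ s hγ hlift
  have : Nonempty M := ⟨y₀⟩
  -- The lift is chosen arbitrarily at each time, but within U the local inverse determines it, and
  -- this formula (`key`) makes it differentiable.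
  choose! y hyL hyU hyγ using fun σ (h : ∃ y ∈ L, (σ, y) ∈ {p : ℝ × M | p.2 ∈ e.source ∧ Ψ p ∈ e'.source ∧ inv (G (p.1, e p.2)) = (p.1, e p.2) ∧
      DifferentiableAt ℝ inv (G (p.1, e p.2))} ∧ Ψ (σ, y) = γ σ) => h
  have key : ∀ᶠ σ in 𝓝 s, G (σ, e (y σ)) = (σ, e' (γ σ)) ∧ y σ = e.symm (inv (σ, e' (γ σ))).2 := by
    filter_upwards [hlift] with σ hσ
    obtain ⟨h1, h2, h3, h4⟩ := hyU σ hσ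
    have h5 : G (σ, e (y σ)) = (σ, e' (γ σ)) := by
      simp only [G, F, κ, Function.comp]
      rw [e.left_inv h1, hyγ σ hσ]
    refine ⟨h5, ?_⟩
    rw [← h5]
    have h3' : inv (G (σ, e (y σ))) = (σ, e (y σ)) := h3
    rw [h3', e.left_inv h1]
  have hs := hlift.self_of_nhds
  obtain ⟨h1, h2, h3, h4⟩ := hyU s hs
  refine ⟨y, ?_, hlift.mono fun σ hσ => ⟨hyL σ hσ, hyU σ hσ, hyγ σ hσ⟩⟩
  have hγs : γ s ∈ (chartAt E (Ψ (s₀, y₀))).source := by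
    rw [← hyγ s hs]; simpa [he'] using h2
  have hd1 : DifferentiableAt ℝ (fun σ => e' (γ σ)) s :=
    mdifferentiableAt_iff_differentiableAt.1
      (((contMDiffAt_extChartAt' (n := ∞) hγs).mdifferentiableAt (by simp)).comp s hγ)
  have hd2 : DifferentiableAt ℝ (fun σ => (inv (σ, e' (γ σ))).2) s := by
    have h5 : DifferentiableAt ℝ inv (s, e' (γ s)) := by
      rw [← key.self_of_nhds.1]; exact h4
    exact (h5.comp s (f := fun σ => (σ, e' (γ σ))) (differentiableAt_id.prodMk hd1)).snd
  have hmem : (inv (s, e' (γ s))).2 ∈ e.target := by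
    rw [← key.self_of_nhds.1]
    have h3' : inv (G (s, e (y s))) = (s, e (y s)) := h3
    rw [h3']
    exact e.map_source h1
  have hd3 : MDifferentiableAt 𝓘(ℝ, ℝ) 𝓘(ℝ, E) (fun σ => e.symm (inv (σ, e' (γ σ))).2) s :=
    (LiouvilleManifold.mfderiv_extChartAt_symm_mem y₀ hmem).comp s hd2.mdifferentiableAt
  exact hd3.congr_of_eventuallyEq (key.mono fun σ hσ => hσ.2)

end LocalInverse

/-! ### Curves in Lagrangians with conical ends. -/

namespace LiouvilleManifold

variable {E M E' N : Type*}
  [NormedAddCommGroup E] [NormedSpace ℝ E] [TopologicalSpace M] [ChartedSpace E M]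
  [NormedAddCommGroup E'] [NormedSpace ℝ E'] [TopologicalSpace N] [ChartedSpace E' N]
  [IsManifold 𝓘(ℝ, E) ∞ M] [IsManifold 𝓘(ℝ, E') ∞ N] [FiniteDimensional ℝ E]
  {X : LiouvilleManifold E M E' N} {W : ℝ → M → ℝ} {φ : ℝ → M → M} {L : Set M}

/-- A Lagrangian is not assumed closed in M; being cut out by a linear subspace in charts, it is
locally closed, which is all the lifting argument requires. -/
theorem IsLagrangian.exists_isCompact_inter [T2Space M] (hL : X.IsLagrangian L) {y : M} (hy : y ∈ L)
    {U : Set M} (hU : U ∈ 𝓝 y) : ∃ B ∈ 𝓝 y, B ⊆ U ∧ IsCompact (L ∩ B) := by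
  obtain ⟨e, -, V, hye, -, hV, -⟩ := hL y hy
  have := Manifold.locallyCompact_of_finiteDimensional (M := M) 𝓘(ℝ, E)
  obtain ⟨B, hB, hBs, hBc⟩ := local_compact_nhds (inter_mem hU (e.open_source.mem_nhds hye))
  refine ⟨B, hB, hBs.trans inter_subset_left, ?_⟩
  have h1 : IsClosed (B ∩ e ⁻¹' V) := (e.continuousOn.mono (hBs.trans inter_subset_right)).preimage_isClosed_of_isClosed
    hBc.isClosed V.closed_of_finiteDimensional
  convert hBc.of_isClosed_subset h1 inter_subset_left using 1
  ext x
  constructor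
  · rintro ⟨hx, hxB⟩
    exact ⟨hxB, (hV x (hBs hxB).2).1 hx⟩
  · rintro ⟨hxB, hx⟩
    exact ⟨(hV x (hBs hxB).2).2 hx, hxB⟩

/-- The velocity of a curve in a submanifold is tangent to the submanifold. -/
theorem mfderiv_chart_velocity_mem {e : OpenPartialHomeomorph M E}
    (he : e ∈ IsManifold.maximalAtlas 𝓘(ℝ, E) ∞ M) {V : Submodule ℝ E}
    (hV : ∀ x ∈ e.source, x ∈ L ↔ e x ∈ V) {γ : ℝ → M} {s : ℝ} {x : M} (hx : γ s = x) (hxe : x ∈ e.source)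
    {v : E} (hγ : HasMFDerivAt 𝓘(ℝ, ℝ) 𝓘(ℝ, E) γ s (velocity (x := γ s) v)) (hmem : ∀ᶠ σ in 𝓝 s, γ σ ∈ L) :
    mfderiv 𝓘(ℝ, E) 𝓘(ℝ, E) e x v ∈ V := by
  subst hx
  have h1 : MDifferentiableAt 𝓘(ℝ, E) 𝓘(ℝ, E) e (γ s) :=
    ((contMDiffOn_of_mem_maximalAtlas he).contMDiffAt (e.open_source.mem_nhds hxe)).mdifferentiableAt (by simp)
  have h2 := HasMFDerivAt.comp s h1.hasMFDerivAt hγ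
  let D : E →L[ℝ] E := mfderiv 𝓘(ℝ, E) 𝓘(ℝ, E) e (γ s)
  let B : ℝ →L[ℝ] E := velocity (x := γ s) v
  have h3 : HasFDerivAt (fun σ => e (γ σ)) (D.comp B) s := hasMFDerivAt_iff_hasFDerivAt.1 h2
  have h4 : HasDerivAt (fun σ => e (γ σ)) (D v) s :=
    h3.hasDerivAt.congr_deriv (congrArg D (one_smul ℝ v))
  have hsrc : ∀ᶠ σ in 𝓝 s, γ σ ∈ e.source := hγ.continuousAt.eventually (e.open_source.mem_nhds hxe)
  have hev : ∀ᶠ σ in 𝓝 s, e (γ σ) ∈ V := by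
    filter_upwards [hmem, hsrc] with σ h h'
    exact (hV _ h').1 h
  refine V.closed_of_finiteDimensional.mem_of_tendsto h4.tendsto_slope ?_
  filter_upwards [hev.filter_mono nhdsWithin_le_nhds] with σ hσ
  exact V.smul_mem _ (V.sub_mem hσ hev.self_of_nhds)

theorem IsLagrangian.symplForm_eq_zero (hL : X.IsLagrangian L) {γ δ : ℝ → M} {s r : ℝ} {x : M}
    (hγx : γ s = x) (hδx : δ r = x) {v w : E}
    (hγ : HasMFDerivAt 𝓘(ℝ, ℝ) 𝓘(ℝ, E) γ s (velocity (x := γ s) v)) (hγL : ∀ᶠ σ in 𝓝 s, γ σ ∈ L)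
    (hδ : HasMFDerivAt 𝓘(ℝ, ℝ) 𝓘(ℝ, E) δ r (velocity (x := δ r) w)) (hδL : ∀ᶠ σ in 𝓝 r, δ σ ∈ L) :
    X.symplForm x v w = 0 := by
  have hxL : x ∈ L := hγx ▸ hγL.self_of_nhds
  obtain ⟨e, he, V, hxe, -, hV, hω⟩ := hL x hxL
  exact hω x hxe hxL v w (mfderiv_chart_velocity_mem he hV hγx hxe hγ hγL)
    (mfderiv_chart_velocity_mem he hV hδx hxe hδ hδL)

theorem hasMFDerivAt_cone_radial (q : N) {r : ℝ} (hr : 0 < r) :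
    HasMFDerivAt 𝓘(ℝ, ℝ) 𝓘(ℝ, E) (fun t => X.cone (q, t)) r
      (velocity (x := X.cone (q, r)) (X.dcone q r (0, 1))) := by
  have h1 : HasMFDerivAt 𝓘(ℝ, ℝ) (𝓘(ℝ, E').prod 𝓘(ℝ, ℝ)) (fun t : ℝ => (q, t)) r
      ((0 : ℝ →L[ℝ] E').prod (ContinuousLinearMap.id ℝ ℝ)) :=
    (hasMFDerivAt_const q r).prodMk (hasMFDerivAt_id r)
  have h2 := HasMFDerivAt.comp r (g := X.cone) ((X.contMDiffAt_cone (q := q) hr).mdifferentiableAt (by simp)).hasMFDerivAt h1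
  refine h2.congr_mfderiv ?_
  refine ContinuousLinearMap.ext_ring ?_
  exact (one_smul ℝ (X.dcone q r (0, 1) : E)).symm

theorem hasMFDerivAt_velocity {γ : ℝ → M} {s : ℝ} (hγ : MDifferentiableAt 𝓘(ℝ, ℝ) 𝓘(ℝ, E) γ s) :
    HasMFDerivAt 𝓘(ℝ, ℝ) 𝓘(ℝ, E) γ s
      (velocity (x := γ s) ((mfderiv 𝓘(ℝ, ℝ) 𝓘(ℝ, E) γ s : ℝ →L[ℝ] E) 1)) := by
  refine hγ.hasMFDerivAt.congr_mfderiv (ContinuousLinearMap.ext_ring ?_)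
  exact (one_smul ℝ ((mfderiv 𝓘(ℝ, ℝ) 𝓘(ℝ, E) γ s : ℝ →L[ℝ] E) 1)).symm

/-- `L` is conical beyond `R`. -/
def IsConicalBeyond (X : LiouvilleManifold E M E' N) (L : Set M) (R : ℝ) : Prop :=
  ∃ Λ : Set N, ∀ (q : N) (r : ℝ), R < r → (X.cone (q, r) ∈ L ↔ q ∈ Λ)

/-- The Liouville form vanishes on the conical end of a Lagrangian. -/
theorem IsLagrangian.θ_velocity_eq_zero (hL : X.IsLagrangian L) {R : ℝ} (hR : 0 ≤ R)
    (hcone : X.IsConicalBeyond L R) {γ : ℝ → M} {s : ℝ} (hγ : MDifferentiableAt 𝓘(ℝ, ℝ) 𝓘(ℝ, E) γ s)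
    (hγL : ∀ᶠ σ in 𝓝 s, γ σ ∈ L) (hfar : γ s ∈ X.farCone R) :
    X.θ (γ s) ((mfderiv 𝓘(ℝ, ℝ) 𝓘(ℝ, E) γ s : ℝ →L[ℝ] E) 1) = 0 := by
  obtain ⟨Λ, hΛ⟩ := hcone
  obtain ⟨⟨q, r⟩, ⟨-, hr⟩, hx⟩ := hfar
  have hr' : R < r := hr
  have hr0 : 0 < r := hR.trans_lt hr'
  have hq : q ∈ Λ := (hΛ q r hr').1 (hx ▸ hγL.self_of_nhds)
  -- The radial line through the point lies in L, so ω(∂_r, v) = 0 for the velocity v, and θ(v) = r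
  -- ω(∂_r, v).
  have hδL : ∀ᶠ t in 𝓝 r, X.cone (q, t) ∈ L := by
    filter_upwards [lt_mem_nhds hr'] with t ht
    exact (hΛ q t ht).2 hq
  obtain ⟨v, hv⟩ : ∃ v : E, ((mfderiv 𝓘(ℝ, ℝ) 𝓘(ℝ, E) γ s : ℝ →L[ℝ] E) 1) = v := ⟨_, rfl⟩
  rw [hv]
  have h1 := hasMFDerivAt_velocity hγ
  rw [hv] at h1
  have h2 := hL.symplForm_eq_zero (x := X.cone (q, r)) (v := X.dcone q r (0, 1)) rfl hx.symm
    (X.hasMFDerivAt_cone_radial q hr0) hδL h1 hγL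
  have h3 : X.θ (X.cone (q, r)) v = 0 := by
    refine (X.symplForm_liouville (X.cone (q, r)) v).symm.trans ?_
    rw [X.liouville_cone q hr0]
    have : ((0 : E'), r) = r • ((0 : E'), (1 : ℝ)) := by simp
    rw [this, map_smul]
    exact (X.symplForm_smul_left (X.cone (q, r)) r (X.dcone q r (0, 1)) v).trans (mul_eq_zero_of_right r h2)
  have hcongr : ∀ y (_ : y = γ s), X.θ y v = 0 → X.θ (γ s) v = 0 := by
    intro y h; subst h; exact id
  exact hcongr _ hx h3

/-- The Liouville form on the velocity of a curve carried along by the flow. -/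
theorem IsHamiltonianFlow.θ_velocity_flow (hφ : X.IsHamiltonianFlow W φ) (hW : X.IsLinearHamiltonian W)
    {R C : ℝ} (hb : X.IsBoundedBeyond W R C) {s : ℝ} (hs : s ∈ Ioo (0 : ℝ) 1) {y : ℝ → M}
    (hy : MDifferentiableAt 𝓘(ℝ, ℝ) 𝓘(ℝ, E) y s) (hfar : φ s (y s) ∈ X.farCone (R * Real.exp C)) :
    X.θ (φ s (y s)) ((mfderiv 𝓘(ℝ, ℝ) 𝓘(ℝ, E) (fun σ => φ σ (y σ)) s : ℝ →L[ℝ] E) 1) =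
      W s (φ s (y s)) + X.θ (y s) ((mfderiv 𝓘(ℝ, ℝ) 𝓘(ℝ, E) y s : ℝ →L[ℝ] E) 1) := by
  have hs' := Ioo_subset_Icc_self hs
  have hΨ : MDifferentiableAt (𝓘(ℝ, ℝ).prod 𝓘(ℝ, E)) 𝓘(ℝ, E) (fun p : ℝ × M => φ p.1 p.2) (s, y s) :=
    (hφ.1.contMDiffAt (prod_mem_nhds (Icc_mem_nhds hs.1 hs.2) univ_mem)).mdifferentiableAt (by simp)
  have h1 : HasMFDerivAt 𝓘(ℝ, ℝ) (𝓘(ℝ, ℝ).prod 𝓘(ℝ, E)) (fun σ : ℝ => (σ, y σ)) s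
      ((ContinuousLinearMap.id ℝ ℝ).prod (mfderiv 𝓘(ℝ, ℝ) 𝓘(ℝ, E) y s)) :=
    (hasMFDerivAt_id s).prodMk hy.hasMFDerivAt
  have h2 := (HasMFDerivAt.comp s (g := fun p : ℝ × M => φ p.1 p.2) hΨ.hasMFDerivAt h1).mfderiv
  have h3 := congrArg (fun B : ℝ →L[ℝ] E => B 1) h2
  set v : E := (mfderiv 𝓘(ℝ, ℝ) 𝓘(ℝ, E) y s : ℝ →L[ℝ] E) 1 with hv
  -- The velocity splits into X_W, on which θ equals W, and the image of y' under the differential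
  -- of φ_s, on which θ equals θ(y').
  have h4 := mfderiv_prod_eq_add_apply (v := ((1, v) : ℝ × E)) hΨ
  have h5 : (mfderiv 𝓘(ℝ, ℝ) 𝓘(ℝ, E) (fun σ => φ σ (y s)) s : ℝ →L[ℝ] E) 1 =
      X.hamiltonianVectorField (W s) (φ s (y s)) := by
    have := ((hφ.2.2 s hs' (y s)).hasMFDerivAt (Icc_mem_nhds hs.1 hs.2)).mfderiv
    refine (congrArg (fun B : ℝ →L[ℝ] E => B 1) this).trans ?_
    exact one_smul ℝ (X.hamiltonianVectorField (W s) (φ s (y s)) : E)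
  have hfar' : ∀ σ ∈ Icc 0 s, φ σ (y s) ∈ X.farCone R := fun σ hσ => hφ.mem_farCone hb le_rfl hs' hfar hσ
  have h6 := hφ.θ_mfderiv hW hb hs' hfar' v
  have h7 : X.θ (φ s (y s)) (X.hamiltonianVectorField (W s) (φ s (y s))) = W s (φ s (y s)) :=
    (X.θ_hamiltonianVectorField (W s) (φ s (y s))).trans
      (hb.2.2 s hs' _ (hfar' s ⟨hs.1.le, le_rfl⟩)).2.2
  have h8 : ((mfderiv 𝓘(ℝ, ℝ) 𝓘(ℝ, E) (fun σ => φ σ (y σ)) s : ℝ →L[ℝ] E) 1) =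
      (X.hamiltonianVectorField (W s) (φ s (y s)) : E) + mfderiv 𝓘(ℝ, E) 𝓘(ℝ, E) (φ s) (y s) v := by
    rw [← h5]
    exact h3.trans h4
  rw [h8]
  refine (map_add (X.θ (φ s (y s)) : E →L[ℝ] ℝ) _ _).trans ?_
  exact congrArg₂ (fun a b : ℝ => a + b) h7 h6

end LiouvilleManifold

/-! ### The Liouville form along the moving boundary. -/

namespace LiouvilleManifold

variable {E M E' N : Type*}
  [NormedAddCommGroup E] [NormedSpace ℝ E] [TopologicalSpace M] [ChartedSpace E M]
  [NormedAddCommGroup E'] [NormedSpace ℝ E'] [TopologicalSpace N] [ChartedSpace E' N]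
  [IsManifold 𝓘(ℝ, E) ∞ M] [IsManifold 𝓘(ℝ, E') ∞ N] [FiniteDimensional ℝ E]
  {X : LiouvilleManifold E M E' N} {W : ℝ → M → ℝ} {φ : ℝ → M → M} {L : Set M}

theorem continuous_θ_velocity {γ : ℝ → M} (hγ : ContMDiff 𝓘(ℝ, ℝ) 𝓘(ℝ, E) ∞ γ) :
    Continuous fun s => X.θ (γ s) ((mfderiv 𝓘(ℝ, ℝ) 𝓘(ℝ, E) γ s : ℝ →L[ℝ] E) 1) := by
  have h := IsSmoothOneForm.continuousOn_mfderivWithin X.smooth_θ (hγ.contMDiffOn (s := univ)) uniqueDiffOn_univ 1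
  rw [← continuousOn_univ]
  refine h.congr fun s _ => ?_
  exact congrArg (fun B : ℝ →L[ℝ] E => X.θ (γ s) (B 1))
    (congrFun (mfderivWithin_univ (I := 𝓘(ℝ, ℝ)) (I' := 𝓘(ℝ, E)) (f := γ)) s).symm

variable [T2Space M] [SecondCountableTopology M]

/-- Along the moving boundary, the Liouville form on the velocity is the Hamiltonian, at a dense set
of times. -/
theorem IsHamiltonianFlow.subset_closure_θ_velocity_eq (hφ : X.IsHamiltonianFlow W φ)
    (hW : X.IsLinearHamiltonian W) {R C : ℝ} (hb : X.IsBoundedBeyond W R C) (hL : X.IsLagrangian L)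
    (hcone : X.IsConicalBeyond L R) {γ : ℝ → M} (hγ : ContMDiff 𝓘(ℝ, ℝ) 𝓘(ℝ, E) ∞ γ)
    (hγL : ∀ s ∈ Icc (0 : ℝ) 1, γ s ∈ φ s '' L) :
    Ioo 0 1 ∩ γ ⁻¹' X.farCone (R * Real.exp C) ⊆
      closure {s | s ∈ Ioo 0 1 ∩ γ ⁻¹' X.farCone (R * Real.exp C) ∧
        X.θ (γ s) ((mfderiv 𝓘(ℝ, ℝ) 𝓘(ℝ, E) γ s : ℝ →L[ℝ] E) 1) = W s (γ s)} := by
  have hR : 0 ≤ R := zero_le_one.trans hb.1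
  have hR' : 0 ≤ R * Real.exp C := mul_nonneg hR (Real.exp_pos C).le
  refine subset_closure_of_lift (Ψ := fun p : ℝ × M => φ p.1 p.2) (L := L)
    (isOpen_Ioo.inter ((X.isOpen_farCone hR').preimage hγ.continuous)) hγ.continuous.continuousOn
    (fun y hy U hU => hL.exists_isCompact_inter hy hU) (fun s hs => hγL s (Ioo_subset_Icc_self hs.1)) ?_
  intro s hs y hy he
  have hΨ : ContMDiffAt (𝓘(ℝ, ℝ).prod 𝓘(ℝ, E)) 𝓘(ℝ, E) ∞ (fun p : ℝ × M => φ p.1 p.2) (s, y) :=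
    hφ.1.contMDiffAt (prod_mem_nhds (Icc_mem_nhds hs.1.1 hs.1.2) univ_mem)
  have hfar : φ s y ∈ X.farCone (R * Real.exp C) := by
    rw [show φ s y = γ s from he]
    exact hs.2
  -- Far out φ_s is immersive, so (s, y) ↦ (s, φ_s(y)) is a local diffeomorphism and lifts confined
  -- to U are differentiable.
  obtain ⟨U, hU, hUl⟩ := exists_nhds_differentiable_lift hΨ fun v hv =>
    hφ.mfderiv_injective hW hb (Ioo_subset_Icc_self hs.1) hfar hv
  refine ⟨U ∩ Ioo 0 1 ×ˢ univ, inter_mem hU (prod_mem_nhds (Ioo_mem_nhds hs.1.1 hs.1.2) univ_mem),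
    hφ.1.continuousOn.mono fun p hp => ⟨Ioo_subset_Icc_self hp.2.1, mem_univ _⟩, ?_⟩
  intro s' hs' hev
  obtain ⟨y, hyd, hyL⟩ := hUl L γ s' ((hγ s').mdifferentiableAt (by simp))
    (hev.mono fun σ ⟨y, h1, h2, h3⟩ => ⟨y, h1, h2.1, h3⟩)
  have hγy : γ =ᶠ[𝓝 s'] fun σ => φ σ (y σ) := hyL.mono fun σ h => h.2.2.symm
  have he' : φ s' (y s') = γ s' := hyL.self_of_nhds.2.2
  have hfar' : φ s' (y s') ∈ X.farCone (R * Real.exp C) := by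
    rw [he']
    exact hs'.2
  have h1 := hφ.θ_velocity_flow hW hb hs'.1 hyd hfar'
  have h0 : φ 0 (y s') ∈ X.farCone R :=
    hφ.mem_farCone hb le_rfl (Ioo_subset_Icc_self hs'.1) hfar' ⟨le_rfl, hs'.1.1.le⟩
  rw [hφ.2.1] at h0
  rw [hL.θ_velocity_eq_zero hR hcone hyd (hyL.mono fun σ h => h.1) h0, add_zero] at h1
  have hcongr : ∀ p (_ : p = γ s') (v : E), X.θ p v = W s' p → X.θ (γ s') v = W s' (γ s') := by
    intro p hp v; subst hp; exact id
  refine Eq.trans ?_ (hcongr _ he' _ h1)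
  exact congrArg (fun B : ℝ →L[ℝ] E => X.θ (γ s') (B 1)) hγy.mfderiv_eq

/-- The equality θ(γ') = W holds only on a dense set of times, but W ≤ C r turns it into an
inequality between continuous functions, which extends to all times and to the endpoints 0 and 1. -/
theorem IsHamiltonianFlow.θ_velocity_le (hφ : X.IsHamiltonianFlow W φ)
    (hW : X.IsLinearHamiltonian W) {R C : ℝ} (hb : X.IsBoundedBeyond W R C) (hL : X.IsLagrangian L)
    (hcone : X.IsConicalBeyond L R) {γ : ℝ → M} (hγ : ContMDiff 𝓘(ℝ, ℝ) 𝓘(ℝ, E) ∞ γ)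
    (hγL : ∀ s ∈ Icc (0 : ℝ) 1, γ s ∈ φ s '' L) {s : ℝ} (hs : s ∈ Icc (0 : ℝ) 1)
    (hfar : γ s ∈ X.farCone (R * Real.exp C)) :
    X.θ (γ s) ((mfderiv 𝓘(ℝ, ℝ) 𝓘(ℝ, E) γ s : ℝ →L[ℝ] E) 1) ≤ C * X.radius (γ s) := by
  have hR : 0 ≤ R := zero_le_one.trans hb.1
  have hR' : 0 ≤ R * Real.exp C := mul_nonneg hR (Real.exp_pos C).le
  set S := {s | s ∈ Ioo 0 1 ∩ γ ⁻¹' X.farCone (R * Real.exp C) ∧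
        X.θ (γ s) ((mfderiv 𝓘(ℝ, ℝ) 𝓘(ℝ, E) γ s : ℝ →L[ℝ] E) 1) = W s (γ s)} with hS
  have h1 : s ∈ closure S := by
    refine closure_minimal (hφ.subset_closure_θ_velocity_eq hW hb hL hcone hγ hγL) isClosed_closure ?_
    rw [inter_comm]
    refine ((X.isOpen_farCone hR').preimage hγ.continuous).inter_closure ⟨hfar, ?_⟩
    rw [closure_Ioo zero_ne_one]
    exact hs
  have := mem_closure_iff_nhdsWithin_neBot.1 h1
  have hrad : ContinuousAt (fun s => X.radius (γ s)) s :=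
    (X.mdifferentiableAt_radius ((X.mem_farCone hR').1 hfar).1).continuousAt.comp hγ.continuous.continuousAt
  refine le_of_tendsto_of_tendsto ((continuous_θ_velocity hγ).continuousWithinAt (s := S) (x := s))
    ((continuousAt_const.mul hrad).continuousWithinAt (s := S)) ?_
  filter_upwards [self_mem_nhdsWithin] with σ hσ
  rw [hσ.2]
  have h2 := X.farCone_subset_farCone (le_mul_of_one_le_right hR (Real.one_le_exp hb.2.1)) hσ.1.2
  exact (le_abs_self _).trans (hb.2.2 σ (Ioo_subset_Icc_self hσ.1.1) _ h2).1

/-- The Liouville form vanishes along the image of `L` under the time-one flow. -/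
theorem IsHamiltonianFlow.θ_velocity_image_eq_zero (hφ : X.IsHamiltonianFlow W φ)
    (hW : X.IsLinearHamiltonian W) {R C : ℝ} (hb : X.IsBoundedBeyond W R C) (hL : X.IsLagrangian L)
    (hcone : X.IsConicalBeyond L R) {γ : ℝ → M} (hγ : ContMDiff 𝓘(ℝ, ℝ) 𝓘(ℝ, E) ∞ γ)
    {O : Set ℝ} (hO : IsOpen O) (hγL : ∀ s ∈ O, γ s ∈ φ 1 '' L) {s : ℝ} (hs : s ∈ O)
    (hfar : γ s ∈ X.farCone (R * Real.exp C)) :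
    X.θ (γ s) ((mfderiv 𝓘(ℝ, ℝ) 𝓘(ℝ, E) γ s : ℝ →L[ℝ] E) 1) = 0 := by
  have hR : 0 ≤ R := zero_le_one.trans hb.1
  have hR' : 0 ≤ R * Real.exp C := mul_nonneg hR (Real.exp_pos C).le
  have h01 : (1 : ℝ) ∈ Icc (0 : ℝ) 1 := ⟨zero_le_one, le_rfl⟩
  have hφ1 := hφ.contMDiff_flow h01
  have hcl : IsClosed {s | X.θ (γ s) ((mfderiv 𝓘(ℝ, ℝ) 𝓘(ℝ, E) γ s : ℝ →L[ℝ] E) 1) = 0} :=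
    isClosed_eq (continuous_θ_velocity hγ) continuous_const
  refine closure_minimal (fun s hs => hs.2) hcl (subset_closure_of_lift (Ψ := fun p : ℝ × M => φ 1 p.2) (L := L)
    (hO.inter ((X.isOpen_farCone hR').preimage hγ.continuous)) hγ.continuous.continuousOn
    (fun y hy U hU => hL.exists_isCompact_inter hy hU) (fun s hs => hγL s hs.1) ?_ ⟨hs, hfar⟩)
  intro s hs y hy he
  have hΨ : ContMDiff (𝓘(ℝ, ℝ).prod 𝓘(ℝ, E)) 𝓘(ℝ, E) ∞ (fun p : ℝ × M => φ 1 p.2) :=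
    hφ1.comp contMDiff_snd
  have hfar : φ 1 y ∈ X.farCone (R * Real.exp C) := by
    rw [show φ 1 y = γ s from he]
    exact hs.2
  obtain ⟨U, hU, hUl⟩ := exists_nhds_differentiable_lift (hΨ (s, y)) fun v hv =>
    hφ.mfderiv_injective hW hb h01 hfar hv
  refine ⟨U, hU, hΨ.continuous.continuousOn, ?_⟩
  intro s' hs' hev
  obtain ⟨y, hyd, hyL⟩ := hUl L γ s' ((hγ s').mdifferentiableAt (by simp)) hev
  have hγy : γ =ᶠ[𝓝 s'] φ 1 ∘ y := hyL.mono fun σ h => h.2.2.symm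
  have he' : φ 1 (y s') = γ s' := hyL.self_of_nhds.2.2
  have hfar' : φ 1 (y s') ∈ X.farCone (R * Real.exp C) := by
    rw [he']
    exact hs'.2
  have hall : ∀ σ ∈ Icc 0 (1 : ℝ), φ σ (y s') ∈ X.farCone R := fun σ hσ => hφ.mem_farCone hb le_rfl h01 hfar' hσ
  have h0 := hall 0 ⟨le_rfl, zero_le_one⟩
  rw [hφ.2.1] at h0
  have h1 := hφ.θ_mfderiv hW hb h01 hall ((mfderiv 𝓘(ℝ, ℝ) 𝓘(ℝ, E) y s' : ℝ →L[ℝ] E) 1)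
  have h2 := hL.θ_velocity_eq_zero hR hcone hyd (hyL.mono fun σ h => h.1) h0
  have h3 := mfderiv_comp s' ((hφ1 (y s')).mdifferentiableAt (by simp)) hyd
  have h4 : X.θ ((φ 1 ∘ y) s') ((mfderiv 𝓘(ℝ, ℝ) 𝓘(ℝ, E) (φ 1 ∘ y) s' : ℝ →L[ℝ] E) 1) = 0 :=
    (congrArg (fun B : ℝ →L[ℝ] E => X.θ ((φ 1 ∘ y) s') (B 1)) h3).trans (h1.trans h2)
  have hcongr : ∀ p (_ : p = γ s') (v : E), X.θ p v = 0 → X.θ (γ s') v = 0 := by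
    intro p hp v; subst hp; exact id
  refine Eq.trans ?_ (hcongr _ he' _ h4)
  exact congrArg (fun B : ℝ →L[ℝ] E => X.θ (γ s') (B 1)) hγy.mfderiv_eq

end LiouvilleManifold

theorem eventually_forall_of_isCompact {α β : Type*} [TopologicalSpace β] {l : Filter α} {K : Set β}
    (hK : IsCompact K) {P : α × β → Prop} (h : ∀ t ∈ K, ∀ᶠ z in l ×ˢ 𝓝[K] t, P z) :
    ∀ᶠ s in l, ∀ t ∈ K, P (s, t) := by
  refine hK.induction_on (p := fun T => ∀ᶠ s in l, ∀ t ∈ T, P (s, t)) (by simp)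
    (fun A B hAB hB => hB.mono fun s hs t ht => hs t (hAB ht))
    (fun A B hA hB => (hA.and hB).mono fun s hs t ht => ht.elim (hs.1 t) (hs.2 t)) fun t ht => ?_
  obtain ⟨pa, hpa, pb, hpb, hP⟩ := eventually_prod_iff.1 (h t ht)
  exact ⟨{t | pb t}, hpb, hpa.mono fun s hs t ht => hP hs ht⟩

theorem isAdmissibleOneForm_dtForm : IsAdmissibleOneForm (fun _ => dtForm) where
  smooth := contDiff_const
  closed := fun z v w => by simp
  eq_dt_ends := ⟨0, fun _ _ _ => rfl⟩
  eq_dt_near := Eventually.of_forall fun _ => rfl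

/-! ### Confinement of Floer strips. -/

namespace LiouvilleManifold

variable {E M E' N : Type*}
  [NormedAddCommGroup E] [NormedSpace ℝ E] [TopologicalSpace M] [ChartedSpace E M]
  [NormedAddCommGroup E'] [NormedSpace ℝ E'] [TopologicalSpace N] [ChartedSpace E' N]
  [IsManifold 𝓘(ℝ, E) ∞ M] [IsManifold 𝓘(ℝ, E') ∞ N] [FiniteDimensional ℝ E]
  {X : LiouvilleManifold E M E' N} {W : ℝ → M → ℝ} {φ : ℝ → M → M} {K L : Set M}
  {c : ℝ → ℝ} {H : ℝ → M → ℝ} {J : ∀ x : M, TangentSpace 𝓘(ℝ, E) x →L[ℝ] TangentSpace 𝓘(ℝ, E) x}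

theorem contMDiff_horizontal {u : ℝ × ℝ → M} (hu : ContMDiffOn 𝓘(ℝ, ℝ × ℝ) 𝓘(ℝ, E) ∞ u strip) {t : ℝ}
    (ht : t ∈ Icc (0 : ℝ) 1) : ContMDiff 𝓘(ℝ, ℝ) 𝓘(ℝ, E) ∞ (fun s => u (s, t)) := by
  have h : ContMDiff 𝓘(ℝ, ℝ) 𝓘(ℝ, ℝ × ℝ) ∞ (fun s : ℝ => (s, t)) :=
    (contDiff_id.prodMk contDiff_const).contMDiff
  exact contMDiffOn_univ.1 (hu.comp h.contMDiffOn fun s _ => ⟨mem_univ s, ht⟩)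

/-- The derivative of `log (r ∘ u)` in the direction of the interval. -/
theorem hasDerivWithinAt_log_radius (hH : X.IsQuadraticHamiltonian c H) (hJ : X.IsContactTypeStructure J)
    {u : ℝ × ℝ → M} (hu : ContMDiffOn 𝓘(ℝ, ℝ × ℝ) 𝓘(ℝ, E) ∞ u strip)
    (heq : ∀ z ∈ strip, (1 / 2 : ℝ) • (X.perturbedDeriv H (fun _ => dtForm) u z +
      (J (u z)).comp ((X.perturbedDeriv H (fun _ => dtForm) u z).comp stripJ)) = 0)
    {s t : ℝ} (ht : t ∈ Icc (0 : ℝ) 1) (hx : u (s, t) ∈ X.farCone 1) :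
    HasDerivWithinAt (fun t => Real.log (X.radius (u (s, t))))
      (-X.θ (u (s, t)) ((mfderiv 𝓘(ℝ, ℝ) 𝓘(ℝ, E) (fun s => u (s, t)) s : ℝ →L[ℝ] E) 1) /
        X.radius (u (s, t))) (Icc 0 1) t := by
  have hz : (s, t) ∈ strip := ⟨mem_univ _, ht⟩
  have hxt := ((X.mem_farCone zero_le_one).1 hx).1
  have hD := ((hu.mdifferentiableOn (by simp)) (s, t) hz).hasMFDerivWithinAt
  set D : ℝ × ℝ →L[ℝ] E := mfderivWithin 𝓘(ℝ, ℝ × ℝ) 𝓘(ℝ, E) u strip (s, t) with hDdef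
  have h1 : HasMFDerivWithinAt 𝓘(ℝ, ℝ) 𝓘(ℝ, ℝ × ℝ) (fun s : ℝ => (s, t)) univ s
      (ContinuousLinearMap.inl ℝ ℝ ℝ) := (hasFDerivAt_prodMk_left s t).hasMFDerivAt.hasMFDerivWithinAt
  have hs1 : univ ⊆ (fun σ : ℝ => (σ, t)) ⁻¹' strip := fun σ _ => ⟨mem_univ σ, ht⟩
  have hs2 : Icc 0 1 ⊆ (fun τ : ℝ => (s, τ)) ⁻¹' strip := fun τ hτ => ⟨mem_univ s, hτ⟩
  have h2 := (hasMFDerivWithinAt_univ.1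
    (HasMFDerivWithinAt.comp s (g := u) hD h1 hs1)).mfderiv
  have h3 : (mfderiv 𝓘(ℝ, ℝ) 𝓘(ℝ, E) (fun s => u (s, t)) s : ℝ →L[ℝ] E) 1 = D (1, 0) :=
    congrArg (fun B : ℝ →L[ℝ] E => B 1) h2
  have h4 : HasMFDerivWithinAt 𝓘(ℝ, ℝ) 𝓘(ℝ, ℝ × ℝ) (fun t : ℝ => (s, t)) (Icc 0 1) t
      (ContinuousLinearMap.inr ℝ ℝ ℝ) := (hasFDerivAt_prodMk_right s t).hasMFDerivAt.hasMFDerivWithinAt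
  have h5 := HasMFDerivWithinAt.comp t (g := u) hD h4 hs2
  have h6 := HasMFDerivAt.comp_hasMFDerivWithinAt t (g := X.radius)
    (X.mdifferentiableAt_radius hxt).hasMFDerivAt h5
  let dr' : E →L[ℝ] ℝ := X.dr (u (s, t))
  have h7 : HasFDerivWithinAt (fun t => X.radius (u (s, t))) (dr'.comp (D.comp (ContinuousLinearMap.inr ℝ ℝ ℝ)))
      (Icc 0 1) t := hasMFDerivWithinAt_iff_hasFDerivWithinAt.1 h6
  have h8 := (dr_deriv_of_floer hH hJ hx (apply_deriv_eq_of_floer hJ (heq _ hz))).2.1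
  have h9 : HasDerivWithinAt (fun t => X.radius (u (s, t))) (-X.θ (u (s, t)) (D (1, 0))) (Icc 0 1) t :=
    h7.hasDerivWithinAt.congr_deriv h8
  rw [h3]
  exact h9.log (X.radius_pos hxt).ne'

/-- Points of the strip mapped to F have bounded s, so the maximum principle can be applied on a
compact rectangle. -/
theorem exists_forall_notMem_of_tendsto {u : ℝ × ℝ → M} {xm xp : ℝ → M} {F : Set M} (hF : IsClosed F)
    (hl : ∀ t ∈ Icc (0 : ℝ) 1, Tendsto u (atBot ×ˢ 𝓝[Icc 0 1] t) (𝓝 (xm t)))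
    (hr : ∀ t ∈ Icc (0 : ℝ) 1, Tendsto u (atTop ×ˢ 𝓝[Icc 0 1] t) (𝓝 (xp t)))
    (hm : ∀ t ∈ Icc (0 : ℝ) 1, xm t ∉ F) (hp : ∀ t ∈ Icc (0 : ℝ) 1, xp t ∉ F) :
    ∃ S : ℝ, ∀ z ∈ strip, u z ∈ F → z.1 ∈ Ioo (-S) S := by
  have h1 := eventually_forall_of_isCompact isCompact_Icc fun t ht =>
    (hl t ht).eventually (hF.isOpen_compl.mem_nhds (hm t ht))
  have h2 := eventually_forall_of_isCompact isCompact_Icc fun t ht =>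
    (hr t ht).eventually (hF.isOpen_compl.mem_nhds (hp t ht))
  obtain ⟨a, ha⟩ := eventually_atBot.1 h1
  obtain ⟨b, hb⟩ := eventually_atTop.1 h2
  refine ⟨max (-a) b, ?_⟩
  rintro ⟨s, t⟩ ⟨-, ht⟩ hz
  constructor
  · by_contra! h
    exact ha s (h.trans (by linarith [le_max_left (-a) b])) t ht hz
  · by_contra! h
    exact hb s ((le_max_right (-a) b).trans h) t ht hz

variable [T2Space M] [SecondCountableTopology M]

/-- Floer strips whose ends do not reach `N × [ρ₁, ∞)` stay in a fixed compact set. -/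
theorem IsFloerStrip.notMem_farCone (hK : X.IsLagrangian K) (hL : X.IsLagrangian L)
    (hW : X.IsLinearHamiltonian W) (hφ : X.IsHamiltonianFlow W φ) {R C : ℝ} (hb : X.IsBoundedBeyond W R C)
    (hKR : X.IsConicalBeyond K R) (hLR : X.IsConicalBeyond L R)
    (hH : X.IsQuadraticHamiltonian c H) (hJ : X.IsContactTypeStructure J) {χ : ℝ → ℝ} {ρ₀ ρ₁ : ℝ}
    (hχ : ContDiff ℝ ∞ χ) (hχ0 : ∀ s, 0 ≤ χ s) (hχ1 : ∀ s, χ s ≤ 1) (hχI : ∀ s ∈ Icc (0 : ℝ) 1, χ s = 1)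
    (hρ₀ : 0 ≤ ρ₀)
    (hcχ : ∀ s, ∀ τ ∈ Icc (0 : ℝ) 1, ∀ r ≥ ρ₀, 0 ≤ 2 * r * (-deriv c s + c s * (C * deriv χ s * τ)) +
      C * deriv (deriv χ) s * τ - 2 * C * χ s)
    (hρ₀₁ : ρ₀ ≤ ρ₁) (hRρ : R * Real.exp C ≤ ρ₁) {xm xp : ℝ → M}
    (hm : ∀ t ∈ Icc (0 : ℝ) 1, xm t ∉ X.cone '' (univ ×ˢ Ici ρ₁))
    (hp : ∀ t ∈ Icc (0 : ℝ) 1, xp t ∉ X.cone '' (univ ×ˢ Ici ρ₁)) {u : ℝ × ℝ → M}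
    (hu : X.IsFloerStrip H J (fun _ => dtForm) K L φ xm xp u) {z : ℝ × ℝ} (hz : z ∈ strip) :
    u z ∉ X.farCone (ρ₁ * Real.exp (C + 1)) := by
  obtain ⟨hR, hC, -⟩ := id hb
  have hR0 : 0 ≤ R := zero_le_one.trans hR
  have hReR : R ≤ R * Real.exp C := le_mul_of_one_le_right hR0 (Real.one_le_exp hC)
  have hρ1 : 1 ≤ ρ₁ := hR.trans (hReR.trans hRρ)
  have hρ0 : 0 < ρ₁ := one_pos.trans_le hρ1
  have hFcl := X.isClosed_image_cone_Ici hρ1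
  set F := X.cone '' (univ ×ˢ Ici ρ₁) with hF
  have hFmem : ∀ x ∈ F, x ∈ X.cone.target := by
    rintro x ⟨⟨q, r⟩, ⟨-, hr⟩, rfl⟩
    exact X.cone_mem_target (hρ0.trans_le hr)
  have hfarF : X.farCone ρ₁ ⊆ F := image_mono (prod_mono_right Ioi_subset_Ici_self)
  obtain ⟨S, hS⟩ := exists_forall_notMem_of_tendsto hFcl hu.tendsto_left hu.tendsto_right hm hp
  -- D is defined by the closed condition r ≥ ρ₁, hence compact; where r > ρ₁ it is a neighbourhood
  -- within the strip.
  let D : Set (ℝ × ℝ) := (Icc (-S) S ×ˢ Icc 0 1) ∩ u ⁻¹' F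
  have hsub : Icc (-S) S ×ˢ Icc (0 : ℝ) 1 ⊆ strip := prod_mono_left (subset_univ _)
  have hDcl : IsClosed D := (hu.smooth.continuousOn.mono hsub).preimage_isClosed_of_isClosed
    (isClosed_Icc.prod isClosed_Icc) hFcl
  have hDc : IsCompact D := (isCompact_Icc.prod isCompact_Icc).of_isClosed_subset hDcl inter_subset_left
  have hmemD : ∀ y ∈ strip, u y ∈ F → y ∈ D := fun y hy hyF =>
    ⟨⟨Ioo_subset_Icc_self (hS y hy hyF), hy.2⟩, hyF⟩
  have hfar : ∀ y ∈ D, Real.log ρ₁ < Real.log (X.radius (u y)) → u y ∈ X.farCone ρ₁ := by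
    intro y hy h
    have h1 := hFmem _ hy.2
    exact (X.mem_farCone hρ0.le).2 ⟨h1, (Real.log_lt_log_iff hρ0 (X.radius_pos h1)).1 h⟩
  have hrad : ContinuousOn (fun y => Real.log (X.radius (u y))) D := by
    intro y hy
    have h1 := hFmem _ hy.2
    have h2 : ContinuousAt (fun x => Real.log (X.radius x)) (u y) :=
      (X.mdifferentiableAt_radius h1).continuousAt.log (X.radius_pos h1).ne'
    exact h2.comp_continuousWithinAt
      ((hu.smooth.continuousOn y (hsub hy.1)).mono (inter_subset_left.trans hsub))
  have hrde : ∀ (s t : ℝ), t ∈ Icc (0 : ℝ) 1 → u (s, t) ∈ X.farCone ρ₁ → _ := fun s t ht h =>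
    hasDerivWithinAt_log_radius (s := s) hH hJ hu.smooth hu.equation ht (X.farCone_subset_farCone hρ1 h)
  have h0 : (0 : ℝ) ∈ Icc (0 : ℝ) 1 := ⟨le_rfl, zero_le_one⟩
  have h1 : (1 : ℝ) ∈ Icc (0 : ℝ) 1 := ⟨zero_le_one, le_rfl⟩
  have hlowsm := contMDiff_horizontal hu.smooth h0
  have hupsm := contMDiff_horizontal hu.smooth h1
  have hmain := le_of_subsolution (m := Real.log ρ₁) (ρ := fun y => X.radius (u y)) hC hχ hχ0 hχ1 hH.c_pos hcχ hρ₀ hDc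
    inter_subset_left hrad ?_ ?_ ?_ ?_
  · intro hzf
    obtain ⟨hzt, hzr⟩ := (X.mem_farCone (mul_pos hρ0 (Real.exp_pos _)).le).1 hzf
    have hzF : u z ∈ F := hfarF (X.farCone_subset_farCone
      (le_mul_of_one_le_right hρ0.le (Real.one_le_exp (by linarith))) hzf)
    have h2 := hmain z (hmemD z hz hzF)
    have h3 := Real.exp_le_exp.2 h2
    rw [Real.exp_log (X.radius_pos hzt), add_assoc, Real.exp_add, Real.exp_log hρ0] at h3
    exact hzr.not_ge h3
  · intro y hy h
    have h2 := hfar y hy h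
    refine ⟨hρ₀₁.trans ((X.mem_farCone hρ0.le).1 h2).2.le, ?_⟩
    filter_upwards [self_mem_nhdsWithin,
      (hu.smooth.continuousOn y (hsub hy.1)).eventually ((X.isOpen_farCone hρ0.le).mem_nhds h2)] with w hw hw2
    exact hmemD w hw (hfarF hw2)
  · intro y hy h hy2
    exact log_radius_subsolution hH hJ hu.smooth hu.equation hy2
      (X.farCone_subset_farCone hρ1 (hfar y hy h))
  · intro s hs h
    have h2 := hfar _ hs h
    have h3 := X.farCone_subset_farCone hRρ h2
    have h4 := X.radius_pos (hFmem _ hs.2)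
    refine ⟨_, ?_, hrde s 0 h0 h2⟩
    have hzero : X.θ (u (s, 0)) ((mfderiv 𝓘(ℝ, ℝ) 𝓘(ℝ, E) (fun s => u (s, 0)) s : ℝ →L[ℝ] E) 1) = 0 →
        -(C * χ s) ≤ -X.θ (u (s, 0)) ((mfderiv 𝓘(ℝ, ℝ) 𝓘(ℝ, E) (fun s => u (s, 0)) s : ℝ →L[ℝ] E) 1) /
          X.radius (u (s, 0)) := by
      intro h
      rw [h, neg_zero, zero_div, neg_nonpos]
      exact mul_nonneg hC (hχ0 s)
    -- Three boundary regimes: θ(∂_s u) vanishes along L for s < 0 and along φ_1(L) for s > 1, and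
    -- is at most C r on [0, 1], where χ = 1.
    rcases lt_or_ge s 0 with hs0 | hs0
    · refine hzero (hL.θ_velocity_eq_zero hR0 hLR ((hlowsm s).mdifferentiableAt (by simp)) ?_
        (X.farCone_subset_farCone hReR h3))
      filter_upwards [Iio_mem_nhds hs0] with σ hσ
      exact hu.lower_left σ (le_of_lt hσ)
    rcases le_or_gt s 1 with hs1 | hs1
    · rw [hχI s ⟨hs0, hs1⟩, mul_one, le_div_iff₀ h4, neg_mul, neg_le_neg_iff]
      exact hφ.θ_velocity_le hW hb hL hLR hlowsm hu.lower_moving ⟨hs0, hs1⟩ h3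
    · exact hzero (hφ.θ_velocity_image_eq_zero hW hb hL hLR hlowsm isOpen_Ioi
        (fun σ hσ => hu.lower_right σ (le_of_lt hσ)) hs1 h3)
  · intro s hs h
    have h2 := hfar _ hs h
    refine (hrde s 1 h1 h2).congr_deriv ?_
    have h3 := hK.θ_velocity_eq_zero hR0 hKR ((hupsm s).mdifferentiableAt (by simp))
      (Eventually.of_forall hu.upper) (X.farCone_subset_farCone (hReR.trans hRρ) h2)
    rw [div_eq_zero_iff, neg_eq_zero]
    exact Or.inl h3

end LiouvilleManifold

end

/-! ### Choice of the Floer data and of the compact set. -/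

theorem mainTheorem3 {E M E' N : Type*}
    [NormedAddCommGroup E] [NormedSpace ℝ E] [FiniteDimensional ℝ E]
    [TopologicalSpace M] [T2Space M] [ChartedSpace E M] [IsManifold 𝓘(ℝ, E) ∞ M]
    [NormedAddCommGroup E'] [NormedSpace ℝ E'] [FiniteDimensional ℝ E']
    [TopologicalSpace N] [T2Space N] [CompactSpace N] [ChartedSpace E' N]
    [IsManifold 𝓘(ℝ, E') ∞ N]
    (X : LiouvilleManifold E M E' N)
    (K : Set M) (hK : X.IsLagrangian K) (hK' : X.HasConicalEnd K)
    (L : Set M) (hL : X.IsLagrangian L) (hL' : X.HasConicalEnd L)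
    (W : ℝ → M → ℝ) (hW : X.IsLinearHamiltonian W)
    (φ : ℝ → M → M) (hφ : X.IsHamiltonianFlow W φ)
    (A : ℝ) :
    ∃ (c : ℝ → ℝ) (H : ℝ → M → ℝ)
      (J : ∀ x : M, TangentSpace 𝓘(ℝ, E) x →L[ℝ] TangentSpace 𝓘(ℝ, E) x)
      (γ : ℝ × ℝ → ℝ × ℝ →L[ℝ] ℝ),
      X.IsQuadraticHamiltonian c H ∧ (∀ s ∈ Icc (0 : ℝ) 1, deriv c s ≤ -A) ∧
      X.IsContactTypeStructure J ∧ IsAdmissibleOneForm γ ∧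
      ∀ B : Set M, IsCompact B → ∃ B' : Set M, IsCompact B' ∧
        ∀ xm xp : ℝ → M,
          X.IsChord (H (-1)) L K xm → MapsTo xm (Icc 0 1) B →
          X.IsChord (H 2) (φ 1 '' L) K xp → MapsTo xp (Icc 0 1) B →
          ∀ u : ℝ × ℝ → M, X.IsFloerStrip H J γ K L φ xm xp u → MapsTo u strip B' := by
  have := X.sigmaCompactSpace
  have : SecondCountableTopology M := ChartedSpace.secondCountable_of_sigmaCompact E M
  obtain ⟨R₁, hR₁, C, hC, hbd⟩ := hW.exists_bound
  obtain ⟨RK, -, ΛK, hΛK⟩ := hK'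
  obtain ⟨RL, -, ΛL, hΛL⟩ := hL'
  obtain ⟨c, χ, ρ₀, hc, hc0, hcl, hcr, hcA, hχ, hχ0, hχ1, hχI, hρ₀, hcχ⟩ := exists_growth_profile A C hC
  obtain ⟨G, hG, hG0, hGr⟩ := X.exists_radius_sq
  obtain ⟨J, hJ⟩ := X.exists_isContactTypeStructure
  -- Beyond R the Hamiltonian bounds hold and both Lagrangians are conical.
  set R := max R₁ (max RK RL) with hR
  have hb : X.IsBoundedBeyond W R C := ⟨hR₁.trans (le_max_left _ _), hC, fun s hs x hx =>
    hbd s hs x (X.farCone_subset_farCone (le_max_left _ _) hx)⟩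
  have hKR : X.IsConicalBeyond K R := ⟨ΛK, fun q r hr =>
    hΛK q r (((le_max_left _ _).trans (le_max_right _ _)).trans_lt hr)⟩
  have hLR : X.IsConicalBeyond L R := ⟨ΛL, fun q r hr =>
    hΛL q r (((le_max_right _ _).trans (le_max_right _ _)).trans_lt hr)⟩
  have hH : X.IsQuadraticHamiltonian c (fun s x => c s * G x) :=
    { smooth_c := hc
      c_pos := hc0
      smooth := (hc.contMDiff.comp contMDiff_fst).mul (hG.comp contMDiff_snd)
      pos := fun s x => mul_pos (hc0 s) (hG0 x)
      quadratic := fun s x hx => by rw [hGr x hx]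
      eq_left := fun s hs => by rw [hcl s hs]
      eq_right := fun s hs => by rw [hcr s hs] }
  refine ⟨c, fun s x => c s * G x, J, fun _ => dtForm, hH, hcA, hJ, isAdmissibleOneForm_dtForm, ?_⟩
  intro B hB
  have hBc : IsCompact (B ∩ X.infiniteCone) := hB.inter_right X.isClosed_infiniteCone
  obtain ⟨b, hbB⟩ := hBc.bddAbove_image (f := X.radius) fun x hx =>
    (X.mdifferentiableAt_radius (X.infiniteCone_subset_target hx.2)).continuousAt.continuousWithinAt
  -- ρ₁ exceeds the radius of every point of B on the cone, the threshold ρ₀ of the profile, and R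
  -- exp(C), beyond which points reached by the flow have stayed beyond R.
  set ρ₁ := max (max ρ₀ (R * Real.exp C)) (b + 1) with hρ₁
  have hRρ : R * Real.exp C ≤ ρ₁ := (le_max_right _ _).trans (le_max_left _ _)
  have hρ1 : 1 ≤ ρ₁ := (one_le_mul_of_one_le_of_one_le hb.1 (Real.one_le_exp hC)).trans hRρ
  have hBfar : ∀ x ∈ B, x ∉ X.cone '' (univ ×ˢ Ici ρ₁) := by
    rintro x hx ⟨⟨q, r⟩, ⟨-, hr⟩, rfl⟩
    have hr' : ρ₁ ≤ r := hr
    have h1 := hbB ⟨_, ⟨hx, ⟨(q, r), ⟨mem_univ _, hρ1.trans hr'⟩, rfl⟩⟩, rfl⟩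
    rw [X.radius_cone (one_pos.trans_le (hρ1.trans hr'))] at h1
    linarith [le_max_right (max ρ₀ (R * Real.exp C)) (b + 1)]
  refine ⟨(X.farCone (ρ₁ * Real.exp (C + 1)))ᶜ, X.isCompact_compl_image_cone
    (one_le_mul_of_one_le_of_one_le hρ1 (Real.one_le_exp (by linarith))), ?_⟩
  intro xm xp _ hxm _ hxp u hu z hz
  exact hu.notMem_farCone hK hL hW hφ hb hKR hLR hH hJ hχ hχ0 hχ1 hχI hρ₀ hcχ
    ((le_max_left _ _).trans (le_max_left _ _)) hRρ (fun t ht => hBfar _ (hxm ht))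
    (fun t ht => hBfar _ (hxp ht)) hz
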